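/- **Setting.** Let $\mathcal M=(\mathcal S,\mathcal A,P,r^{\rm true},H,s_1)$ be an episodic MDP with horizon $H\ge 1$, transition kernels $P_h(\cdot\mid s,a)$, $h\in[H]$, fixed initial state $s_1$ and unknown true reward $r^{\rm true}=(r^{\rm true}_1,\dots,r^{\rm true}_H)$. For a policy $\pi=(\pi_1,\dots,\pi_H)$ and a reward $r$, $V^\pi_r$ is the expected value of $\sum_{h=1}^H r_h(s_h,a_h)$ when $a_h\sim\pi_h(\cdot|s_h)$, $s_{h+1}\sim P_h(\cdot|s_h,a_h)$; $Q^{\pi,r}_h(s,a)$ is the expected reward from step $h$ on given $(s_h,a_h)=(s,a)$, and $Q^{\star,r}_h=\sup_\pi Q^{\pi,r}_h$. The Bellman operator is $(\mathcal T^r_hg)(s,a)=r_h(s,a)+\mathbb E_{s'\sim P_h(\cdot|s,a)}[\max_{a'}g(s',a')]$. We are given a reward class $\mathcal R=\mathcal R_1\times\dots\times\mathcal R_H$ with $\mathcal R_h\subseteq(\mathcal S\times\mathcal A\to[0,1])$ and a Q-class $\mathcal Q=\mathcal Q_1\times\dots\times\mathcal Q_H$ with $\mathcal Q_h\subseteq(\mathcal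 S\times\mathcal A\to[0,H])$, all functions being measurable, with $Q_{H+1}\equiv0$; maxima over actions of functions in $\mathcal Q_h$ are attained, at an action $\arg\max_a Q_h(s,a)$ chosen by a fixed measurable rule. $\mathcal N_\rho(\mathcal F)$ is the least cardinality of a subset of $\mathcal F$ such that every $f\in\mathcal F$ is within sup-distance $\rho$ of a member of it; for $\mathcal R$ and $\mathcal Q$ the supremum is also over $h$. **Assumptions.** (1) $r^{\rm true}\in\mathcal R$. (2) For all $r\in\mathcal R$: $Q^{\star,r}\in\mathcal Q$, and $\mathcal T^r_h\mathcal Q_{h+1}\subseteq\mathcal Q_h$ for all $h\in[H]$. **Generalized eluder coefficient.** For $\epsilon'>0$ and the number $K$ of iterations, $d_{\rm GEC}(\epsilon')$ is the smallest $d\ge0$ such that for all $r^1,\dots,r^K\in\mathcal R$ and $f^1,\dots,f^K\in\mathcal Q$ with greedy policies $\pi^k_h(s)=\arg\max_af^k_h(s,a)$, $$\sum_{k=1}^K\Big(\max_af^k_1(s_1,a)-V^{\pi^k}_{r^k}\Big)\le\inf_{\mu>0}\Big\{\frac\mu2\sum_{k=1}^K\sum_{i=1}^{k-1}\mathbb E\Big[\sum_{h=1}^H\big(f^k_h-\mathcal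 T^{r^k}_hf^k_{h+1}\big)^2(s_h,a_h)\,\Big|\,\pi^i\Big]+\frac d{2\mu}\Big\}+\sqrt{dHK}+\epsilon'HK .$$ **Algorithm (model-free OPT-AIL).** Input: $N$ i.i.d. trajectories of an expert policy $\pi^{\rm E}$, an arbitrary initial policy $\pi^0$, and $\lambda_Q>0$. Let $\tau^i=(s^i_1,a^i_1,\dots,s^i_H,a^i_H)$ be the trajectory rolled out by $\pi^i$, $\widehat V^{\pi^i}_r=\sum_hr_h(s^i_h,a^i_h)$, and $\widehat V^{\pi^{\rm E}}_r$ the average of $\sum_hr_h$ over the expert trajectories. For $k=1,\dots,K$: roll out $\tau^{k-1}$; choose $r^k\in\mathcal R$ and then $Q^k\in\mathcal Q$ from the data gathered so far (expert data and $\tau^0,\dots,\tau^{k-1}$) and possibly internal randomness; let $\pi^k$ be the greedy policy of $Q^k$. Here $r^k$ is the output of an online learner for the losses $\mathcal L^i(r)=\widehat V^{\pi^i}_r-\widehat V^{\pi^{\rm E}}_r$, whose reward optimization error is $$\varepsilon^r_{\rm opt}=\frac1K\sup_{r\in\mathcal R}\sum_{k=1}^K\big(\mathcal L^k(r^k)-\mathcal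 L^k(r)\big),$$ and $Q^k$ is an approximate minimizer over $\mathcal Q$ of $$\mathcal L^k(Q)=\sum_{h=1}^H\Big(\mathcal E^k_h(Q_h,Q_{h+1})-\inf_{Q_h'\in\mathcal Q_h}\mathcal E^k_h(Q_h',Q_{h+1})\Big)-\lambda_Q\max_aQ_1(s_1,a),$$ $$\mathcal E^k_h(g,g')=\sum_{i=0}^{k-1}\big(g(s^i_h,a^i_h)-r^k_h(s^i_h,a^i_h)-\max_{a'}g'(s^i_{h+1},a')\big)^2,$$ with optimization error $\varepsilon^Q_{\rm opt}=\max_{1\le k\le K}\big(\mathcal L^k(Q^k)-\inf_{Q\in\mathcal Q}\mathcal L^k(Q)\big)$. The output $\bar\pi$ draws $k$ uniformly from $\{1,\dots,K\}$ and then follows $\pi^k$. **Theorem.** There are absolute constants $c_1,c_2,C>0$ such that the following holds in the above setting under assumptions (1) and (2). Let $\varepsilon,\delta\in(0,1]$, let $d\ge1$ be a real number with $d\ge d_{\rm GEC}(\varepsilon/(6H))$ (for instance $d=\max\{1,d_{\rm GEC}(\varepsilon/(6H))\}$), let $\rho=c_2\varepsilon^2/(H^3d+H)$, assume that $\mathcal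 N_\rho(\mathcal R_h)$ and $\mathcal N_\rho(\mathcal Q_h)$ are finite for all $h\in[H]$, and run the algorithm with $$\lambda_Q=c_1\sqrt{\frac{KH^3\log\big(4KH\,\mathcal N_\rho(\mathcal Q)\mathcal N_\rho(\mathcal R)/\delta\big)+K^2H^3\rho}{d}} .$$ If $$N\ge\frac{C\,H^2\log\big(\max_{h}\mathcal N_\rho(\mathcal R_h)/\delta\big)}{\varepsilon^2},\qquad K\ge\frac{C\Big(H^4d\,\log\big(Hd\max_{h}\mathcal N_\rho(\mathcal Q_h)\mathcal N_\rho(\mathcal R_h)/(\delta\varepsilon)\big)+H^2\log(1/\delta)\Big)}{\varepsilon^2},$$ then with probability at least $1-\delta$, $$V^{\pi^{\rm E}}_{r^{\rm true}}-V^{\bar\pi}_{r^{\rm true}}\le\varepsilon+\varepsilon^r_{\rm opt}+\frac{\varepsilon^Q_{\rm opt}}{\lambda_Q}.$$ -/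

import Mathlib

open MeasureTheory ProbabilityTheory
open scoped ENNReal

namespace OptAIL

/-! Time steps are `0, …, H - 1` (for `1, …, H`).  Functions of the time step are indexed by `ℕ`;
only the values at steps below `H` (and the zero function at later steps) ever matter. -/

/-- An episodic Markov decision process with horizon `H`, transition kernels `P h`,
fixed initial state `s₁` and true reward `rTrue`. -/
structure MDP (S A : Type*) [MeasurableSpace S] [MeasurableSpace A] where
  H : ℕ
  P : ℕ → Kernel (S × A) S
  markov : ∀ h, IsMarkovKernel (P h)
  s₁ : S
  rTrue : ℕ → S × A → ℝ

/-- A non-stationary policy: `π h s` is the law of the action taken in state `s` at step `h`. -/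
abbrev Policy (S A : Type*) [MeasurableSpace S] [MeasurableSpace A] := ℕ → Kernel S A

/-- A trajectory with `n` steps: the states `s_0, …, s_n` and the actions `a_0, …, a_{n-1}`. -/
abbrev Traj (S A : Type*) (n : ℕ) := (Fin (n + 1) → S) × (Fin n → A)

section
variable {S A : Type*}

/-- The state-action pair at step `i` of a trajectory. -/
def Traj.sa {n : ℕ} (τ : Traj S A n) (i : Fin n) : S × A := (τ.1 i.castSucc, τ.2 i)

/-- The state reached after step `i` of a trajectory. -/
def Traj.next {n : ℕ} (τ : Traj S A n) (i : Fin n) : S := τ.1 i.succ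

/-- Total reward collected along a trajectory whose first step is step `h`. -/
def ret {n : ℕ} (r : ℕ → S × A → ℝ) (h : ℕ) (τ : Traj S A n) : ℝ :=
  ∑ i : Fin n, r (h + i) (τ.sa i)

/-- The trajectory that starts with the state `s`, the action `a` and continues as `τ`. -/
def Traj.cons {n : ℕ} (p : S × A × Traj S A n) : Traj S A (n + 1) :=
  (Fin.cons p.1 p.2.2.1, Fin.cons p.2.1 p.2.2.2)

/-- The class `F_0 × ⋯ × F_{H-1}`; its members vanish at steps `h ≥ H`. -/
def prodClass (H : ℕ) (F : ℕ → Set (S × A → ℝ)) : Set (ℕ → S × A → ℝ) :=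
  {f | (∀ h < H, f h ∈ F h) ∧ ∀ h, H ≤ h → f h = 0}

/-- `max_a g (s, a)`. -/
noncomputable def maxA (g : S × A → ℝ) (s : S) : ℝ := ⨆ a : A, g (s, a)

end

/-! ### Covering numbers -/

/-- The covering number of a class of real functions in the supremum distance, with the centres
taken from the class; it is `⊤` if there is no finite cover. -/
noncomputable def coveringNumber {X : Type*} (ρ : ℝ) (F : Set (X → ℝ)) : ℕ∞ :=
  ⨅ (F' : Set (X → ℝ)) (_ : F' ⊆ F ∧ ∀ f ∈ F, ∃ f' ∈ F', ∀ x, |f x - f' x| ≤ ρ), F'.encard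

/-- The covering number as a natural number, to be used when it is finite. -/
noncomputable def covN {X : Type*} (ρ : ℝ) (F : Set (X → ℝ)) : ℕ := (coveringNumber ρ F).toNat

/-- The covering number of a class of families of functions, seen as functions on
`steps × X`. -/
noncomputable def covNProd {X : Type*} (ρ : ℝ) (F : Set (ℕ → X → ℝ)) : ℕ :=
  covN ρ ((fun f (p : ℕ × X) => f p.1 p.2) '' F)

section
variable {S A : Type*} [MeasurableSpace S] [MeasurableSpace A]

theorem Traj.measurable_cons {n : ℕ} : Measurable (Traj.cons : S × A × Traj S A n → _) := by
  refine Measurable.prodMk ?_ ?_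
  · refine measurable_pi_lambda _ fun i => ?_
    refine Fin.cases ?_ (fun j => ?_) i
    · simpa using measurable_fst
    · simp only [Fin.cons_succ]; fun_prop
  · refine measurable_pi_lambda _ fun i => ?_
    refine Fin.cases ?_ (fun j => ?_) i
    · simp only [Fin.cons_zero]; fun_prop
    · simp only [Fin.cons_succ]; fun_prop

/-! ### Trajectories and values -/

/-- The law of `n` steps of the interaction of `π` with the MDP, started at step `h`, as a kernel
in the initial state: draw `a ∼ π h s`, then `s' ∼ P h (s, a)`, then continue from `s'` at step
`h + 1`. -/
noncomputable def rollout (M : MDP S A) (π : Policy S A) : (n : ℕ) → ℕ → Kernel S (Traj S A n)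
  | 0, _ => Kernel.deterministic (fun s => (fun _ => s, Fin.elim0)) (by fun_prop)
  | n + 1, h =>
      (Kernel.id ×ₖ (π h ⊗ₖ (rollout M π n (h + 1) ∘ₖ M.P h))).map Traj.cons

/-- The law of a full trajectory of the policy `π` from the initial state. -/
noncomputable def trajLaw (M : MDP S A) (π : Policy S A) : Measure (Traj S A M.H) :=
  rollout M π M.H 0 M.s₁

/-- The policy value `V^π_r`. -/
noncomputable def value (M : MDP S A) (π : Policy S A) (r : ℕ → S × A → ℝ) : ℝ :=
  ∫ τ, ret r 0 τ ∂(trajLaw M π)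

/-- `Q^π_h (s, a)` under the reward `r`: the expected reward from step `h` to the end, given the
state-action pair at step `h`. -/
noncomputable def qValue (M : MDP S A) (π : Policy S A) (r : ℕ → S × A → ℝ) (h : ℕ)
    (x : S × A) : ℝ :=
  r h x + ∫ s', (∫ τ, ret r (h + 1) τ ∂(rollout M π (M.H - (h + 1)) (h + 1) s')) ∂(M.P h x)

/-- The optimal Q-function `Q^{⋆,r}_h = sup_π Q^{π,r}_h`. -/
noncomputable def optQ (M : MDP S A) (r : ℕ → S × A → ℝ) (h : ℕ) (x : S × A) : ℝ :=
  ⨆ π : {π : Policy S A // ∀ h, IsMarkovKernel (π h)}, qValue M π.1 r h x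

/-- The Bellman operator at step `h` under the reward `r`, applied to `g = Q_{h+1}`. -/
noncomputable def bellman (M : MDP S A) (r : ℕ → S × A → ℝ) (h : ℕ) (g : S × A → ℝ)
    (x : S × A) : ℝ :=
  r h x + ∫ s', maxA g s' ∂(M.P h x)

/-! ### Function classes -/

/-- `R_h ⊆ (S × A → [0, 1])`. -/
def IsRewardClass (M : MDP S A) (R : ℕ → Set (S × A → ℝ)) : Prop :=
  ∀ h < M.H, ∀ r ∈ R h, Measurable r ∧ ∀ x, r x ∈ Set.Icc (0 : ℝ) 1

/-- `Q_h ⊆ (S × A → [0, H])`. -/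
def IsQClass (M : MDP S A) (Qc : ℕ → Set (S × A → ℝ)) : Prop :=
  ∀ h < M.H, ∀ g ∈ Qc h, Measurable g ∧ ∀ x, g x ∈ Set.Icc (0 : ℝ) M.H

/-- `am g s` is a maximiser of `g (s, ·)`, chosen measurably in `s`, for the members of the
Q-class; so `am` is a rule that resolves `argmax_a g (s, a)`. -/
def IsArgmaxRule (M : MDP S A) (Qc : ℕ → Set (S × A → ℝ)) (am : (S × A → ℝ) → S → A) : Prop :=
  ∀ h < M.H, ∀ g ∈ Qc h, Measurable (am g) ∧ ∀ s a, g (s, a) ≤ g (s, am g s)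

/-- Realizability of the Q-class: `Q^{⋆,r} ∈ Q` for all rewards `r` of the reward class. -/
def QRealizable (M : MDP S A) (R Qc : ℕ → Set (S × A → ℝ)) : Prop :=
  ∀ r ∈ prodClass M.H R, ∀ h < M.H, optQ M r h ∈ Qc h

/-- Bellman completeness: `T^r_h Q_{h+1} ⊆ Q_h` for all rewards `r` of the reward class (with
`Q_{h+1} = 0` at the last step). -/
def BellmanComplete (M : MDP S A) (R Qc : ℕ → Set (S × A → ℝ)) : Prop :=
  ∀ r ∈ prodClass M.H R, ∀ Q ∈ prodClass M.H Qc, ∀ h < M.H, bellman M r h (Q (h + 1)) ∈ Qc h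

open Classical in
/-- The greedy policy `π_h (s) = argmax_a Q_h (s, a)`. -/
noncomputable def greedy (am : (S × A → ℝ) → S → A) (Q : ℕ → S × A → ℝ) : Policy S A :=
  fun h => if hm : Measurable (am (Q h)) then Kernel.deterministic (am (Q h)) hm else 0

/-! ### Generalized eluder coefficient -/

/-- The squared Bellman error of `f` under the reward `r`, summed along a trajectory. -/
noncomputable def bellmanSq (M : MDP S A) (r f : ℕ → S × A → ℝ) (τ : Traj S A M.H) : ℝ :=
  ∑ h : Fin M.H, (f h (τ.sa h) - bellman M r h (f (h + 1)) (τ.sa h)) ^ 2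

/-- The inequality that defines the generalized eluder coefficient, for sequences of length `K`
of rewards, Q-functions and the greedy policies of the latter. -/
def GECBound (M : MDP S A) (R Qc : ℕ → Set (S × A → ℝ)) (am : (S × A → ℝ) → S → A) (K : ℕ)
    (ε d : ℝ) : Prop :=
  ∀ r f : ℕ → ℕ → S × A → ℝ, (∀ k, r k ∈ prodClass M.H R) → (∀ k, f k ∈ prodClass M.H Qc) →
    ∑ k ∈ Finset.Icc 1 K, (maxA (f k 0) M.s₁ - value M (greedy am (f k)) (r k)) ≤
      (⨅ m : Set.Ioi (0 : ℝ),
        ((m : ℝ) / 2 * ∑ k ∈ Finset.Icc 1 K, ∑ i ∈ Finset.Ico 1 k,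
            ∫ τ, bellmanSq M (r k) (f k) τ ∂(trajLaw M (greedy am (f i)))
          + d / (2 * m)))
      + √(d * M.H * K) + ε * M.H * K

/-- The generalized eluder coefficient: the smallest `d ≥ 0` for which `GECBound` holds. -/
noncomputable def gec (M : MDP S A) (R Qc : ℕ → Set (S × A → ℝ)) (am : (S × A → ℝ) → S → A)
    (K : ℕ) (ε : ℝ) : ℝ :=
  sInf {d : ℝ | 0 ≤ d ∧ GECBound M R Qc am K ε d}

/-! ### The algorithm -/

/-- A run of model-free OPT-AIL with `N` expert trajectories and `K` iterations on a probability
space `(Ω, μ)`.  `info k` is the information present when `τ^k` is rolled out: the expert data,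
`τ^0, …, τ^{k-1}`, `r^k`, the policy `π^k`, and possibly the internal randomness of the learner.
The reward `r^k` is the output of an arbitrary (possibly randomised) online learner and `Q^k` that
of an arbitrary approximate minimiser; how good they are is measured by `rewardOptError` and
`qOptError`. -/
structure Run (M : MDP S A) (R Qc : ℕ → Set (S × A → ℝ)) (am : (S × A → ℝ) → S → A)
    (πE π₀ : Policy S A) (N K : ℕ) {Ω : Type*} [mΩ : MeasurableSpace Ω] (μ : Measure Ω) where
  /-- the expert trajectories -/
  expert : Fin N → Ω → Traj S A M.H
  /-- `τ^k`, the trajectory rolled out by `π^k` -/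
  traj : ℕ → Ω → Traj S A M.H
  /-- `r^k` -/
  rew : ℕ → Ω → ℕ → S × A → ℝ
  /-- `Q^k` -/
  qfun : ℕ → Ω → ℕ → S × A → ℝ
  info : Filtration ℕ mΩ
  -- the expert trajectories are i.i.d. with the law of the expert policy
  expert_measurable : ∀ j, Measurable[info 0] (expert j)
  expert_indep : iIndepFun expert μ
  expert_law : ∀ j, μ.map (expert j) = trajLaw M πE
  -- rewards and Q-functions come from the classes and depend on the past only
  rew_mem : ∀ k ∈ Finset.Icc 1 K, ∀ ω, rew k ω ∈ prodClass M.H R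
  qfun_mem : ∀ k ∈ Finset.Icc 1 K, ∀ ω, qfun k ω ∈ prodClass M.H Qc
  rew_measurable : ∀ k ∈ Finset.Icc 1 K, ∀ h < M.H,
    Measurable[(info k).prod inferInstance] (fun p : Ω × (S × A) => rew k p.1 h p.2)
  policy_measurable : ∀ k ∈ Finset.Icc 1 K, ∀ h < M.H,
    Measurable[(info k).prod inferInstance] (fun p : Ω × S => am (qfun k p.1 h) p.2)
  -- given the past, `τ^k` is a trajectory of `π^0` (`k = 0`) or of the greedy policy of `Q^k`
  traj_measurable : ∀ k ≤ K, Measurable[info (k + 1)] (traj k)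
  traj_law : ∀ k ≤ K, ∀ G, MeasurableSet[info k] G → ∀ B, MeasurableSet B →
    μ (G ∩ traj k ⁻¹' B) =
      ∫⁻ ω in G, trajLaw M (if k = 0 then π₀ else greedy am (qfun k ω)) B ∂μ

section
variable {M : MDP S A} {R Qc : ℕ → Set (S × A → ℝ)} {am : (S × A → ℝ) → S → A}
  {πE π₀ : Policy S A} {N K : ℕ} {Ω : Type*} [mΩ : MeasurableSpace Ω] {μ : Measure Ω}

/-- The estimate `(1/N) ∑_τ ∑_h r_h (τ(s_h), τ(a_h))` of the expert value under `r`. -/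
noncomputable def Run.expertEst (run : Run M R Qc am πE π₀ N K μ) (ω : Ω) (r : ℕ → S × A → ℝ) : ℝ :=
  (1 / (N : ℝ)) * ∑ j, ret r 0 (run.expert j ω)

/-- The estimated loss `L^k (r)` of the reward learner. -/
noncomputable def Run.rewLoss (run : Run M R Qc am πE π₀ N K μ) (ω : Ω) (k : ℕ)
    (r : ℕ → S × A → ℝ) : ℝ :=
  ret r 0 (run.traj k ω) - run.expertEst ω r

/-- The reward optimization error: the average regret of `r^1, …, r^K`. -/
noncomputable def Run.rewardOptError (run : Run M R Qc am πE π₀ N K μ) (ω : Ω) : ℝ :=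
  (1 / (K : ℝ)) * ⨆ r : prodClass M.H R,
    ∑ k ∈ Finset.Icc 1 K, (run.rewLoss ω k (run.rew k ω) - run.rewLoss ω k r)

/-- `E_h (g, g'; D^k, r^k)` for `g = Q_h` and `g' = Q_{h+1}`. -/
noncomputable def Run.fitError (run : Run M R Qc am πE π₀ N K μ) (ω : Ω) (k : ℕ) (h : Fin M.H)
    (g g' : S × A → ℝ) : ℝ :=
  ∑ i ∈ Finset.range k,
    (g ((run.traj i ω).sa h) - run.rew k ω h ((run.traj i ω).sa h) - maxA g' ((run.traj i ω).next h)) ^ 2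

/-- The estimated Bellman error `BE^k (Q)`. -/
noncomputable def Run.bellmanEst (run : Run M R Qc am πE π₀ N K μ) (ω : Ω) (k : ℕ)
    (Q : ℕ → S × A → ℝ) : ℝ :=
  ∑ h : Fin M.H, (run.fitError ω k h (Q h) (Q (h + 1)) -
    ⨅ g : Qc h, run.fitError ω k h g (Q (h + 1)))

/-- The optimism-regularized objective `L^k (Q)`, with regularization parameter `lam`. -/
noncomputable def Run.qLoss (run : Run M R Qc am πE π₀ N K μ) (lam : ℝ) (ω : Ω) (k : ℕ)
    (Q : ℕ → S × A → ℝ) : ℝ :=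
  run.bellmanEst ω k Q - lam * maxA (Q 0) M.s₁

/-- The error up to which the Q-function objectives are minimised: the largest value of
`L^k (Q^k) - min_Q L^k (Q)` over the iterations. -/
noncomputable def Run.qOptError (run : Run M R Qc am πE π₀ N K μ) (lam : ℝ) (ω : Ω) : ℝ :=
  ⨆ k : Finset.Icc 1 K,
    (run.qLoss lam ω k (run.qfun k ω) - ⨅ Q : prodClass M.H Qc, run.qLoss lam ω k Q)

/-- The value, under the true reward, of the output policy, which draws `k` uniformly from
`1, …, K` and then follows `π^k`, the greedy policy of `Q^k`. -/
noncomputable def Run.outputValue (run : Run M R Qc am πE π₀ N K μ) (ω : Ω) : ℝ :=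
  ∫ τ, ret M.rTrue 0 τ
    ∂((K : ℝ≥0∞)⁻¹ • ∑ k ∈ Finset.Icc 1 K, trajLaw M (greedy am (run.qfun k ω)))

end

/-- `max_h N_ρ (R_h)`. -/
noncomputable def maxCovR (M : MDP S A) (R : ℕ → Set (S × A → ℝ)) (ρ : ℝ) : ℕ :=
  (Finset.range M.H).sup fun h => covN ρ (R h)

/-- `max_h N_ρ (Q_h) N_ρ (R_h)`. -/
noncomputable def maxCovQR (M : MDP S A) (R Qc : ℕ → Set (S × A → ℝ)) (ρ : ℝ) : ℕ :=
  (Finset.range M.H).sup fun h => covN ρ (Qc h) * covN ρ (R h)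

/-- The regularization parameter
`c₁ √((K H³ log (4 K H N_ρ(Q) N_ρ(R) / δ) + K² H³ ρ) / d)`. -/
noncomputable def lambdaQ (M : MDP S A) (R Qc : ℕ → Set (S × A → ℝ)) (c₁ ρ d δ : ℝ) (K : ℕ) : ℝ :=
  c₁ * √((K * (M.H : ℝ) ^ 3 * Real.log (4 * K * M.H * covNProd ρ (prodClass M.H Qc) *
      covNProd ρ (prodClass M.H R) / δ) + (K : ℝ) ^ 2 * (M.H : ℝ) ^ 3 * ρ) / d)

end

end OptAIL

namespace OptAIL

/-! ### Elementary facts on trajectories and bounded integrals -/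

section Elementary
variable {S A : Type*}

/-! For each iteration k, the gap between the expert and `π^k` under the true reward splits into two
parts: the change of the gap when the true reward is replaced by `r^k`, and the gap under `r^k`.

The first part is a reward-learning error. The expert values are replaced by their estimates
uniformly over the reward class (`Run.measure_expert_le`), and the values of `π^k` by the returns of
the trajectories, at the cost of a martingale deviation (`Run.measure_return_le`). No cover is
needed for the latter, because `r^k` is fixed before `τ^k` is rolled out. What remains is the regret
of the online learner.

The second part is handled by optimism. By the Bellman optimality equation (`optQ_eq_bellman`), the
optimal Q-function of `r^k` has small estimated Bellman error. Since `Q^k` almost minimises the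
regularised objective, `λ (max Q^⋆ - max Q^k)` is at most the estimated Bellman error of `Q^⋆`,
minus that of `Q^k`, plus the optimisation error. The rest, `max Q^k - V^{π^k}`, is bounded by the
eluder inequality through expected squared Bellman errors on earlier policies; these are at most
four times the estimated Bellman error plus a small term. With the parameter `1 / (2λ)` in the
eluder inequality, the estimated errors of `Q^k` cancel exactly, leaving terms of order `H B / λ + d
λ / K`, which the choice of `λ` balances (`Run.sum_value_sub_le`, `regularized_error_bound`).

The statistical core is `lintegral_exp_excess_le_one`. The excess of the squared loss of `f` over
that of its Bellman backup has the squared Bellman error as conditional mean, and its fluctuations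
are governed by the same quantity. This self-bounding yields a fast rate: an exponential
supermartingale, then a union bound over steps, iterations and finite covers
(`Run.measure_bellman_le`). The covers are needed because `r^k` and `Q^k` depend on the trajectories
in the sum.

If all covers are single balls, the logarithms in the sample sizes may be arbitrarily small and give
no concentration. Everything is then determined up to `O(ρ)` and the bound holds surely
(`Run.value_sub_outputValue_le_of_maxCovQR_eq_one`). -/

theorem cons_sa_zero {n : ℕ} (p : S × A × Traj S A n) : (Traj.cons p).sa 0 = (p.1, p.2.1) := rfl

theorem cons_sa_succ {n : ℕ} (p : S × A × Traj S A n) (i : Fin n) :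
    (Traj.cons p).sa i.succ = p.2.2.sa i := rfl

theorem cons_next_zero {n : ℕ} (p : S × A × Traj S A n) : (Traj.cons p).next 0 = p.2.2.1 0 := rfl

theorem cons_next_succ {n : ℕ} (p : S × A × Traj S A n) (i : Fin n) :
    (Traj.cons p).next i.succ = p.2.2.next i := rfl

theorem abs_ret_le {r : ℕ → S × A → ℝ} {b : ℝ} (hr : ∀ h x, |r h x| ≤ b) {n : ℕ} (h : ℕ)
    (τ : Traj S A n) : |ret r h τ| ≤ n * b := by
  unfold ret
  refine (Finset.abs_sum_le_sum_abs _ _).trans ?_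
  refine (Finset.sum_le_sum fun i _ => hr _ _).trans ?_
  simp

theorem ret_cons (r : ℕ → S × A → ℝ) {n : ℕ} (h : ℕ) (s : S) (a : A) (τ : Traj S A n) :
    ret r h (Traj.cons (s, a, τ)) = r h (s, a) + ret r (h + 1) τ := by
  unfold ret
  rw [Fin.sum_univ_succ]
  simp only [cons_sa_zero, cons_sa_succ, Fin.val_zero, Fin.val_succ, add_zero]
  congr 1
  refine Finset.sum_congr rfl fun i _ => ?_
  rw [show h + (i + 1) = h + 1 + (i : ℕ) by omega]

theorem integrable_of_abs_le {α : Type*} [MeasurableSpace α] {μ : Measure α} [IsFiniteMeasure μ]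
    {f : α → ℝ} (hf : Measurable f) {b : ℝ} (hb : ∀ x, |f x| ≤ b) : Integrable f μ :=
  Integrable.of_bound hf.aestronglyMeasurable b (Filter.Eventually.of_forall hb)

theorem abs_integral_le_of_abs_le {α : Type*} [MeasurableSpace α] {μ : Measure α}
    [IsProbabilityMeasure μ] {f : α → ℝ} {b : ℝ} (hb : ∀ x, |f x| ≤ b) : |∫ x, f x ∂μ| ≤ b := by
  have := norm_integral_le_of_norm_le_const (μ := μ) (f := f) (C := b)
    (Filter.Eventually.of_forall hb)
  simpa using this

end Elementary

section Rollout
variable {S A : Type*} [MeasurableSpace S] [MeasurableSpace A]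

/-! ### Rollouts and values -/

/-- The hypothesis covers only the steps that are played, because a greedy policy is known to be
Markov only below the horizon. -/
theorem isMarkovKernel_rollout (M : MDP S A) {π : Policy S A} :
    ∀ n h : ℕ, (∀ j, h ≤ j → j < h + n → IsMarkovKernel (π j)) → IsMarkovKernel (rollout M π n h)
  | 0, h, _ => by rw [rollout]; infer_instance
  | n + 1, h, hπ => by
      have := isMarkovKernel_rollout M n (h + 1) fun j h1 h2 => hπ j (by omega) (by omega)
      have := hπ h le_rfl (by omega)
      have := M.markov h
      rw [rollout]
      exact Kernel.IsMarkovKernel.map _ Traj.measurable_cons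

theorem lintegral_rollout_succ (M : MDP S A) {π : Policy S A} {n h : ℕ}
    (hπ : ∀ j, h ≤ j → j < h + (n + 1) → IsMarkovKernel (π j)) (s : S)
    {f : Traj S A (n + 1) → ℝ≥0∞} (hf : Measurable f) :
    ∫⁻ τ, f τ ∂(rollout M π (n + 1) h s) =
      ∫⁻ a, ∫⁻ s', ∫⁻ τ, f (Traj.cons (s, a, τ)) ∂(rollout M π n (h + 1) s') ∂(M.P h (s, a))
        ∂(π h s) := by
  have := isMarkovKernel_rollout M n (h + 1) fun j h1 h2 => hπ j (by omega) (by omega)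
  have := hπ h le_rfl (by omega)
  have := M.markov h
  have hc := Traj.measurable_cons (S := S) (A := A) (n := n)
  have hfc : Measurable fun p : S × A × Traj S A n => f (Traj.cons p) := hf.comp hc
  rw [rollout, Kernel.lintegral_map _ hc _ hf, Kernel.lintegral_id_prod hfc,
    Kernel.lintegral_compProd _ _ _ (f := fun q => f (Traj.cons (s, q)))
      (hfc.comp measurable_prodMk_left)]
  refine lintegral_congr fun a => ?_
  rw [Kernel.lintegral_comp _ _ _ (g := fun τ => f (Traj.cons (s, a, τ)))
    (hfc.comp (measurable_prodMk_left.comp measurable_prodMk_left))]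

/-- `rollout` stores its initial state in the trajectory. This identifies the first state of the
remaining trajectory with the state drawn by the transition kernel. -/
theorem rollout_start (M : MDP S A) {π : Policy S A} : ∀ {n h : ℕ},
    (∀ j, h ≤ j → j < h + n → IsMarkovKernel (π j)) → ∀ (s : S)
    {f : S × Traj S A n → ℝ≥0∞}, Measurable f →
    ∫⁻ τ, f (τ.1 0, τ) ∂(rollout M π n h s) = ∫⁻ τ, f (s, τ) ∂(rollout M π n h s)
  | 0, h, _, s, f, hf => by
      rw [rollout, Kernel.lintegral_deterministic' _ (by fun_prop),
        Kernel.lintegral_deterministic' _ (by fun_prop)]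
  | n + 1, h, hπ, s, f, hf => by
      rw [lintegral_rollout_succ M hπ s (by fun_prop), lintegral_rollout_succ M hπ s (by fun_prop)]
      simp [Traj.cons]

theorem measurable_sa {n : ℕ} (i : Fin n) : Measurable fun τ : Traj S A n => τ.sa i := by
  unfold Traj.sa; fun_prop

theorem measurable_next {n : ℕ} (i : Fin n) : Measurable fun τ : Traj S A n => τ.next i := by
  unfold Traj.next; fun_prop

/-- The state after step `i` is drawn from the transition kernel. -/
theorem rollout_step (M : MDP S A) {π : Policy S A} : ∀ {n h : ℕ},
    (∀ j, h ≤ j → j < h + n → IsMarkovKernel (π j)) → ∀ (s : S) (i : Fin n)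
    {f : (S × A) × S → ℝ≥0∞}, Measurable f →
    ∫⁻ τ, f (τ.sa i, τ.next i) ∂(rollout M π n h s) =
      ∫⁻ τ, ∫⁻ s', f (τ.sa i, s') ∂(M.P (h + i) (τ.sa i)) ∂(rollout M π n h s)
  | 0, h, _, s, i, f, hf => i.elim0
  | n + 1, h, hπ, s, i, f, hf => by
      have hπ' : ∀ j, h + 1 ≤ j → j < h + 1 + n → IsMarkovKernel (π j) :=
        fun j h1 h2 => hπ j (by omega) (by omega)
      have := isMarkovKernel_rollout M n (h + 1) hπ'
      have := fun j => M.markov j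
      have hm : Measurable fun x : S × A => ∫⁻ s', f (x, s') ∂(M.P (h + i) x) :=
        hf.lintegral_kernel_prod_right'
      rw [lintegral_rollout_succ M hπ s (f := fun τ => f (τ.sa i, τ.next i))
          (hf.comp ((measurable_sa i).prodMk (measurable_next i))),
        lintegral_rollout_succ M hπ s
          (f := fun τ => ∫⁻ s', f (τ.sa i, s') ∂(M.P (h + i) (τ.sa i)))
          (hm.comp (measurable_sa i))]
      refine lintegral_congr fun a => ?_
      refine Fin.cases ?_ (fun i => ?_) i
      -- For the first step, the next state is the initial state of the tail, so the integrand no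
      -- longer depends on the rest of the tail.
      · simp only [cons_sa_zero, cons_next_zero, lintegral_const, measure_univ, mul_one,
          Fin.val_zero, add_zero]
        refine lintegral_congr fun s' => ?_
        have := rollout_start M hπ' s' (f := fun p => f ((s, a), p.1)) (by fun_prop)
        simpa using this
      · refine lintegral_congr fun s' => ?_
        simp only [cons_sa_succ, cons_next_succ, Fin.val_succ]
        rw [rollout_step M hπ' s' i hf]
        simp only [add_assoc, add_comm (1 : ℕ)]

theorem measurable_ret {r : ℕ → S × A → ℝ} (hr : ∀ h, Measurable (r h)) {n : ℕ} (h : ℕ) :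
    Measurable (ret (n := n) r h) := by
  unfold ret
  exact Finset.measurable_sum _ fun i _ => (hr _).comp (measurable_sa i)

theorem integral_rollout_succ (M : MDP S A) {π : Policy S A} {n h : ℕ}
    (hπ : ∀ j, h ≤ j → j < h + (n + 1) → IsMarkovKernel (π j)) (s : S)
    {f : Traj S A (n + 1) → ℝ} (hf : Measurable f) {b : ℝ} (hb : ∀ τ, |f τ| ≤ b) :
    ∫ τ, f τ ∂(rollout M π (n + 1) h s) =
      ∫ a, ∫ s', ∫ τ, f (Traj.cons (s, a, τ)) ∂(rollout M π n (h + 1) s') ∂(M.P h (s, a))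
        ∂(π h s) := by
  have := isMarkovKernel_rollout M n (h + 1) fun j h1 h2 => hπ j (by omega) (by omega)
  have := hπ h le_rfl (by omega)
  have := M.markov h
  have hc := Traj.measurable_cons (S := S) (A := A) (n := n)
  have hfc : Measurable fun p : S × A × Traj S A n => f (Traj.cons p) := hf.comp hc
  have hg : Measurable fun q : A × Traj S A n => f (Traj.cons (s, q)) :=
    hfc.comp measurable_prodMk_left
  rw [rollout, Kernel.map_apply _ hc, integral_map hc.aemeasurable hf.aestronglyMeasurable,
    Kernel.prod_apply, Kernel.id_apply,
    integral_prod (fun p => f (Traj.cons p)) (integrable_of_abs_le hfc fun x => hb _),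
    integral_dirac' (fun x => ∫ y, f (Traj.cons (x, y)) ∂_),
    ProbabilityTheory.integral_compProd (f := fun q => f (Traj.cons (s, q)))
      (integrable_of_abs_le hg fun x => hb _)]
  · refine integral_congr_ae (Filter.Eventually.of_forall fun a => ?_)
    exact Kernel.integral_comp (f := fun τ => f (Traj.cons (s, a, τ)))
      (integrable_of_abs_le (hg.comp measurable_prodMk_left) fun x => hb _)
  · exact hfc.stronglyMeasurable.integral_prod_right'

end Rollout

/-! ### Maxima over actions -/

section MaxA
variable {S A : Type*}

theorem maxA_zero : maxA (0 : S × A → ℝ) = 0 := by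
  funext s
  simp [maxA]

theorem abs_maxA_sub_le [Nonempty A] {f g : S × A → ℝ} {b : ℝ} (s : S)
    (hf : BddAbove (Set.range fun a => f (s, a))) (hg : BddAbove (Set.range fun a => g (s, a)))
    (h : ∀ x, |f x - g x| ≤ b) : |maxA f s - maxA g s| ≤ b := by
  refine abs_sub_le_iff.2 ⟨?_, ?_⟩
  · refine sub_le_iff_le_add.2 (ciSup_le fun a => ?_)
    have := le_ciSup hg a
    have := (abs_sub_le_iff.1 (h (s, a))).1
    unfold maxA; linarith
  · refine sub_le_iff_le_add.2 (ciSup_le fun a => ?_)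
    have := le_ciSup hf a
    have := (abs_sub_le_iff.1 (h (s, a))).2
    unfold maxA; linarith

end MaxA

/-! ### Optimal Q-functions, greedy policies and the Bellman equation -/

section Bellman
variable {S A : Type*} [MeasurableSpace S] [MeasurableSpace A]

/-- The value of the last `n` steps, started in the state `s` at step `h`. -/
noncomputable def stepValue (M : MDP S A) (π : Policy S A) (r : ℕ → S × A → ℝ) (n h : ℕ)
    (s : S) : ℝ :=
  ∫ τ, ret r h τ ∂(rollout M π n h s)

theorem value_eq_stepValue (M : MDP S A) (π : Policy S A) (r : ℕ → S × A → ℝ) :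
    value M π r = stepValue M π r M.H 0 M.s₁ := rfl

/-- The assumptions on the MDP and the function classes. -/
structure Setting (M : MDP S A) (R Qc : ℕ → Set (S × A → ℝ)) (am : (S × A → ℝ) → S → A) :
    Prop where
  one_le : 1 ≤ M.H
  rew : IsRewardClass M R
  qcl : IsQClass M Qc
  rTrue : M.rTrue ∈ prodClass M.H R
  real : QRealizable M R Qc
  compl : BellmanComplete M R Qc
  argmax : IsArgmaxRule M Qc am

variable {M : MDP S A} {R Qc : ℕ → Set (S × A → ℝ)} {am : (S × A → ℝ) → S → A}

theorem Setting.measurable_rew (hS : Setting M R Qc am) {r : ℕ → S × A → ℝ}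
    (hr : r ∈ prodClass M.H R) (h : ℕ) : Measurable (r h) := by
  by_cases hh : h < M.H
  · exact (hS.rew h hh _ (hr.1 h hh)).1
  · rw [hr.2 h (by omega)]; exact measurable_zero

theorem Setting.rew_mem_Icc (hS : Setting M R Qc am) {r : ℕ → S × A → ℝ}
    (hr : r ∈ prodClass M.H R) (h : ℕ) (x : S × A) : r h x ∈ Set.Icc (0 : ℝ) 1 := by
  by_cases hh : h < M.H
  · exact (hS.rew h hh _ (hr.1 h hh)).2 x
  · rw [hr.2 h (by omega)]; simp

theorem Setting.abs_rew_le (hS : Setting M R Qc am) {r : ℕ → S × A → ℝ}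
    (hr : r ∈ prodClass M.H R) (h : ℕ) (x : S × A) : |r h x| ≤ 1 := by
  have := hS.rew_mem_Icc hr h x
  exact abs_le.2 ⟨by linarith [this.1], this.2⟩

theorem Setting.measurable_q (hS : Setting M R Qc am) {Q : ℕ → S × A → ℝ}
    (hQ : Q ∈ prodClass M.H Qc) (h : ℕ) : Measurable (Q h) := by
  by_cases hh : h < M.H
  · exact (hS.qcl h hh _ (hQ.1 h hh)).1
  · rw [hQ.2 h (by omega)]; exact measurable_zero

theorem Setting.q_mem_Icc (hS : Setting M R Qc am) {Q : ℕ → S × A → ℝ}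
    (hQ : Q ∈ prodClass M.H Qc) (h : ℕ) (x : S × A) : Q h x ∈ Set.Icc (0 : ℝ) M.H := by
  by_cases hh : h < M.H
  · exact (hS.qcl h hh _ (hQ.1 h hh)).2 x
  · rw [hQ.2 h (by omega)]; simp

theorem Setting.nonempty_action (_ : Setting M R Qc am) : Nonempty A := ⟨am 0 M.s₁⟩

theorem Setting.bddAbove_q (hS : Setting M R Qc am) {Q : ℕ → S × A → ℝ}
    (hQ : Q ∈ prodClass M.H Qc) (h : ℕ) (s : S) : BddAbove (Set.range fun a => Q h (s, a)) :=
  ⟨M.H, by rintro _ ⟨a, rfl⟩; exact (hS.q_mem_Icc hQ h _).2⟩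

theorem Setting.le_maxA (hS : Setting M R Qc am) {Q : ℕ → S × A → ℝ}
    (hQ : Q ∈ prodClass M.H Qc) (h : ℕ) (s : S) (a : A) : Q h (s, a) ≤ maxA (Q h) s :=
  le_ciSup (hS.bddAbove_q hQ h s) a

theorem Setting.maxA_eq (hS : Setting M R Qc am) {Q : ℕ → S × A → ℝ}
    (hQ : Q ∈ prodClass M.H Qc) {h : ℕ} (hh : h < M.H) (s : S) :
    maxA (Q h) s = Q h (s, am (Q h) s) := by
  have := hS.nonempty_action
  exact le_antisymm (ciSup_le fun a => (hS.argmax h hh _ (hQ.1 h hh)).2 s a) (hS.le_maxA hQ h s _)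

theorem Setting.measurable_maxA (hS : Setting M R Qc am) {Q : ℕ → S × A → ℝ}
    (hQ : Q ∈ prodClass M.H Qc) (h : ℕ) : Measurable (maxA (Q h)) := by
  by_cases hh : h < M.H
  · rw [show maxA (Q h) = fun s => Q h (s, am (Q h) s) from funext fun s => hS.maxA_eq hQ hh s]
    exact (hS.measurable_q hQ h).comp
      (measurable_id.prodMk (hS.argmax h hh _ (hQ.1 h hh)).1)
  · rw [hQ.2 h (by omega), maxA_zero]; exact measurable_zero

theorem Setting.maxA_mem_Icc (hS : Setting M R Qc am) {Q : ℕ → S × A → ℝ}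
    (hQ : Q ∈ prodClass M.H Qc) (h : ℕ) (s : S) : maxA (Q h) s ∈ Set.Icc (0 : ℝ) M.H := by
  have := hS.nonempty_action
  obtain ⟨a⟩ := hS.nonempty_action
  exact ⟨(hS.q_mem_Icc hQ h (s, a)).1.trans (hS.le_maxA hQ h s a),
    ciSup_le fun a => (hS.q_mem_Icc hQ h _).2⟩

theorem Setting.abs_maxA_le (hS : Setting M R Qc am) {Q : ℕ → S × A → ℝ}
    (hQ : Q ∈ prodClass M.H Qc) (h : ℕ) (s : S) : |maxA (Q h) s| ≤ M.H := by
  have := hS.maxA_mem_Icc hQ h s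
  exact abs_le.2 ⟨by linarith [this.1, this.2], this.2⟩

/-- Below the horizon the argmax rule is measurable, so the default branch of `greedy`, the zero
kernel, does not occur. -/
theorem greedy_eq_deterministic (hS : Setting M R Qc am) {Q : ℕ → S × A → ℝ}
    (hQ : Q ∈ prodClass M.H Qc) {h : ℕ} (hh : h < M.H) :
    greedy am Q h = Kernel.deterministic (am (Q h)) (hS.argmax h hh _ (hQ.1 h hh)).1 := by
  rw [greedy, dif_pos]

theorem isMarkovKernel_greedy (hS : Setting M R Qc am) {Q : ℕ → S × A → ℝ}
    (hQ : Q ∈ prodClass M.H Qc) {h : ℕ} (hh : h < M.H) : IsMarkovKernel (greedy am Q h) := by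
  rw [greedy_eq_deterministic hS hQ hh]; infer_instance

theorem isProbabilityMeasure_trajLaw {π : Policy S A} (hπ : ∀ h < M.H, IsMarkovKernel (π h)) :
    IsProbabilityMeasure (trajLaw M π) := by
  have := isMarkovKernel_rollout M (π := π) M.H 0 fun j _ hj => hπ j (by omega)
  unfold trajLaw; infer_instance

theorem measurable_stepValue {π : Policy S A} {r : ℕ → S × A → ℝ}
    (hr : ∀ h, Measurable (r h)) {n h : ℕ}
    (hπ : ∀ j, h ≤ j → j < h + n → IsMarkovKernel (π j)) :
    Measurable (stepValue M π r n h) := by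
  have := isMarkovKernel_rollout M n h hπ
  exact (measurable_ret hr h).stronglyMeasurable.integral_kernel.measurable

theorem abs_stepValue_le {π : Policy S A} {r : ℕ → S × A → ℝ} (hb : ∀ h x, |r h x| ≤ 1) {n h : ℕ}
    (hπ : ∀ j, h ≤ j → j < h + n → IsMarkovKernel (π j)) (s : S) :
    |stepValue M π r n h s| ≤ n := by
  have := isMarkovKernel_rollout M n h hπ
  refine abs_integral_le_of_abs_le fun τ => ?_
  simpa using abs_ret_le hb h τ

theorem stepValue_succ {π : Policy S A} {r : ℕ → S × A → ℝ}
    (hr : ∀ h, Measurable (r h)) (hb : ∀ h x, |r h x| ≤ 1) {n h : ℕ}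
    (hπ : ∀ j, h ≤ j → j < h + (n + 1) → IsMarkovKernel (π j)) (s : S) :
    stepValue M π r (n + 1) h s =
      ∫ a, (r h (s, a) + ∫ s', stepValue M π r n (h + 1) s' ∂(M.P h (s, a))) ∂(π h s) := by
  have hπ' : ∀ j, h + 1 ≤ j → j < h + 1 + n → IsMarkovKernel (π j) :=
    fun j h1 h2 => hπ j (by omega) (by omega)
  have := isMarkovKernel_rollout M n (h + 1) hπ'
  have := M.markov h
  rw [stepValue, integral_rollout_succ M hπ s (measurable_ret hr h) (abs_ret_le hb h)]
  refine integral_congr_ae (Filter.Eventually.of_forall fun a => ?_)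
  have h1 : ∀ s', ∫ τ, ret r h (Traj.cons (s, a, τ)) ∂(rollout M π n (h + 1) s') =
      r h (s, a) + stepValue M π r n (h + 1) s' := fun s' => by
    simp only [ret_cons]
    rw [integral_add (integrable_const _) (integrable_of_abs_le (measurable_ret hr _)
      (abs_ret_le hb _))]
    simp [stepValue]
  simp only [h1]
  rw [integral_add (integrable_const _) (integrable_of_abs_le (measurable_stepValue hr hπ')
      (abs_stepValue_le hb hπ'))]
  simp

theorem measurable_qValue {π : Policy S A} {r : ℕ → S × A → ℝ}
    (hr : ∀ h, Measurable (r h)) (hπ : ∀ j < M.H, IsMarkovKernel (π j)) (h : ℕ) :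
    Measurable (qValue M π r h) := by
  have := M.markov h
  by_cases hh : h < M.H
  · exact (hr h).add ((measurable_stepValue hr fun j _ hj =>
      hπ j (by omega)).stronglyMeasurable.integral_kernel).measurable
  · have h0 : M.H - (h + 1) = 0 := by omega
    unfold qValue
    rw [h0]
    exact (hr h).add ((measurable_stepValue (M := M) (π := π) (n := 0) hr fun j _ hj =>
      by omega).stronglyMeasurable.integral_kernel).measurable

theorem abs_qValue_le {π : Policy S A} {r : ℕ → S × A → ℝ} (hb : ∀ h x, |r h x| ≤ 1)
    (hπ : ∀ j < M.H, IsMarkovKernel (π j)) {h : ℕ} (hh : h < M.H) (x : S × A) :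
    |qValue M π r h x| ≤ M.H := by
  have := M.markov h
  have h1 : |∫ s', stepValue M π r (M.H - (h + 1)) (h + 1) s' ∂(M.P h x)| ≤
      ((M.H - (h + 1) : ℕ) : ℝ) :=
    abs_integral_le_of_abs_le fun s' => abs_stepValue_le hb (fun j _ hj => hπ j (by omega)) s'
  have h2 := hb h x
  have h3 : ((M.H - (h + 1) : ℕ) : ℝ) = M.H - (h + 1) := by
    rw [Nat.cast_sub (by omega)]; simp
  refine (abs_add_le _ _).trans ((add_le_add h2 h1).trans ?_)
  rw [h3]; linarith [(Nat.cast_nonneg h : (0 : ℝ) ≤ h)]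

theorem stepValue_eq_integral_qValue {π : Policy S A} {r : ℕ → S × A → ℝ}
    (hr : ∀ h, Measurable (r h)) (hb : ∀ h x, |r h x| ≤ 1)
    (hπ : ∀ j < M.H, IsMarkovKernel (π j)) {h : ℕ} (hh : h < M.H) (s : S) :
    stepValue M π r (M.H - h) h s = ∫ a, qValue M π r h (s, a) ∂(π h s) := by
  rw [show M.H - h = (M.H - (h + 1)) + 1 by omega, stepValue_succ hr hb (fun j _ hj =>
    hπ j (by omega))]
  rfl

/-- The uniform bound on values makes the real supremum in `optQ` a genuine one rather than a
default value. -/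
theorem qValue_le_optQ (hS : Setting M R Qc am) {r : ℕ → S × A → ℝ} (hr : r ∈ prodClass M.H R)
    {π : Policy S A} (hπ : ∀ h, IsMarkovKernel (π h)) {h : ℕ} (hh : h < M.H) (x : S × A) :
    qValue M π r h x ≤ optQ M r h x := by
  refine le_ciSup (f := fun π : {π : Policy S A // ∀ h, IsMarkovKernel (π h)} =>
    qValue M π.1 r h x) ⟨M.H, ?_⟩ ⟨π, hπ⟩
  rintro _ ⟨π, rfl⟩
  exact (abs_le.1 (abs_qValue_le (hS.abs_rew_le hr) (fun j _ => π.2 j) hh x)).2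

/-- The optimal Q-function of a member of the reward class belongs to the Q-class. -/
theorem optQ_mem (hS : Setting M R Qc am) {r : ℕ → S × A → ℝ} (hr : r ∈ prodClass M.H R) :
    optQ M r ∈ prodClass M.H Qc := by
  refine ⟨hS.real r hr, fun h hh => funext fun x => ?_⟩
  -- Beyond the horizon no steps remain, by truncated subtraction, and the reward vanishes as well.
  have h0 : M.H - (h + 1) = 0 := by omega
  have : ∀ π : {π : Policy S A // ∀ h, IsMarkovKernel (π h)}, qValue M π.1 r h x = 0 := by
    intro π
    unfold qValue
    rw [h0]
    simp [hr.2 h hh, ret]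
  simp only [optQ, this, Pi.zero_apply]
  exact Real.iSup_const_zero

theorem stepValue_le_maxA_optQ (hS : Setting M R Qc am) {r : ℕ → S × A → ℝ}
    (hr : r ∈ prodClass M.H R) {π : Policy S A} (hπ : ∀ h, IsMarkovKernel (π h)) {h : ℕ}
    (hh : h ≤ M.H) (s : S) : stepValue M π r (M.H - h) h s ≤ maxA (optQ M r h) s := by
  have hQ := optQ_mem hS hr
  rcases hh.lt_or_eq with hh | rfl
  · rw [stepValue_eq_integral_qValue (hS.measurable_rew hr) (hS.abs_rew_le hr) (fun j _ => hπ j) hh]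
    have := hπ h
    calc ∫ a, qValue M π r h (s, a) ∂(π h s) ≤ ∫ _, maxA (optQ M r h) s ∂(π h s) := by
          refine integral_mono (integrable_of_abs_le ((measurable_qValue (hS.measurable_rew hr)
            (fun j _ => hπ j) h).comp measurable_prodMk_left)
            fun a => abs_qValue_le (hS.abs_rew_le hr) (fun j _ => hπ j) hh _)
            (integrable_const _) fun a => ?_
          exact (qValue_le_optQ hS hr hπ hh _).trans (hS.le_maxA hQ h s a)
      _ = _ := by simp
  · rw [Nat.sub_self]
    simp only [stepValue, ret, Finset.univ_eq_empty, Finset.sum_empty, integral_zero]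
    exact (hS.maxA_mem_Icc hQ _ s).1

/-- The easy half of the optimality equation: from the next step on, no policy does better than
`max_a Q^⋆`. The policy `π₀` only ensures that the supremum runs over a nonempty set. -/
theorem optQ_le_bellman (hS : Setting M R Qc am) {r : ℕ → S × A → ℝ}
    (hr : r ∈ prodClass M.H R) {π₀ : Policy S A} (hπ₀ : ∀ h, IsMarkovKernel (π₀ h)) {h : ℕ}
    (hh : h < M.H) (x : S × A) : optQ M r h x ≤ bellman M r h (optQ M r (h + 1)) x := by
  have : Nonempty {π : Policy S A // ∀ h, IsMarkovKernel (π h)} := ⟨⟨π₀, hπ₀⟩⟩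
  have := M.markov h
  have hQ := optQ_mem hS hr
  refine ciSup_le fun π => ?_
  refine (add_le_add_iff_left (r h x)).2 ?_
  refine integral_mono (integrable_of_abs_le (measurable_stepValue (hS.measurable_rew hr)
      fun j _ _ => π.2 j) (abs_stepValue_le (hS.abs_rew_le hr) fun j _ _ => π.2 j))
    (integrable_of_abs_le (hS.measurable_maxA hQ _) (hS.abs_maxA_le hQ _)) fun s' => ?_
  exact stepValue_le_maxA_optQ hS hr π.2 hh s'

/-- A policy that is greedy for `f` is nearly optimal if `f` nearly satisfies one half of the
Bellman equation. -/
theorem maxA_le_stepValue_add (hS : Setting M R Qc am) {r f : ℕ → S × A → ℝ}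
    (hr : r ∈ prodClass M.H R) (hf : f ∈ prodClass M.H Qc) {π : Policy S A}
    (hπ : ∀ h < M.H, π h = greedy am f h) {b : ℝ}
    (hb : ∀ h < M.H, ∀ x, f h x ≤ bellman M r h (f (h + 1)) x + b) :
    ∀ n h, n + h = M.H → ∀ s, maxA (f h) s ≤ stepValue M π r n h s + n * b
  | 0, h, hn, s => by
      simp [hf.2 h (by omega), maxA_zero, stepValue, ret]
  | n + 1, h, hn, s => by
      have hh : h < M.H := by omega
      have hM : ∀ j < M.H, IsMarkovKernel (π j) := fun j hj => by
        rw [hπ j hj]; exact isMarkovKernel_greedy hS hf hj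
      have hM' : ∀ j, h + 1 ≤ j → j < h + 1 + n → IsMarkovKernel (π j) :=
        fun j _ _ => hM j (by omega)
      have := M.markov h
      have := hM h hh
      have hmr := hS.measurable_rew hr
      have hbr := hS.abs_rew_le hr
      have hv := measurable_stepValue (M := M) hmr hM'
      have key : ∫ s', maxA (f (h + 1)) s' ∂(M.P h (s, am (f h) s)) ≤
          ∫ s', (stepValue M π r n (h + 1) s' + n * b) ∂(M.P h (s, am (f h) s)) :=
        integral_mono (integrable_of_abs_le (hS.measurable_maxA hf _) (hS.abs_maxA_le hf _))
          ((integrable_of_abs_le hv (abs_stepValue_le hbr hM')).add (integrable_const _))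
          fun s' => maxA_le_stepValue_add hS hr hf hπ hb n (h + 1) (by omega) s'
      rw [integral_add (integrable_of_abs_le hv (abs_stepValue_le hbr hM')) (integrable_const _),
        integral_const, probReal_univ, one_smul] at key
      have h1 := hb h hh (s, am (f h) s)
      rw [stepValue_succ hmr hbr (fun j _ _ => hM j (by omega)), hπ h hh,
        greedy_eq_deterministic hS hf hh,
        Kernel.integral_deterministic' (f := fun a => r h (s, a) +
          ∫ s', stepValue M π r n (h + 1) s' ∂(M.P h (s, a))), hS.maxA_eq hf hh]
      · unfold bellman at h1
        push_cast
        linarith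
      · exact
          (((hmr h).stronglyMeasurable).add hv.stronglyMeasurable.integral_kernel).comp_measurable
          measurable_prodMk_left

/-- The Bellman optimality equation. -/
theorem optQ_eq_bellman (hS : Setting M R Qc am) {r : ℕ → S × A → ℝ}
    (hr : r ∈ prodClass M.H R) {π₀ : Policy S A} (hπ₀ : ∀ h, IsMarkovKernel (π₀ h)) {h : ℕ}
    (hh : h < M.H) : optQ M r h = bellman M r h (optQ M r (h + 1)) := by
  have := M.markov h
  have hQ := optQ_mem hS hr
  refine funext fun x => le_antisymm (optQ_le_bellman hS hr hπ₀ hh x) ?_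
  classical
  -- The supremum in `optQ` is over policies that are Markov at every step, so the greedy policy is
  -- completed by `π₀` beyond the horizon.
  let π : Policy S A := fun j => if j < M.H then greedy am (optQ M r) j else π₀ j
  have hπ : ∀ j < M.H, π j = greedy am (optQ M r) j := fun j hj => if_pos hj
  have hM : ∀ j, IsMarkovKernel (π j) := fun j => by
    by_cases hj : j < M.H
    · rw [hπ j hj]; exact isMarkovKernel_greedy hS hQ hj
    · simp only [π, if_neg hj]; exact hπ₀ j
  refine le_trans ?_ (qValue_le_optQ hS hr hM hh x)
  refine (add_le_add_iff_left (r h x)).2 ?_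
  refine integral_mono
    (integrable_of_abs_le (hS.measurable_maxA hQ _) (hS.abs_maxA_le hQ _))
    (integrable_of_abs_le (measurable_stepValue (hS.measurable_rew hr)
      fun j _ _ => hM j) (abs_stepValue_le (hS.abs_rew_le hr) fun j _ _ => hM j)) fun s' => ?_
  -- The half of the Bellman equation already proved suffices, with no error, for the greedy policy
  -- of `Q^⋆` to attain `max_a Q^⋆`; hence there is no circularity.
  have := maxA_le_stepValue_add hS hr hQ hπ (b := 0)
    (fun j hj x => by simpa using optQ_le_bellman hS hr hπ₀ hj x)
    (M.H - (h + 1)) (h + 1) (by omega) s'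
  rw [mul_zero, add_zero] at this
  exact this

theorem value_le_maxA_optQ (hS : Setting M R Qc am) {r : ℕ → S × A → ℝ}
    (hr : r ∈ prodClass M.H R) {π : Policy S A} (hπ : ∀ h, IsMarkovKernel (π h)) :
    value M π r ≤ maxA (optQ M r 0) M.s₁ :=
  stepValue_le_maxA_optQ hS hr hπ (Nat.zero_le _) _

end Bellman

/-! ### Exponential supermartingales for adapted sequences -/

section Adapted

theorem measurable_ennreal_mul {α : Type*} {m : MeasurableSpace α} {f g : α → ℝ≥0∞}
    (hf : Measurable[m] f) (hg : Measurable[m] g) : Measurable[m] fun x => f x * g x :=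
  hf.mul hg

/-- If, given `X`, the law of `Y` is `ν X`, then `Y` may be integrated out first. -/
theorem lintegral_of_condLaw {Ω Ω' T : Type*} [MeasurableSpace Ω] [MeasurableSpace Ω']
    [MeasurableSpace T] {μ : Measure Ω} [IsProbabilityMeasure μ] {X : Ω → Ω'} {Y : Ω → T}
    (hX : Measurable X) (hY : Measurable Y) {ν : Ω' → Measure T} (hν : Measurable ν)
    (hp : ∀ x, IsProbabilityMeasure (ν x))
    (hlaw : ∀ G, MeasurableSet G → ∀ B, MeasurableSet B →
      μ (X ⁻¹' G ∩ Y ⁻¹' B) = ∫⁻ ω in X ⁻¹' G, ν (X ω) B ∂μ)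
    {F : Ω' × T → ℝ≥0∞} (hF : Measurable F) :
    ∫⁻ ω, F (X ω, Y ω) ∂μ = ∫⁻ ω, ∫⁻ t, F (X ω, t) ∂(ν (X ω)) ∂μ := by
  let κ : Kernel Ω' T := ⟨ν, hν⟩
  have : IsMarkovKernel κ := ⟨hp⟩
  have := Measure.isProbabilityMeasure_map (μ := μ) hX.aemeasurable
  have := Measure.isProbabilityMeasure_map (μ := μ) (hX.prodMk hY).aemeasurable
  have key : μ.map (fun ω => (X ω, Y ω)) = (μ.map X) ⊗ₘ κ := by
    refine Measure.ext_prod fun {G B} hG hB => ?_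
    rw [Measure.map_apply (hX.prodMk hY) (hG.prod hB), Measure.compProd_apply_prod hG hB,
      setLIntegral_map hG (κ.measurable_coe hB) hX]
    exact hlaw G hG B hB
  rw [← lintegral_map hF (hX.prodMk hY), key, Measure.lintegral_compProd hF,
    lintegral_map hF.lintegral_kernel_prod_right' hX]
  rfl

variable {Ω T : Type*} {mΩ : MeasurableSpace Ω} [MeasurableSpace T] {μ : Measure Ω}
  [IsProbabilityMeasure μ] {ℱ : Filtration ℕ mΩ} {Y : ℕ → Ω → T} {ν : ℕ → Ω → Measure T} {k : ℕ}

/-- Integrate out the last factor given the past, which costs a factor at most one, and induct.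
Measurability of the product is carried along because the next step uses it as a function of the
past. -/
theorem lintegral_prod_le_one (hY : ∀ i < k, Measurable[ℱ (i + 1)] (Y i))
    (hν : ∀ i < k, Measurable[ℱ i] (ν i)) (hp : ∀ i < k, ∀ ω, IsProbabilityMeasure (ν i ω))
    (hlaw : ∀ i < k, ∀ G, MeasurableSet[ℱ i] G → ∀ B, MeasurableSet B →
      μ (G ∩ Y i ⁻¹' B) = ∫⁻ ω in G, ν i ω B ∂μ)
    {F : ℕ → Ω × T → ℝ≥0∞} (hF : ∀ i < k, Measurable[(ℱ i).prod inferInstance] (F i))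
    (h1 : ∀ i < k, ∀ ω, ∫⁻ t, F i (ω, t) ∂(ν i ω) ≤ 1) :
    Measurable[ℱ k] (fun ω => ∏ i ∈ Finset.range k, F i (ω, Y i ω)) ∧
      ∫⁻ ω, ∏ i ∈ Finset.range k, F i (ω, Y i ω) ∂μ ≤ 1 := by
  induction k with
  | zero => simp
  | succ k ih =>
    obtain ⟨hm, hi⟩ := ih (fun i hik => hY i (by omega)) (fun i hik => hν i (by omega))
      (fun i hik => hp i (by omega)) (fun i hik => hlaw i (by omega))
      (fun i hik => hF i (by omega)) (fun i hik => h1 i (by omega))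
    have hk : k < k + 1 := Nat.lt_succ_self k
    have hid : Measurable[ℱ (k + 1), ℱ k] (id : Ω → Ω) := measurable_id'' (ℱ.mono (Nat.le_succ k))
    have hpair : @Measurable _ _ (ℱ (k + 1)) ((ℱ k).prod inferInstance) (fun ω => (ω, Y k ω)) :=
      @Measurable.prodMk Ω (ℱ (k + 1)) Ω T (ℱ k) _ _ _ hid (hY k hk)
    refine ⟨?_, ?_⟩
    · simp only [Finset.prod_range_succ]
      exact measurable_ennreal_mul (hm.mono (ℱ.mono (Nat.le_succ k)) le_rfl)
        (@Measurable.comp _ _ _ (ℱ (k + 1)) ((ℱ k).prod inferInstance) _ _ _ (hF k hk) hpair)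
    -- The past is represented by the identity, from the full σ-algebra to the coarser `ℱ k`; the
    -- preceding conditional-law lemma applies with this map as `X`.
    · have hX : @Measurable _ _ mΩ (ℱ k) (id : Ω → Ω) := measurable_id'' (ℱ.le k)
      have hG : Measurable[(ℱ k).prod inferInstance] (fun p : Ω × T =>
          (∏ i ∈ Finset.range k, F i (p.1, Y i p.1)) * F k p) :=
        measurable_ennreal_mul
          (@Measurable.comp _ _ _ ((ℱ k).prod inferInstance) (ℱ k) _ _ _ hm
            (@measurable_fst _ _ (ℱ k) _)) (hF k hk)
      have := @lintegral_of_condLaw Ω Ω T mΩ (ℱ k) _ μ _ id (Y k) hX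
        ((hY k hk).mono (ℱ.le _) le_rfl) (ν k) (hν k hk) (hp k hk) (hlaw k hk) _ hG
      simp only [id] at this
      simp only [Finset.prod_range_succ]
      rw [this]
      refine le_trans (lintegral_mono fun ω => ?_) hi
      have hs : Measurable fun t => F k (ω, t) :=
        @Measurable.comp _ _ _ _ ((ℱ k).prod inferInstance) _ _ _ (hF k hk)
          (@measurable_prodMk_left _ _ (ℱ k) _ ω)
      rw [lintegral_const_mul _ hs]
      exact mul_le_of_le_one_right' (h1 k hk ω)

/-- A Chernoff bound for adapted sums. -/
theorem measure_sum_ge_le_exp_neg (hY : ∀ i < k, Measurable[ℱ (i + 1)] (Y i))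
    (hν : ∀ i < k, Measurable[ℱ i] (ν i)) (hp : ∀ i < k, ∀ ω, IsProbabilityMeasure (ν i ω))
    (hlaw : ∀ i < k, ∀ G, MeasurableSet[ℱ i] G → ∀ B, MeasurableSet B →
      μ (G ∩ Y i ⁻¹' B) = ∫⁻ ω in G, ν i ω B ∂μ)
    {F : ℕ → Ω × T → ℝ} (hF : ∀ i < k, Measurable[(ℱ i).prod inferInstance] (F i))
    (h1 : ∀ i < k, ∀ ω, ∫⁻ t, ENNReal.ofReal (Real.exp (F i (ω, t))) ∂(ν i ω) ≤ 1) (a : ℝ) :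
    μ {ω | a ≤ ∑ i ∈ Finset.range k, F i (ω, Y i ω)} ≤ ENNReal.ofReal (Real.exp (-a)) := by
  obtain ⟨hm, hi⟩ := lintegral_prod_le_one (F := fun i p => ENNReal.ofReal (Real.exp (F i p)))
    hY hν hp hlaw (fun i hik =>
      (ENNReal.measurable_ofReal.comp Real.measurable_exp).comp (hF i hik))
    h1
  have hsub : {ω | a ≤ ∑ i ∈ Finset.range k, F i (ω, Y i ω)} ⊆
      {ω | ENNReal.ofReal (Real.exp a) ≤
        ∏ i ∈ Finset.range k, ENNReal.ofReal (Real.exp (F i (ω, Y i ω)))} := fun ω hω => by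
    rw [Set.mem_ofPred_eq, ← ENNReal.ofReal_prod_of_nonneg fun i _ => (Real.exp_pos _).le,
      ← Real.exp_sum]
    exact ENNReal.ofReal_le_ofReal (Real.exp_le_exp.2 hω)
  refine (measure_mono hsub).trans ?_
  refine (meas_ge_le_lintegral_div (hm.mono (ℱ.le k) le_rfl).aemeasurable
    (by simp [Real.exp_pos]) ENNReal.ofReal_ne_top).trans ?_
  refine (ENNReal.div_le_div_right hi _).trans ?_
  rw [one_div, ← ENNReal.ofReal_inv_of_pos (Real.exp_pos a), Real.exp_neg]

end Adapted

/-! ### Measurable dependence of rollout laws on a random greedy policy -/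

section MeasurableRollout
variable {S A : Type*} [MeasurableSpace S] [MeasurableSpace A]
  {M : MDP S A} {R Qc : ℕ → Set (S × A → ℝ)} {am : (S × A → ℝ) → S → A}

/-- Policies carry no σ-algebra, so the law of the next trajectory cannot be obtained by composition
with a measurable map on policies. Instead, joint measurability of the greedy actions in outcome and
state is propagated backwards through the steps, by integrating against kernels on the product
space. -/
theorem measurable_rollout_greedy {Ω' : Type*} [MeasurableSpace Ω'] (hS : Setting M R Qc am)
    {Q : Ω' → ℕ → S × A → ℝ} (hQ : ∀ ω, Q ω ∈ prodClass M.H Qc)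
    (hm : ∀ h < M.H, Measurable fun p : Ω' × S => am (Q p.1 h) p.2) :
    ∀ n h, h + n ≤ M.H → Measurable fun p : Ω' × S => rollout M (greedy am (Q p.1)) n h p.2
  | 0, h, _ => by
      simp only [rollout]
      exact (Kernel.measurable _).comp measurable_snd
  | n + 1, h, hn => by
      have ih := measurable_rollout_greedy hS hQ hm n (h + 1) (by omega)
      let κ : Kernel (Ω' × S) (Traj S A n) :=
        ⟨fun p => rollout M (greedy am (Q p.1)) n (h + 1) p.2, ih⟩
      have hκ : IsMarkovKernel κ := ⟨fun p => by
        have := isMarkovKernel_rollout M (π := greedy am (Q p.1)) n (h + 1)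
          fun j _ hj => isMarkovKernel_greedy hS (hQ p.1) (by omega)
        exact inferInstanceAs (IsProbabilityMeasure (rollout M _ n (h + 1) p.2))⟩
      have := M.markov h
      have hmh := hm h (by omega)
      have hc := Traj.measurable_cons (S := S) (A := A) (n := n)
      refine Measure.measurable_of_measurable_coe _ fun B hB => ?_
      have hind : Measurable (B.indicator (1 : Traj S A (n + 1) → ℝ≥0∞)) :=
        measurable_one.indicator hB
      have hrw : ∀ p : Ω' × S, rollout M (greedy am (Q p.1)) (n + 1) h p.2 B =
          ∫⁻ s', ∫⁻ τ, B.indicator 1 (Traj.cons (p.2, am (Q p.1 h) p.2, τ)) ∂(κ (p.1, s'))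
            ∂(M.P h (p.2, am (Q p.1 h) p.2)) := fun p => by
        have hk := isMarkovKernel_rollout M (π := greedy am (Q p.1)) n (h + 1)
          fun j _ hj => isMarkovKernel_greedy hS (hQ p.1) (by omega)
        rw [← lintegral_indicator_one hB, lintegral_rollout_succ M (fun j _ hj =>
          isMarkovKernel_greedy hS (hQ p.1) (by omega)) _ hind,
          greedy_eq_deterministic hS (hQ p.1) (by omega), Kernel.lintegral_deterministic'
          (f := fun a => ∫⁻ s', ∫⁻ τ, B.indicator 1 (Traj.cons (p.2, a, τ))
            ∂(rollout M (greedy am (Q p.1)) n (h + 1) s') ∂(M.P h (p.2, a)))]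
        · rfl
        · have h2 : Measurable fun q : A × S => ∫⁻ τ, B.indicator (1 : Traj S A (n + 1) → ℝ≥0∞)
              (Traj.cons (p.2, q.1, τ)) ∂(rollout M (greedy am (Q p.1)) n (h + 1) q.2) :=
            Measurable.lintegral_kernel_prod_right' (κ := (rollout M (greedy am (Q p.1)) n
              (h + 1)).comap (fun q : A × S => q.2) measurable_snd)
              (f := fun z =>
                B.indicator (1 : Traj S A (n + 1) → ℝ≥0∞) (Traj.cons (p.2, z.1.1, z.2)))
              (hind.comp (hc.comp (by fun_prop)))
          exact Measurable.lintegral_kernel_prod_right' (κ := (M.P h).comap (fun a => (p.2, a))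
            measurable_prodMk_left) h2
      simp only [hrw]
      have h1 : Measurable fun q : (Ω' × S) × S => ∫⁻ τ, B.indicator (1 : Traj S A (n + 1) → ℝ≥0∞)
          (Traj.cons (q.1.2, am (Q q.1.1 h) q.1.2, τ)) ∂(κ (q.1.1, q.2)) :=
        Measurable.lintegral_kernel_prod_right'
          (κ := κ.comap (fun q : (Ω' × S) × S => (q.1.1, q.2)) (by fun_prop))
          (f := fun z => B.indicator (1 : Traj S A (n + 1) → ℝ≥0∞)
            (Traj.cons (z.1.1.2, am (Q z.1.1.1 h) z.1.1.2, z.2)))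
          (hind.comp (hc.comp ((measurable_snd.comp (measurable_fst.comp measurable_fst)).prodMk
            ((hmh.comp (measurable_fst.comp measurable_fst)).prodMk measurable_snd))))
      exact Measurable.lintegral_kernel_prod_right'
        (κ := (M.P h).comap (fun p : Ω' × S => (p.2, am (Q p.1 h) p.2))
          (measurable_snd.prodMk hmh)) h1

end MeasurableRollout

/-! ### Conditional laws of the trajectories of a run -/

section RunLaw
variable {S A : Type*} [MeasurableSpace S] [MeasurableSpace A]
  {M : MDP S A} {R Qc : ℕ → Set (S × A → ℝ)} {am : (S × A → ℝ) → S → A}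
  {πE π₀ : Policy S A} {N K : ℕ} {Ω : Type*} {mΩ : MeasurableSpace Ω} {μ : Measure Ω}

/-- The policy that is rolled out at iteration `k`. -/
noncomputable def Run.policy (run : Run M R Qc am πE π₀ N K μ) (k : ℕ) (ω : Ω) : Policy S A :=
  if k = 0 then π₀ else greedy am (run.qfun k ω)

theorem Run.isMarkovKernel_policy (run : Run M R Qc am πE π₀ N K μ) (hS : Setting M R Qc am)
    (hπ₀ : ∀ h, IsMarkovKernel (π₀ h)) {k : ℕ} (hk : k ≤ K) (ω : Ω) :
    ∀ h < M.H, IsMarkovKernel (run.policy k ω h) := fun h hh => by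
  rcases eq_or_ne k 0 with rfl | h0
  · exact hπ₀ h
  · rw [policy, if_neg h0]
    exact isMarkovKernel_greedy hS
      (run.qfun_mem k (Finset.mem_Icc.2 ⟨Nat.one_le_iff_ne_zero.2 h0, hk⟩) ω) hh

theorem Run.isProbabilityMeasure_policy (run : Run M R Qc am πE π₀ N K μ)
    (hS : Setting M R Qc am) (hπ₀ : ∀ h, IsMarkovKernel (π₀ h)) {k : ℕ} (hk : k ≤ K) (ω : Ω) :
    IsProbabilityMeasure (trajLaw M (run.policy k ω)) :=
  isProbabilityMeasure_trajLaw (run.isMarkovKernel_policy hS hπ₀ hk ω)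

theorem Run.measurable_policy_law (run : Run M R Qc am πE π₀ N K μ) (hS : Setting M R Qc am)
    {k : ℕ} (hk : k ≤ K) : Measurable[run.info k] fun ω => trajLaw M (run.policy k ω) := by
  rcases eq_or_ne k 0 with rfl | h0
  · simp only [policy, if_true]
    exact @measurable_const _ _ _ (run.info 0) _
  · have hk' : k ∈ Finset.Icc 1 K := Finset.mem_Icc.2 ⟨Nat.one_le_iff_ne_zero.2 h0, hk⟩
    have h1 := @measurable_rollout_greedy S A _ _ M R Qc am Ω (run.info k) hS (run.qfun k)
      (run.qfun_mem k hk') (run.policy_measurable k hk') M.H 0 (by omega)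
    have h2 := @Measurable.comp _ _ _ (run.info k) _ _ _ _ h1
      (@measurable_prodMk_right _ _ (run.info k) _ M.s₁)
    simp only [policy, if_neg h0, trajLaw]
    exact h2

/-- A Chernoff bound for sums of functions of the trajectories of a run. -/
theorem Run.measure_sum_ge_le [IsProbabilityMeasure μ] (run : Run M R Qc am πE π₀ N K μ)
    (hS : Setting M R Qc am) (hπ₀ : ∀ h, IsMarkovKernel (π₀ h)) {k : ℕ} (hk : k ≤ K + 1)
    {F : ℕ → Ω × Traj S A M.H → ℝ}
    (hF : ∀ i < k, Measurable[(run.info i).prod inferInstance] (F i))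
    (h1 : ∀ i < k, ∀ ω,
      ∫⁻ t, ENNReal.ofReal (Real.exp (F i (ω, t))) ∂(trajLaw M (run.policy i ω)) ≤ 1) (a : ℝ) :
    μ {ω | a ≤ ∑ i ∈ Finset.range k, F i (ω, run.traj i ω)} ≤ ENNReal.ofReal (Real.exp (-a)) :=
  measure_sum_ge_le_exp_neg (ℱ := run.info) (fun i hi => run.traj_measurable i (by omega))
    (fun i hi => run.measurable_policy_law hS (by omega))
    (fun i hi => run.isProbabilityMeasure_policy hS hπ₀ (by omega))
    (fun i hi => run.traj_law i (by omega)) hF h1 a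

end RunLaw

/-! ### Exponential inequalities -/

section Exponential

/-- Hoeffding's lemma, as a bound on a Lebesgue integral. -/
theorem lintegral_exp_centered_le {α : Type*} [MeasurableSpace α] {P : Measure α}
    [IsProbabilityMeasure P] {f : α → ℝ} (hf : Measurable f) {a b : ℝ}
    (hb : ∀ x, f x ∈ Set.Icc a b) (t : ℝ) :
    ∫⁻ x, ENNReal.ofReal (Real.exp (t * (f x - ∫ y, f y ∂P))) ∂P ≤
      ENNReal.ofReal (Real.exp (t ^ 2 * (b - a) ^ 2 / 8)) := by
  have hsub := hasSubgaussianMGF_of_mem_Icc (μ := P) hf.aemeasurable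
    (Filter.Eventually.of_forall hb)
  rw [← ofReal_integral_eq_lintegral_ofReal (hsub.integrable_exp_mul t)
    (Filter.Eventually.of_forall fun x => (Real.exp_pos _).le)]
  refine ENNReal.ofReal_le_ofReal ((hsub.mgf_le t).trans_eq ?_)
  congr 1
  push_cast
  rw [Real.norm_eq_abs, div_pow, sq_abs]
  ring

/-- Replaces an exponential by an affine function, so that an expectation can afterwards be moved
into the exponent by `1 - x ≤ exp (-x)`. -/
theorem exp_neg_le_one_sub_half {u : ℝ} (h0 : 0 ≤ u) (h1 : u ≤ 1) :
    Real.exp (-u) ≤ 1 - u / 2 := by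
  have h2 := Real.add_one_le_exp u
  rw [Real.exp_neg, inv_le_comm₀ (Real.exp_pos u) (by linarith)]
  refine le_trans ?_ h2
  rw [inv_le_iff_one_le_mul₀ (by linarith)]
  nlinarith

theorem measurable_integral_of_measurable {Ω T : Type*} {m : MeasurableSpace Ω}
    [MeasurableSpace T] {ν : Ω → Measure T} (hν : Measurable ν)
    (hp : ∀ ω, IsProbabilityMeasure (ν ω)) {g : T → ℝ} (hg : Measurable g) :
    Measurable fun ω => ∫ t, g t ∂(ν ω) := by
  let κ : Kernel Ω T := ⟨ν, hν⟩
  have : IsMarkovKernel κ := ⟨hp⟩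
  exact (hg.stronglyMeasurable.integral_kernel (κ := κ)).measurable

end Exponential

/-! ### Bellman errors and the moment bound for the excess loss -/

section BellmanError
variable {S A : Type*} [MeasurableSpace S] [MeasurableSpace A]
  {M : MDP S A} {R Qc : ℕ → Set (S × A → ℝ)} {am : (S × A → ℝ) → S → A}

/-- The Bellman error of `f` under the reward `r` at step `h`. -/
noncomputable def bellErr (M : MDP S A) (r f : ℕ → S × A → ℝ) (h : ℕ) (x : S × A) : ℝ :=
  f h x - bellman M r h (f (h + 1)) x

/-- The excess of the squared error of `f` over that of its Bellman backup. -/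
noncomputable def excess (M : MDP S A) (r f : ℕ → S × A → ℝ) (h : Fin M.H) (τ : Traj S A M.H) :
    ℝ :=
  (f h (τ.sa h) - r h (τ.sa h) - maxA (f (h + 1)) (τ.next h)) ^ 2 -
    (bellman M r h (f (h + 1)) (τ.sa h) - r h (τ.sa h) - maxA (f (h + 1)) (τ.next h)) ^ 2

/-- Given the state-action pair, the last factor is centred. So the conditional mean of the excess
is the squared Bellman error, and the noise is proportional to the Bellman error itself. -/
theorem excess_eq (M : MDP S A) (r f : ℕ → S × A → ℝ) (h : Fin M.H) (τ : Traj S A M.H) :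
    excess M r f h τ = bellErr M r f h (τ.sa h) ^ 2 - 2 * bellErr M r f h (τ.sa h) *
      (maxA (f (h + 1)) (τ.next h) - ∫ s', maxA (f (h + 1)) s' ∂(M.P h (τ.sa h))) := by
  unfold excess bellErr bellman
  ring

theorem Setting.measurable_bellman (hS : Setting M R Qc am) {r f : ℕ → S × A → ℝ}
    (hr : r ∈ prodClass M.H R) (hf : f ∈ prodClass M.H Qc) {h : ℕ} (hh : h < M.H) :
    Measurable (bellman M r h (f (h + 1))) :=
  (hS.qcl h hh _ (hS.compl r hr f hf h hh)).1

theorem Setting.bellman_mem_Icc (hS : Setting M R Qc am) {r f : ℕ → S × A → ℝ}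
    (hr : r ∈ prodClass M.H R) (hf : f ∈ prodClass M.H Qc) {h : ℕ} (hh : h < M.H) (x : S × A) :
    bellman M r h (f (h + 1)) x ∈ Set.Icc (0 : ℝ) M.H :=
  (hS.qcl h hh _ (hS.compl r hr f hf h hh)).2 x

theorem Setting.measurable_bellErr (hS : Setting M R Qc am) {r f : ℕ → S × A → ℝ}
    (hr : r ∈ prodClass M.H R) (hf : f ∈ prodClass M.H Qc) {h : ℕ} (hh : h < M.H) :
    Measurable (bellErr M r f h) :=
  (hS.measurable_q hf h).sub (hS.measurable_bellman hr hf hh)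

theorem Setting.abs_bellErr_le (hS : Setting M R Qc am) {r f : ℕ → S × A → ℝ}
    (hr : r ∈ prodClass M.H R) (hf : f ∈ prodClass M.H Qc) {h : ℕ} (hh : h < M.H) (x : S × A) :
    |bellErr M r f h x| ≤ M.H := by
  have h1 := hS.q_mem_Icc hf h x
  have h2 := hS.bellman_mem_Icc hr hf hh x
  unfold bellErr
  exact abs_sub_le_iff.2 ⟨by linarith [h1.2, h2.1], by linarith [h1.1, h2.2]⟩

theorem Setting.bellErr_sq_le (hS : Setting M R Qc am) {r f : ℕ → S × A → ℝ}
    (hr : r ∈ prodClass M.H R) (hf : f ∈ prodClass M.H Qc) {h : ℕ} (hh : h < M.H) (x : S × A) :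
    bellErr M r f h x ^ 2 ≤ (M.H : ℝ) ^ 2 :=
  sq_le_sq' (by linarith [(abs_le.1 (hS.abs_bellErr_le hr hf hh x)).1])
    (abs_le.1 (hS.abs_bellErr_le hr hf hh x)).2

theorem Setting.measurable_excess (hS : Setting M R Qc am) {r f : ℕ → S × A → ℝ}
    (hr : r ∈ prodClass M.H R) (hf : f ∈ prodClass M.H Qc) (h : Fin M.H) :
    Measurable (excess M r f h) := by
  have h1 := (hS.measurable_maxA hf (h + 1)).comp (measurable_next (S := S) (A := A) h)
  have h2 := (hS.measurable_rew hr h).comp (measurable_sa (S := S) (A := A) h)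
  have h3 := (hS.measurable_q hf h).comp (measurable_sa (S := S) (A := A) h)
  have h4 := (hS.measurable_bellman hr hf h.2).comp (measurable_sa (S := S) (A := A) h)
  exact (((h3.sub h2).sub h1).pow_const 2).sub (((h4.sub h2).sub h1).pow_const 2)

/-- The exponential moment bound behind the concentration of the excess squared error. -/
theorem lintegral_exp_excess_le_one (hS : Setting M R Qc am) {r f : ℕ → S × A → ℝ}
    (hr : r ∈ prodClass M.H R) (hf : f ∈ prodClass M.H Qc) {π : Policy S A}
    (hπ : ∀ h < M.H, IsMarkovKernel (π h)) (h : Fin M.H) :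
    ∫⁻ τ, ENNReal.ofReal (Real.exp (-(excess M r f h τ) / (M.H : ℝ) ^ 2 +
      (∫ τ', bellErr M r f h (τ'.sa h) ^ 2 ∂(trajLaw M π)) / (4 * (M.H : ℝ) ^ 2)))
      ∂(trajLaw M π) ≤ 1 := by
  have hprob := isProbabilityMeasure_trajLaw hπ
  have hH : (0 : ℝ) < M.H := by exact_mod_cast hS.one_le
  have hH2 : (0 : ℝ) < (M.H : ℝ) ^ 2 := by positivity
  have := M.markov h
  have hD := hS.measurable_bellErr hr hf h.2
  have hG := hS.measurable_maxA hf (h + 1)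
  set D := bellErr M r f h with hDdef
  set G := maxA (f (h + 1)) with hGdef
  set E := ∫ τ', D (τ'.sa h) ^ 2 ∂(trajLaw M π) with hE
  have hPG : Measurable fun x => ∫ s', G s' ∂(M.P h x) :=
    (hG.stronglyMeasurable.integral_kernel (κ := M.P h)).measurable
  have step : ∫⁻ τ, ENNReal.ofReal (Real.exp (-(excess M r f h τ) / (M.H : ℝ) ^ 2))
      ∂(trajLaw M π) ≤ ENNReal.ofReal (Real.exp (-(E / (4 * (M.H : ℝ) ^ 2)))) := by
    have hmeas : Measurable fun p : (S × A) × S =>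
        ENNReal.ofReal (Real.exp (-D p.1 ^ 2 / (M.H : ℝ) ^ 2) *
          Real.exp (2 * D p.1 / (M.H : ℝ) ^ 2 * (G p.2 - ∫ s', G s' ∂(M.P h p.1)))) := by
      have h1 : Measurable fun p : (S × A) × S => D p.1 := hD.comp measurable_fst
      have h2 : Measurable fun p : (S × A) × S => G p.2 := hG.comp measurable_snd
      have h3 : Measurable fun p : (S × A) × S => ∫ s', G s' ∂(M.P h p.1) :=
        hPG.comp measurable_fst
      fun_prop
    have hstep := rollout_step M (π := π) (n := M.H) (h := 0) (fun j _ hj => hπ j (by omega)) M.s₁ h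
      hmeas
    simp only [zero_add] at hstep
    calc ∫⁻ τ, ENNReal.ofReal (Real.exp (-(excess M r f h τ) / (M.H : ℝ) ^ 2)) ∂(trajLaw M π)
        = ∫⁻ τ, ENNReal.ofReal (Real.exp (-D (τ.sa h) ^ 2 / (M.H : ℝ) ^ 2)
          * Real.exp (2 * D (τ.sa h) / (M.H : ℝ) ^ 2 * (G (τ.next h) -
            ∫ s', G s' ∂(M.P h (τ.sa h))))) ∂(trajLaw M π) := by
          refine lintegral_congr fun τ => ?_
          rw [← Real.exp_add, excess_eq]
          congr 2
          ring
      _ = _ := hstep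
      -- Given the state-action pair, Hoeffding's lemma with parameter `2 D / H²` and a range of
      -- length `H` costs `D² / (2 H²)`. Half of `-D² / H²` survives, and `exp (-u) ≤ 1 - u / 2` is
      -- applied to `u = D² / (2 H²) ≤ 1`.
      _ ≤ ∫⁻ τ, ENNReal.ofReal (1 - D (τ.sa h) ^ 2 / (4 * (M.H : ℝ) ^ 2))
            ∂(rollout M π M.H 0 M.s₁) := by
          refine lintegral_mono fun τ => ?_
          simp only [ENNReal.ofReal_mul (Real.exp_pos _).le]
          rw [lintegral_const_mul _ (by fun_prop)]
          refine (mul_le_mul_right (lintegral_exp_centered_le hG (hS.maxA_mem_Icc hf _) _)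
            _).trans ?_
          rw [← ENNReal.ofReal_mul (Real.exp_pos _).le, ← Real.exp_add]
          refine ENNReal.ofReal_le_ofReal ?_
          have hDs := hS.bellErr_sq_le hr hf h.2 (τ.sa h)
          have hu := exp_neg_le_one_sub_half (u := D (τ.sa h) ^ 2 / (2 * (M.H : ℝ) ^ 2))
            (by positivity) (by rw [div_le_one (by positivity)]; linarith)
          convert! hu using 2
          · field_simp; ring
          · field_simp; ring
      _ = ENNReal.ofReal (∫ τ, (1 - D (τ.sa h) ^ 2 / (4 * (M.H : ℝ) ^ 2)) ∂(trajLaw M π)) := by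
          rw [ofReal_integral_eq_lintegral_ofReal]
          · rfl
          · refine integrable_of_abs_le (b := 1) ?_ fun τ => ?_
            · exact measurable_const.sub (((hD.comp (measurable_sa h)).pow_const 2).div_const _)
            · have hDs := hS.bellErr_sq_le hr hf h.2 (τ.sa h)
              have h1 : D (τ.sa h) ^ 2 / (4 * (M.H : ℝ) ^ 2) ≤ 1 := by
                rw [div_le_one (by positivity)]; linarith
              have h2 : 0 ≤ D (τ.sa h) ^ 2 / (4 * (M.H : ℝ) ^ 2) := by positivity
              exact abs_le.2 ⟨by linarith, by linarith⟩
          · refine Filter.Eventually.of_forall fun τ => ?_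
            have hDs := hS.bellErr_sq_le hr hf h.2 (τ.sa h)
            have h1 : D (τ.sa h) ^ 2 / (4 * (M.H : ℝ) ^ 2) ≤ 1 := by
              rw [div_le_one (by positivity)]; linarith
            simpa using h1
      _ ≤ _ := by
          refine ENNReal.ofReal_le_ofReal ?_
          have hi : Integrable (fun τ : Traj S A M.H => D (τ.sa h) ^ 2) (trajLaw M π) :=
            integrable_of_abs_le (b := (M.H : ℝ) ^ 2) ((hD.comp (measurable_sa h)).pow_const 2)
              fun τ => by simpa using hS.bellErr_sq_le hr hf h.2 (τ.sa h)
          rw [integral_sub (integrable_const _) (hi.div_const _), integral_div]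
          simp only [integral_const, probReal_univ, one_smul]
          linarith [Real.add_one_le_exp (-(E / (4 * (M.H : ℝ) ^ 2)))]
  simp only [Real.exp_add, ENNReal.ofReal_mul (Real.exp_pos _).le]
  have hX := hS.measurable_excess hr hf h
  rw [lintegral_mul_const _ (by fun_prop)]
  refine (mul_le_mul_left step _).trans ?_
  rw [← ENNReal.ofReal_mul (Real.exp_pos _).le, ← Real.exp_add]
  simp

end BellmanError

/-! ### Finite covers -/

section Covers
variable {X : Type*}

/-- Cardinalities lie in `ℕ∞`, where the infimum of a nonempty family is attained; finiteness of the
covering number gives nonemptiness. -/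
theorem exists_cover {ρ : ℝ} {F : Set (X → ℝ)} (hF : coveringNumber ρ F ≠ ⊤) :
    ∃ T : Finset (X → ℝ), (T : Set (X → ℝ)) ⊆ F ∧ (∀ f ∈ F, ∃ f' ∈ T, ∀ x, |f x - f' x| ≤ ρ) ∧
      T.card = covN ρ F := by
  have hne : Nonempty {F' : Set (X → ℝ) // F' ⊆ F ∧ ∀ f ∈ F, ∃ f' ∈ F', ∀ x, |f x - f' x| ≤ ρ} := by
    by_contra hcon
    rw [not_nonempty_iff] at hcon
    refine hF ?_
    simp only [coveringNumber, iInf_eq_top]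
    exact fun F' h => (hcon.false ⟨F', h⟩).elim
  obtain ⟨⟨F', hsub, hcov⟩, hF'⟩ := ENat.exists_eq_iInf
    (fun F' : {F' : Set (X → ℝ) // F' ⊆ F ∧ ∀ f ∈ F, ∃ f' ∈ F', ∀ x, |f x - f' x| ≤ ρ} =>
      F'.1.encard)
  have heq : F'.encard = coveringNumber ρ F := by
    rw [coveringNumber]
    exact hF'.trans (iInf_subtype (p := fun F' : Set (X → ℝ) => F' ⊆ F ∧ ∀ f ∈ F, ∃ f' ∈ F', ∀ x,
      |f x - f' x| ≤ ρ) (f := fun F' => F'.1.encard))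
  have hfin : F'.Finite := Set.encard_ne_top_iff.1 (heq ▸ hF)
  refine ⟨hfin.toFinset, by simpa using hsub, fun f hf => by simpa using hcov f hf, ?_⟩
  rw [covN, ← heq, hfin.encard_eq_coe_toFinset_card, ENat.toNat_natCast]

theorem coveringNumber_le_card {ρ : ℝ} {F : Set (X → ℝ)} {T : Finset (X → ℝ)}
    (hsub : (T : Set (X → ℝ)) ⊆ F) (hcov : ∀ f ∈ F, ∃ f' ∈ T, ∀ x, |f x - f' x| ≤ ρ) :
    coveringNumber ρ F ≤ T.card := by
  rw [← Set.encard_coe_eq_coe_finsetCard]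
  exact iInf₂_le (T : Set (X → ℝ)) ⟨hsub, hcov⟩

theorem one_le_covN {ρ : ℝ} {F : Set (X → ℝ)} (hF : coveringNumber ρ F ≠ ⊤) (hne : F.Nonempty) :
    1 ≤ covN ρ F := by
  obtain ⟨T, -, hcov, hcard⟩ := exists_cover hF
  obtain ⟨f, hf⟩ := hne
  obtain ⟨f', hf', -⟩ := hcov f hf
  rw [← hcard]
  exact Finset.card_pos.2 ⟨f', hf'⟩

/-- All members are within `ρ` of the same centre. This drives the degenerate cases, in which
concentration is replaced by a deterministic estimate. -/
theorem abs_sub_le_of_covN_eq_one {ρ : ℝ} {F : Set (X → ℝ)} (hF : coveringNumber ρ F ≠ ⊤)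
    (h1 : covN ρ F = 1) {f g : X → ℝ} (hf : f ∈ F) (hg : g ∈ F) (x : X) :
    |f x - g x| ≤ 2 * ρ := by
  obtain ⟨T, -, hcov, hcard⟩ := exists_cover hF
  rw [h1, Finset.card_eq_one] at hcard
  obtain ⟨c, rfl⟩ := hcard
  obtain ⟨f', hf', h2⟩ := hcov f hf
  obtain ⟨g', hg', h3⟩ := hcov g hg
  rw [Finset.mem_singleton] at hf' hg'
  subst hf' hg'
  have h4 := h2 x
  have h5 := h3 x
  rw [abs_sub_comm] at h5
  linarith [abs_sub_le (f x) (g' x) (g x)]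

/-- A product class has a cover whose size is its covering number, which is at most the product
of the covering numbers of the factors. -/
theorem exists_cover_prodClass {S A : Type*} {ρ : ℝ} (hρ : 0 ≤ ρ) {H : ℕ}
    {F : ℕ → Set (S × A → ℝ)} (hF : ∀ h < H, coveringNumber ρ (F h) ≠ ⊤) :
    (∃ T : Finset (ℕ → S × A → ℝ), (T : Set _) ⊆ prodClass H F ∧
      (∀ f ∈ prodClass H F, ∃ f' ∈ T, ∀ h x, |f h x - f' h x| ≤ ρ) ∧
      T.card = covNProd ρ (prodClass H F)) ∧
    covNProd ρ (prodClass H F) ≤ ∏ h ∈ Finset.range H, covN ρ (F h) := by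
  classical
  choose T hsub hcov hcard using fun h : Fin H => exists_cover (hF h h.2)
  -- A choice of one function per step becomes a member of the product class by extension with zero,
  -- so products of the covers of the factors cover the product.
  let e : (Fin H → S × A → ℝ) → ℕ × (S × A) → ℝ :=
    fun g p => if hh : p.1 < H then g ⟨p.1, hh⟩ p.2 else 0
  let U : Finset (ℕ × (S × A) → ℝ) := (Fintype.piFinset T).image e
  set G : Set (ℕ × (S × A) → ℝ) := (fun f (p : ℕ × (S × A)) => f p.1 p.2) '' prodClass H F with hG
  have hUsub : (U : Set _) ⊆ G := by
    intro u hu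
    obtain ⟨g, hg, rfl⟩ := Finset.mem_image.1 (Finset.mem_coe.1 hu)
    rw [Fintype.mem_piFinset] at hg
    refine ⟨fun h x => e g (h, x), ⟨fun h hh => ?_, fun h hh => ?_⟩, rfl⟩
    · have : (fun x => e g (h, x)) = g ⟨h, hh⟩ := by funext x; simp [e, hh]
      have h3 : g ⟨h, hh⟩ ∈ F h := hsub ⟨h, hh⟩ (hg ⟨h, hh⟩)
      rw [← this] at h3
      exact h3
    · funext x; simp [e, not_lt.2 hh]
  have hUcov : ∀ f ∈ G, ∃ f' ∈ U, ∀ x, |f x - f' x| ≤ ρ := by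
    rintro _ ⟨f, hf, rfl⟩
    choose c hc hd using fun h : Fin H => hcov h (f h) (hf.1 h h.2)
    refine ⟨e c, Finset.mem_image.2 ⟨c, Fintype.mem_piFinset.2 hc, rfl⟩, fun p => ?_⟩
    by_cases hp : p.1 < H
    · simpa [e, hp] using hd ⟨p.1, hp⟩ p.2
    · simp [e, hp, hf.2 p.1 (by omega), hρ]
  have hle := coveringNumber_le_card hUsub hUcov
  have htop : coveringNumber ρ G ≠ ⊤ := ne_top_of_le_ne_top (ENat.natCast_ne_top _) hle
  refine ⟨?_, ?_⟩
  · obtain ⟨V, hV, hVcov, hVcard⟩ := exists_cover htop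
    have hinj : Set.InjOn (fun (v : ℕ × (S × A) → ℝ) (h : ℕ) (x : S × A) => v (h, x)) V :=
      fun v _ w _ hvw => funext fun p => congrFun (congrFun hvw p.1) p.2
    refine ⟨V.image fun v h x => v (h, x), fun f hf => ?_, fun f hf => ?_, ?_⟩
    · obtain ⟨v, hv, rfl⟩ := Finset.mem_image.1 (Finset.mem_coe.1 hf)
      obtain ⟨g, hg, rfl⟩ := hV hv
      exact hg
    · obtain ⟨v, hv, hd⟩ := hVcov _ ⟨f, hf, rfl⟩
      exact ⟨_, Finset.mem_image_of_mem _ hv, fun h x => hd (h, x)⟩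
    · rw [Finset.card_image_of_injOn hinj, hVcard]; rfl
  · refine (ENat.toNat_le_of_le_natCast hle).trans (Finset.card_image_le.trans ?_)
    rw [Fintype.card_piFinset, ← Fin.prod_univ_eq_prod_range]
    exact (Finset.prod_congr rfl fun h _ => hcard h).le

end Covers

/-! ### Uniform concentration of the excess loss -/

section Concentration

theorem measurable_neg_div_add_div {α : Type*} {m : MeasurableSpace α} {f g : α → ℝ}
    (hf : Measurable[m] f) (hg : Measurable[m] g) (c d : ℝ) :
    Measurable[m] fun x => -f x / c + g x / d :=
  (hf.neg.div_const c).add (hg.div_const d)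

variable {S A : Type*} [MeasurableSpace S] [MeasurableSpace A]
  {M : MDP S A} {R Qc : ℕ → Set (S × A → ℝ)} {am : (S × A → ℝ) → S → A}
  {πE π₀ : Policy S A} {N K : ℕ} {Ω : Type*} {mΩ : MeasurableSpace Ω} {μ : Measure Ω}
  [IsProbabilityMeasure μ]

/-- The Chernoff bound for runs applied to the exponent of `lintegral_exp_excess_le_one`, and
multiplied through by `4 H²`. The expected errors on the left are conditional on the past, through
the random policies. -/
theorem Run.measure_excess_le (run : Run M R Qc am πE π₀ N K μ)
    (hS : Setting M R Qc am) (hπ₀ : ∀ h, IsMarkovKernel (π₀ h)) {k : ℕ} (hk : k ≤ K + 1)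
    {r f : ℕ → S × A → ℝ} (hr : r ∈ prodClass M.H R) (hf : f ∈ prodClass M.H Qc)
    (h : Fin M.H) (L : ℝ) :
    μ {ω | ¬ ∑ i ∈ Finset.range k, ∫ τ, bellErr M r f h (τ.sa h) ^ 2
          ∂(trajLaw M (run.policy i ω)) ≤
        4 * ∑ i ∈ Finset.range k, excess M r f h (run.traj i ω) + 4 * (M.H : ℝ) ^ 2 * L} ≤
      ENNReal.ofReal (Real.exp (-L)) := by
  have hH : (0 : ℝ) < M.H := by exact_mod_cast hS.one_le
  refine le_trans (measure_mono fun ω hω => ?_) (run.measure_sum_ge_le hS hπ₀ hk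
    (F := fun i p => -(excess M r f h p.2) / (M.H : ℝ) ^ 2 +
      (∫ τ', bellErr M r f h (τ'.sa h) ^ 2 ∂(trajLaw M (run.policy i p.1))) / (4 * (M.H : ℝ) ^ 2))
    (fun i hi => ?_) (fun i hi ω =>
      lintegral_exp_excess_le_one hS hr hf (run.isMarkovKernel_policy hS hπ₀ (by omega) ω) h) L)
  · rw [Set.mem_ofPred_eq, not_le] at hω
    rw [Set.mem_ofPred_eq, Finset.sum_add_distrib, ← Finset.sum_div, ← Finset.sum_div,
      Finset.sum_neg_distrib]
    have h2 : (0 : ℝ) < 4 * (M.H : ℝ) ^ 2 := by positivity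
    rw [← mul_le_mul_iff_right₀ h2, mul_add, mul_div_cancel₀ _ h2.ne']
    have h3 : 4 * (M.H : ℝ) ^ 2 * (-(∑ i ∈ Finset.range k, excess M r f h (run.traj i ω)) /
        (M.H : ℝ) ^ 2) = -4 * ∑ i ∈ Finset.range k, excess M r f h (run.traj i ω) := by
      field_simp
    rw [h3]
    linarith
  · have h1 : Measurable[run.info i] fun ω =>
        ∫ τ', bellErr M r f h (τ'.sa h) ^ 2 ∂(trajLaw M (run.policy i ω)) :=
      measurable_integral_of_measurable (run.measurable_policy_law hS (by omega))
        (run.isProbabilityMeasure_policy hS hπ₀ (by omega))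
        (((hS.measurable_bellErr hr hf h.2).comp (measurable_sa h)).pow_const 2)
    have h2 : @Measurable _ _ ((run.info i).prod inferInstance) _
        (fun p : Ω × Traj S A M.H => excess M r f h p.2) :=
      @Measurable.comp _ _ _ ((run.info i).prod inferInstance) _ _ _ _
        (hS.measurable_excess hr hf h) (@measurable_snd _ _ (run.info i) _)
    have h3 : @Measurable _ _ ((run.info i).prod inferInstance) _
        (fun p : Ω × Traj S A M.H =>
          ∫ τ', bellErr M r f h (τ'.sa h) ^ 2 ∂(trajLaw M (run.policy i p.1))) :=
      @Measurable.comp _ _ _ ((run.info i).prod inferInstance) (run.info i) _ _ _ h1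
        (@measurable_fst _ _ (run.info i) _)
    exact measurable_neg_div_add_div h2 h3 _ _

theorem Setting.abs_maxA_sub_le (hS : Setting M R Qc am) {f f' : ℕ → S × A → ℝ}
    (hf : f ∈ prodClass M.H Qc) (hf' : f' ∈ prodClass M.H Qc) {ρ : ℝ} {h : ℕ}
    (hd : ∀ x, |f h x - f' h x| ≤ ρ) (s : S) : |maxA (f h) s - maxA (f' h) s| ≤ ρ := by
  have := hS.nonempty_action
  exact OptAIL.abs_maxA_sub_le s (hS.bddAbove_q hf h s) (hS.bddAbove_q hf' h s) hd

theorem Setting.abs_integral_maxA_sub_le (hS : Setting M R Qc am) {f f' : ℕ → S × A → ℝ}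
    (hf : f ∈ prodClass M.H Qc) (hf' : f' ∈ prodClass M.H Qc) {ρ : ℝ} {h : ℕ}
    (hd : ∀ x, |f (h + 1) x - f' (h + 1) x| ≤ ρ) (x : S × A) :
    |∫ s, maxA (f (h + 1)) s ∂(M.P h x) - ∫ s, maxA (f' (h + 1)) s ∂(M.P h x)| ≤ ρ := by
  have := M.markov h
  rw [← integral_sub (integrable_of_abs_le (hS.measurable_maxA hf _) (hS.abs_maxA_le hf _))
    (integrable_of_abs_le (hS.measurable_maxA hf' _) (hS.abs_maxA_le hf' _))]
  exact abs_integral_le_of_abs_le fun s => hS.abs_maxA_sub_le hf hf' hd s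

theorem abs_sq_sub_sq_le {a b c e : ℝ} (hc : |a| ≤ c) (hc' : |b| ≤ c) (he : |a - b| ≤ e) :
    |a ^ 2 - b ^ 2| ≤ 2 * c * e := by
  rw [sq_sub_sq, abs_mul]
  have h1 : |a + b| ≤ 2 * c := (abs_add_le _ _).trans (by linarith)
  have : 0 ≤ 2 * c := (abs_nonneg _).trans h1
  exact mul_le_mul h1 he (abs_nonneg _) this

theorem Setting.abs_bellErr_sub_le (hS : Setting M R Qc am) {r r' f f' : ℕ → S × A → ℝ}
    (hf : f ∈ prodClass M.H Qc) (hf' : f' ∈ prodClass M.H Qc) {ρ : ℝ}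
    (hdr : ∀ h x, |r h x - r' h x| ≤ ρ) (hdf : ∀ h x, |f h x - f' h x| ≤ ρ) (h : ℕ) (x : S × A) :
    |bellErr M r f h x - bellErr M r' f' h x| ≤ 3 * ρ := by
  have h1 := abs_le.1 (hS.abs_integral_maxA_sub_le hf hf' (h := h) (hdf (h + 1)) x)
  have h2 := abs_le.1 (hdr h x)
  have h3 := abs_le.1 (hdf h x)
  unfold bellErr bellman
  exact abs_le.2 ⟨by linarith, by linarith⟩

theorem Setting.abs_excess_sub_le (hS : Setting M R Qc am) {r r' f f' : ℕ → S × A → ℝ}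
    (hr : r ∈ prodClass M.H R) (hr' : r' ∈ prodClass M.H R)
    (hf : f ∈ prodClass M.H Qc) (hf' : f' ∈ prodClass M.H Qc) {ρ : ℝ}
    (hdr : ∀ h x, |r h x - r' h x| ≤ ρ) (hdf : ∀ h x, |f h x - f' h x| ≤ ρ) (h : Fin M.H)
    (τ : Traj S A M.H) :
    |excess M r f h τ - excess M r' f' h τ| ≤ 20 * M.H * ρ := by
  have hH : (1 : ℝ) ≤ M.H := by exact_mod_cast hS.one_le
  have bd : ∀ {r f : ℕ → S × A → ℝ}, r ∈ prodClass M.H R → f ∈ prodClass M.H Qc →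
      |f h (τ.sa h) - r h (τ.sa h) - maxA (f (h + 1)) (τ.next h)| ≤ 2 * M.H ∧
      |bellman M r h (f (h + 1)) (τ.sa h) - r h (τ.sa h) - maxA (f (h + 1)) (τ.next h)| ≤
        2 * M.H := fun {r f} hr hf => by
    have h1 := hS.q_mem_Icc hf h (τ.sa h)
    have h2 := hS.rew_mem_Icc hr h (τ.sa h)
    have h3 := hS.maxA_mem_Icc hf (h + 1) (τ.next h)
    have h4 := hS.bellman_mem_Icc hr hf h.2 (τ.sa h)
    exact ⟨abs_le.2 ⟨by linarith [h1.1, h2.2, h3.2], by linarith [h1.2, h2.1, h3.1]⟩,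
      abs_le.2 ⟨by linarith [h4.1, h2.2, h3.2], by linarith [h4.2, h2.1, h3.1]⟩⟩
  have h1 := abs_le.1 (hS.abs_integral_maxA_sub_le hf hf' (h := h) (hdf (h + 1)) (τ.sa h))
  have h2 := abs_le.1 (hdr h (τ.sa h))
  have h3 := abs_le.1 (hdf h (τ.sa h))
  have h4 := abs_le.1 (hS.abs_maxA_sub_le hf hf' (hdf (h + 1)) (τ.next h))
  -- Residuals are at most `2H` in absolute value. Those of `f` move by at most `3ρ` and those of
  -- its backup by at most `2ρ`, where the rewards cancel. This gives `12 Hρ + 8 Hρ`.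
  have e1 := abs_sq_sub_sq_le (bd hr hf).1 (bd hr' hf').1 (e := 3 * ρ)
    (abs_le.2 ⟨by linarith, by linarith⟩)
  have e2 := abs_sq_sub_sq_le (bd hr hf).2 (bd hr' hf').2 (e := 2 * ρ)
    (by unfold bellman; exact abs_le.2 ⟨by linarith, by linarith⟩)
  have hρ : 0 ≤ (M.H : ℝ) * ρ := mul_nonneg (by linarith) (by linarith)
  have e1' := abs_le.1 e1
  have e2' := abs_le.1 e2
  unfold excess
  exact abs_le.2 ⟨by linarith, by linarith⟩

/-- The excess squared errors of all members of the classes concentrate simultaneously. -/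
theorem Run.measure_bellman_le (run : Run M R Qc am πE π₀ N K μ)
    (hS : Setting M R Qc am) (hπ₀ : ∀ h, IsMarkovKernel (π₀ h)) {ρ : ℝ} (hρ : 0 ≤ ρ)
    (hR : ∀ h < M.H, coveringNumber ρ (R h) ≠ ⊤) (hQ : ∀ h < M.H, coveringNumber ρ (Qc h) ≠ ⊤)
    (L : ℝ) :
    μ {ω | ¬ ∀ k ∈ Finset.Icc 1 K, ∀ h : Fin M.H, ∀ r ∈ prodClass M.H R, ∀ f ∈ prodClass M.H Qc,
        ∑ i ∈ Finset.range k, ∫ τ, bellErr M r f h (τ.sa h) ^ 2 ∂(trajLaw M (run.policy i ω)) ≤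
        4 * ∑ i ∈ Finset.range k, excess M r f h (run.traj i ω) +
          (4 * (M.H : ℝ) ^ 2 * L + 86 * M.H * ρ * k)} ≤
      ENNReal.ofReal (K * M.H * covNProd ρ (prodClass M.H Qc) * covNProd ρ (prodClass M.H R) *
        Real.exp (-L)) := by
  classical
  obtain ⟨⟨TR, hTR, hcR, hnR⟩, -⟩ := exists_cover_prodClass hρ hR
  obtain ⟨⟨TQ, hTQ, hcQ, hnQ⟩, -⟩ := exists_cover_prodClass hρ hQ
  -- The bad events are indexed by deterministic pairs from the covers, for which the
  -- supermartingale bound is available.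
  let bad : ℕ → Fin M.H → (ℕ → S × A → ℝ) → (ℕ → S × A → ℝ) → Set Ω := fun k h f r =>
    {ω | ¬ ∑ i ∈ Finset.range k, ∫ τ, bellErr M r f h (τ.sa h) ^ 2
          ∂(trajLaw M (run.policy i ω)) ≤
        4 * ∑ i ∈ Finset.range k, excess M r f h (run.traj i ω) + 4 * (M.H : ℝ) ^ 2 * L}
  have hbad : ∀ k ∈ Finset.Icc 1 K, ∀ h, ∀ f ∈ TQ, ∀ r ∈ TR,
      μ (bad k h f r) ≤ ENNReal.ofReal (Real.exp (-L)) := fun k hk h f hf r hr =>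
    run.measure_excess_le hS hπ₀ (by have := (Finset.mem_Icc.1 hk).2; omega) (hTR hr) (hTQ hf) h L
  refine le_trans (measure_mono (t := ⋃ k ∈ Finset.Icc 1 K, ⋃ h ∈ (Finset.univ : Finset (Fin M.H)),
    ⋃ f ∈ TQ, ⋃ r ∈ TR, bad k h f r) fun ω hω => ?_) ?_
  · by_contra hcon
    refine hω fun k hk h r hr f hf => ?_
    obtain ⟨r', hr', hdr⟩ := hcR r hr
    obtain ⟨f', hf', hdf⟩ := hcQ f hf
    have hgood : ω ∉ bad k h f' r' := fun hb => hcon <| by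
      simp only [Set.mem_iUnion]
      exact ⟨k, hk, h, Finset.mem_univ _, f', hf', r', hr', hb⟩
    simp only [bad, Set.mem_ofPred_eq, not_not] at hgood
    have hR' := hTR hr'
    have hQ' := hTQ hf'
    -- Passing to the cover costs `6 Hρ` per trajectory here and `20 Hρ` in the excess, which is
    -- multiplied by four: `86 = 6 + 4 · 20`.
    have h1 : ∀ i ∈ Finset.range k, ∫ τ, bellErr M r f h (τ.sa h) ^ 2
        ∂(trajLaw M (run.policy i ω)) ≤ ∫ τ, bellErr M r' f' h (τ.sa h) ^ 2
        ∂(trajLaw M (run.policy i ω)) + 6 * M.H * ρ := fun i hi => by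
      have hik : i ≤ K := by
        have := (Finset.mem_Icc.1 hk).2
        have := Finset.mem_range.1 hi
        omega
      have := run.isProbabilityMeasure_policy hS hπ₀ hik ω
      have hi : ∀ {r f : ℕ → S × A → ℝ}, r ∈ prodClass M.H R → f ∈ prodClass M.H Qc →
          Integrable (fun τ : Traj S A M.H => bellErr M r f h (τ.sa h) ^ 2)
            (trajLaw M (run.policy i ω)) := fun {r f} hr hf =>
        integrable_of_abs_le (b := (M.H : ℝ) ^ 2)
          (((hS.measurable_bellErr hr hf h.2).comp (measurable_sa h)).pow_const 2)
          fun τ => by simpa using hS.bellErr_sq_le hr hf h.2 (τ.sa h)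
      rw [← sub_le_iff_le_add', ← integral_sub (hi hr hf) (hi hR' hQ')]
      refine (le_abs_self _).trans (abs_integral_le_of_abs_le fun τ => ?_)
      refine (abs_sq_sub_sq_le (hS.abs_bellErr_le hr hf h.2 _) (hS.abs_bellErr_le hR' hQ' h.2 _)
        (hS.abs_bellErr_sub_le hf hQ' hdr hdf h _)).trans_eq (by ring)
    have h2 : ∀ i ∈ Finset.range k, excess M r' f' h (run.traj i ω) ≤
        excess M r f h (run.traj i ω) + 20 * M.H * ρ := fun i _ => by
      have := (abs_le.1 (hS.abs_excess_sub_le hr hR' hf hQ' hdr hdf h (run.traj i ω))).1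
      linarith
    have h1' := Finset.sum_le_sum h1
    have h2' := Finset.sum_le_sum h2
    rw [Finset.sum_add_distrib] at h1' h2'
    simp only [Finset.sum_const, Finset.card_range, nsmul_eq_mul] at h1' h2'
    linarith
  · have hb := measure_biUnion_finset_le (μ := μ) (Finset.Icc 1 K) fun k =>
      ⋃ h ∈ (Finset.univ : Finset (Fin M.H)), ⋃ f ∈ TQ, ⋃ r ∈ TR, bad k h f r
    refine hb.trans ?_
    calc ∑ k ∈ Finset.Icc 1 K, μ (⋃ h ∈ (Finset.univ : Finset (Fin M.H)), ⋃ f ∈ TQ, ⋃ r ∈ TR,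
          bad k h f r)
        ≤ ∑ k ∈ Finset.Icc 1 K, ∑ h ∈ (Finset.univ : Finset (Fin M.H)), ∑ f ∈ TQ, ∑ r ∈ TR,
          ENNReal.ofReal (Real.exp (-L)) := by
          refine Finset.sum_le_sum fun k hk => (measure_biUnion_finset_le _ _).trans ?_
          refine Finset.sum_le_sum fun h _ => (measure_biUnion_finset_le _ _).trans ?_
          refine Finset.sum_le_sum fun f hf => (measure_biUnion_finset_le _ _).trans ?_
          exact Finset.sum_le_sum fun r hr => hbad k hk h f hf r hr
      _ = _ := by
          simp only [Finset.sum_const, Finset.card_univ, Fintype.card_fin, Nat.card_Icc,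
            Nat.add_sub_cancel, hnQ, hnR, nsmul_eq_mul]
          rw [ENNReal.ofReal_mul (by positivity), ENNReal.ofReal_mul (by positivity),
            ENNReal.ofReal_mul (by positivity), ENNReal.ofReal_mul (by positivity)]
          simp only [ENNReal.ofReal_natCast]
          ring

end Concentration

/-! ### Concentration of returns and of expert estimates -/

section Reward
variable {S A : Type*} [MeasurableSpace S] [MeasurableSpace A]
  {M : MDP S A} {R Qc : ℕ → Set (S × A → ℝ)} {am : (S × A → ℝ) → S → A}
  {πE π₀ : Policy S A} {N K : ℕ} {Ω : Type*} {mΩ : MeasurableSpace Ω} {μ : Measure Ω}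

theorem Setting.ret_mem_Icc (hS : Setting M R Qc am) {r : ℕ → S × A → ℝ}
    (hr : r ∈ prodClass M.H R) (τ : Traj S A M.H) : ret r 0 τ ∈ Set.Icc (0 : ℝ) M.H := by
  refine ⟨Finset.sum_nonneg fun i _ => (hS.rew_mem_Icc hr _ _).1, ?_⟩
  simpa using (le_abs_self _).trans (abs_ret_le (hS.abs_rew_le hr) 0 τ)

theorem Setting.integrable_ret (hS : Setting M R Qc am) {r : ℕ → S × A → ℝ}
    (hr : r ∈ prodClass M.H R) (P : Measure (Traj S A M.H)) [IsFiniteMeasure P] :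
    Integrable (ret r 0) P :=
  integrable_of_abs_le (measurable_ret (hS.measurable_rew hr) 0) (abs_ret_le (hS.abs_rew_le hr) 0)

theorem measurable_integral_prod {Ω T : Type*} {m : MeasurableSpace Ω}
    [MeasurableSpace T] {ν : Ω → Measure T} (hν : Measurable ν)
    (hp : ∀ ω, IsProbabilityMeasure (ν ω)) {g : Ω × T → ℝ} (hg : Measurable g) :
    Measurable fun ω => ∫ t, g (ω, t) ∂(ν ω) := by
  let κ : Kernel Ω T := ⟨ν, hν⟩
  have : IsMarkovKernel κ := ⟨hp⟩
  exact (hg.stronglyMeasurable.integral_kernel_prod_right' (κ := κ)).measurable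

theorem measurable_ret_of_joint {Ω' : Type*} {m : MeasurableSpace Ω'} {H : ℕ}
    {r : Ω' → ℕ → S × A → ℝ}
    (hr : ∀ h < H, Measurable fun p : Ω' × (S × A) => r p.1 h p.2) :
    Measurable fun p : Ω' × Traj S A H => ret (r p.1) 0 p.2 := by
  unfold ret
  refine Finset.measurable_sum _ fun i _ => ?_
  simp only [zero_add]
  exact (hr i i.2).comp (measurable_fst.prodMk ((measurable_sa i).comp measurable_snd))

theorem measurable_centered {Ω' T : Type*} {m : MeasurableSpace Ω'} [MeasurableSpace T]
    {ν : Ω' → Measure T} (hν : Measurable ν) (hp : ∀ ω, IsProbabilityMeasure (ν ω))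
    {g : Ω' × T → ℝ} (hg : Measurable g) (t c : ℝ) :
    Measurable fun p : Ω' × T => t * (g p - ∫ y, g (p.1, y) ∂(ν p.1)) - c :=
  ((hg.sub ((measurable_integral_prod hν hp hg).comp measurable_fst)).const_mul t).sub_const c

/-- Concentration of the returns of the true and the learned rewards along the run. -/
theorem Run.measure_return_le [IsProbabilityMeasure μ] (run : Run M R Qc am πE π₀ N K μ)
    (hS : Setting M R Qc am) (hπ₀ : ∀ h, IsMarkovKernel (π₀ h)) {t : ℝ} (ht : 0 < t) (L : ℝ) :
    μ {ω | ¬ ∑ k ∈ Finset.Icc 1 K,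
        ((ret M.rTrue 0 (run.traj k ω) - ret (run.rew k ω) 0 (run.traj k ω)) -
        (value M (run.policy k ω) M.rTrue - value M (run.policy k ω) (run.rew k ω))) ≤
        t * K * (M.H : ℝ) ^ 2 / 2 + L / t} ≤ ENNReal.ofReal (Real.exp (-L)) := by
  let g : ℕ → Ω × Traj S A M.H → ℝ := fun i p => ret M.rTrue 0 p.2 - ret (run.rew i p.1) 0 p.2
  -- The summand at time `0` is set to zero, because `τ^0` is rolled out but does not enter the
  -- regret. The return differences lie in `[-H, H]`, so `t² H² / 2` compensates Hoeffding's
  -- exponent.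
  let F : ℕ → Ω × Traj S A M.H → ℝ := fun i p => if i = 0 then 0 else
    t * (g i p - ∫ y, g i (p.1, y) ∂(trajLaw M (run.policy i p.1))) - t ^ 2 * (M.H : ℝ) ^ 2 / 2
  have hmem : ∀ i < K + 1, i ≠ 0 → i ∈ Finset.Icc 1 K := fun i hi h0 =>
    Finset.mem_Icc.2 ⟨Nat.one_le_iff_ne_zero.2 h0, by omega⟩
  have hgm : ∀ i < K + 1, i ≠ 0 → Measurable[(run.info i).prod inferInstance] (g i) :=
    fun i hi h0 => by
      have h1 := @measurable_ret_of_joint S A _ _ Ω (run.info i) M.H (run.rew i)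
        (run.rew_measurable i (hmem i hi h0))
      have h2 : @Measurable _ _ ((run.info i).prod inferInstance) _
          (fun p : Ω × Traj S A M.H => ret M.rTrue 0 p.2) :=
        @Measurable.comp _ _ _ ((run.info i).prod inferInstance) _ _ (ret M.rTrue 0) Prod.snd
          (measurable_ret (hS.measurable_rew hS.rTrue) 0) (@measurable_snd _ _ (run.info i) _)
      exact h2.sub h1
  refine le_trans (measure_mono fun ω hω => ?_) (run.measure_sum_ge_le hS hπ₀ (k := K + 1) le_rfl
    (F := F) (fun i hi => ?_) (fun i hi ω => ?_) L)
  · rw [Set.mem_ofPred_eq, not_le] at hω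
    have hsum : ∑ i ∈ Finset.range (K + 1), F i (ω, run.traj i ω) =
        ∑ k ∈ Finset.Icc 1 K, F k (ω, run.traj k ω) := by
      refine (Finset.sum_subset (fun i hi => ?_) fun i hi hni => ?_).symm
      · have := (Finset.mem_Icc.1 hi).2
        exact Finset.mem_range.2 (by omega)
      · have h0 : i = 0 := by
          by_contra h0
          exact hni (hmem i (Finset.mem_range.1 hi) h0)
        simp only [F, if_pos h0]
    have hF : ∀ k ∈ Finset.Icc 1 K, F k (ω, run.traj k ω) =
        t * ((ret M.rTrue 0 (run.traj k ω) - ret (run.rew k ω) 0 (run.traj k ω)) -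
          (value M (run.policy k ω) M.rTrue - value M (run.policy k ω) (run.rew k ω))) -
          t ^ 2 * (M.H : ℝ) ^ 2 / 2 := fun k hk => by
      obtain ⟨hk1, hk2⟩ := Finset.mem_Icc.1 hk
      have := run.isProbabilityMeasure_policy hS hπ₀ hk2 ω
      simp only [F, if_neg (by omega : k ≠ 0), g]
      rw [integral_sub (hS.integrable_ret hS.rTrue _) (hS.integrable_ret (run.rew_mem k hk ω) _)]
      rfl
    rw [Set.mem_ofPred_eq, hsum, Finset.sum_congr rfl hF, Finset.sum_sub_distrib, ← Finset.mul_sum,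
      Finset.sum_const, Nat.card_Icc, Nat.add_sub_cancel, nsmul_eq_mul]
    have h1 := mul_lt_mul_of_pos_left hω ht
    have h2 : t * (t * K * (M.H : ℝ) ^ 2 / 2 + L / t) = K * (t ^ 2 * (M.H : ℝ) ^ 2 / 2) + L := by
      field_simp
    linarith
  · by_cases h0 : i = 0
    · simp only [F, if_pos h0]
      exact @measurable_const _ _ _ ((run.info i).prod inferInstance) _
    · simp only [F, if_neg h0]
      exact measurable_centered (run.measurable_policy_law hS (by omega))
        (run.isProbabilityMeasure_policy hS hπ₀ (by omega)) (hgm i hi h0) _ _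
  · have := run.isProbabilityMeasure_policy hS hπ₀ (k := i) (by omega) ω
    by_cases h0 : i = 0
    · simp [F, if_pos h0]
    · simp only [F, if_neg h0, sub_eq_add_neg _ (t ^ 2 * (M.H : ℝ) ^ 2 / 2), Real.exp_add,
        ENNReal.ofReal_mul (Real.exp_pos _).le]
      have hrew := run.rew_mem i (hmem i hi h0) ω
      have hm : Measurable fun τ => g i (ω, τ) :=
        (measurable_ret (hS.measurable_rew hS.rTrue) 0).sub
          (measurable_ret (hS.measurable_rew hrew) 0)
      have hm2 : ∀ I : ℝ, Measurable fun τ =>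
          ENNReal.ofReal (Real.exp (t * (g i (ω, τ) - I))) := fun I =>
        ENNReal.measurable_ofReal.comp (Real.measurable_exp.comp ((hm.sub_const I).const_mul t))
      rw [lintegral_mul_const _ (hm2 _)]
      have hb : ∀ τ, g i (ω, τ) ∈ Set.Icc (-(M.H : ℝ)) M.H := fun τ => by
        have h1 := hS.ret_mem_Icc hS.rTrue τ
        have h2 := hS.ret_mem_Icc hrew τ
        exact ⟨by simp only [g]; linarith [h1.1, h2.2], by simp only [g]; linarith [h1.2, h2.1]⟩
      refine (mul_le_mul_left (lintegral_exp_centered_le hm hb t) _).trans ?_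
      rw [← ENNReal.ofReal_mul (Real.exp_pos _).le, ← Real.exp_add]
      rw [show t ^ 2 * ((M.H : ℝ) - -M.H) ^ 2 / 8 + -(t ^ 2 * (M.H : ℝ) ^ 2 / 2) = 0 by ring]
      simp

theorem value_eq_sum (hS : Setting M R Qc am) {r : ℕ → S × A → ℝ} (hr : r ∈ prodClass M.H R)
    {π : Policy S A} [IsFiniteMeasure (trajLaw M π)] :
    value M π r = ∑ h : Fin M.H, ∫ τ, r h (τ.sa h) ∂(trajLaw M π) := by
  unfold value ret
  simp only [zero_add]
  rw [integral_finsetSum]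
  exact fun h _ => integrable_of_abs_le ((hS.measurable_rew hr h).comp (measurable_sa h))
    fun τ => hS.abs_rew_le hr _ _

/-- Each summand has range of length two, hence sub-Gaussian parameter one. Independence adds these
to `N`, and averaging divides by `N²`. -/
theorem Run.lintegral_exp_expert_le [IsProbabilityMeasure μ] (run : Run M R Qc am πE π₀ N K μ)
    (hN : 0 < N) {g : Traj S A M.H → ℝ} (hg : Measurable g)
    (hb : ∀ τ, g τ ∈ Set.Icc (-1 : ℝ) 1) (t : ℝ) :
    ∫⁻ ω, ENNReal.ofReal (Real.exp (t * ((1 / (N : ℝ)) * ∑ j, (g (run.expert j ω) -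
      ∫ τ, g τ ∂(trajLaw M πE))))) ∂μ ≤ ENNReal.ofReal (Real.exp (t ^ 2 / (2 * N))) := by
  have hm : ∀ j, Measurable (run.expert j) := fun j =>
    (run.expert_measurable j).mono (run.info.le 0) le_rfl
  have hint : ∀ j, ∫ ω, g (run.expert j ω) ∂μ = ∫ τ, g τ ∂(trajLaw M πE) := fun j => by
    rw [← run.expert_law j, integral_map (hm j).aemeasurable hg.aestronglyMeasurable]
  have hsub : ∀ j, HasSubgaussianMGF (fun ω => g (run.expert j ω) - ∫ τ, g τ ∂(trajLaw M πE))
      ((‖(1 : ℝ) - -1‖₊ / 2) ^ 2) μ := fun j => by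
    have := hasSubgaussianMGF_of_mem_Icc (μ := μ) (X := fun ω => g (run.expert j ω))
      (hg.comp (hm j)).aemeasurable (Filter.Eventually.of_forall fun ω => hb _)
    rwa [hint j] at this
  have hind : iIndepFun (fun j ω => g (run.expert j ω) - ∫ τ, g τ ∂(trajLaw M πE)) μ :=
    run.expert_indep.comp (fun _ τ => g τ - ∫ τ, g τ ∂(trajLaw M πE)) fun _ => hg.sub_const _
  have hsum := HasSubgaussianMGF.sum_of_iIndepFun hind (s := Finset.univ) fun j _ => hsub j
  have hN' : (0 : ℝ) < N := by exact_mod_cast hN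
  simp only [← mul_assoc]
  rw [← ofReal_integral_eq_lintegral_ofReal (hsum.integrable_exp_mul _)
    (Filter.Eventually.of_forall fun x => (Real.exp_pos _).le)]
  refine ENNReal.ofReal_le_ofReal ((hsum.mgf_le _).trans_eq ?_)
  congr 1
  push_cast
  norm_num
  field_simp

/-- Uniform concentration of the expert estimates over the reward class. -/
theorem Run.measure_expert_le [IsProbabilityMeasure μ] (run : Run M R Qc am πE π₀ N K μ)
    (hS : Setting M R Qc am) (hπE : ∀ h, IsMarkovKernel (πE h)) (hN : 0 < N) {ρ : ℝ}
    (hR : ∀ h < M.H, coveringNumber ρ (R h) ≠ ⊤) {e : ℝ} (he : 0 < e) :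
    μ {ω | ¬ ∀ r ∈ prodClass M.H R, (run.expertEst ω r - run.expertEst ω M.rTrue) -
        (value M πE r - value M πE M.rTrue) ≤ M.H * e + 2 * M.H * ρ} ≤
      ENNReal.ofReal (maxCovR M R ρ * Real.exp (-(N * e ^ 2 / 2))) := by
  classical
  have hH : (0 : ℝ) < M.H := by exact_mod_cast hS.one_le
  have hN' : (0 : ℝ) < N := by exact_mod_cast hN
  have hprob := isProbabilityMeasure_trajLaw (M := M) (π := πE) fun h _ => hπE h
  choose T hsub hcov hcard using fun h : Fin M.H => exists_cover (hR h h.2)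
  let G : (h : Fin M.H) → (S × A → ℝ) → Traj S A M.H → ℝ :=
    fun h r' τ => r' (τ.sa h) - M.rTrue h (τ.sa h)
  let W : Fin M.H → (S × A → ℝ) → Ω → ℝ := fun h r' ω =>
    (1 / (N : ℝ)) * ∑ j, (G h r' (run.expert j ω) - ∫ τ, G h r' τ ∂(trajLaw M πE))
  have hTm : ∀ h, ∀ r' ∈ T h, Measurable r' ∧ ∀ x, r' x ∈ Set.Icc (0 : ℝ) 1 := fun h r' hr' =>
    hS.rew h h.2 r' (hsub h hr')
  have hGm : ∀ h, ∀ r' ∈ T h, Measurable (G h r') := fun h r' hr' =>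
    ((hTm h r' hr').1.comp (measurable_sa h)).sub
      ((hS.measurable_rew hS.rTrue h).comp (measurable_sa h))
  have hGb : ∀ h, ∀ r' ∈ T h, ∀ τ, G h r' τ ∈ Set.Icc (-1 : ℝ) 1 := fun h r' hr' τ => by
    have h1 := (hTm h r' hr').2 (τ.sa h)
    have h2 := hS.rew_mem_Icc hS.rTrue h (τ.sa h)
    exact ⟨by simp only [G]; linarith [h1.1, h2.2], by simp only [G]; linarith [h1.2, h2.1]⟩
  -- The optimal parameter in `t e - t² / (2N)`, giving the exponent `N e² / 2`.
  set t : ℝ := N * e with ht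
  have hm : ∀ j, Measurable (run.expert j) := fun j =>
    (run.expert_measurable j).mono (run.info.le 0) le_rfl
  have hWm : ∀ h, ∀ r' ∈ T h, Measurable (W h r') := fun h r' hr' =>
    (Finset.measurable_sum _ fun j _ => ((hGm h r' hr').comp (hm j)).sub_const _).const_mul _
  -- A single exponential moment for all steps and centres. Its expectation carries a factor `H`,
  -- which the threshold used in Markov's inequality also carries; so no `log H` is lost, as it
  -- would be in a union bound over steps.
  let Z : Ω → ℝ≥0∞ := fun ω => ∑ h, ∑ r' ∈ T h, ENNReal.ofReal (Real.exp (t * W h r' ω))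
  have hZ : ∫⁻ ω, Z ω ∂μ ≤ ENNReal.ofReal (M.H * (maxCovR M R ρ * Real.exp (t ^ 2 / (2 * N)))) := by
    have hme : ∀ h, ∀ r' ∈ T h, Measurable fun ω => ENNReal.ofReal (Real.exp (t * W h r' ω)) :=
      fun h r' hr' => by have := hWm h r' hr'; fun_prop
    rw [lintegral_finsetSum _ fun h _ => Finset.measurable_sum _ fun r' hr' => hme h r' hr']
    calc ∑ h, ∫⁻ ω, ∑ r' ∈ T h, ENNReal.ofReal (Real.exp (t * W h r' ω)) ∂μ
        ≤ ∑ h : Fin M.H, ENNReal.ofReal (maxCovR M R ρ * Real.exp (t ^ 2 / (2 * N))) := by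
          refine Finset.sum_le_sum fun h _ => ?_
          rw [lintegral_finsetSum _ fun r' hr' => hme h r' hr']
          refine (Finset.sum_le_sum fun r' hr' =>
            run.lintegral_exp_expert_le hN (hGm h r' hr') (hGb h r' hr') t).trans ?_
          rw [Finset.sum_const, hcard, nsmul_eq_mul, ENNReal.ofReal_mul (by positivity),
            ENNReal.ofReal_natCast]
          gcongr
          exact Finset.le_sup (f := fun h => covN ρ (R h)) (Finset.mem_range.2 h.2)
      _ = _ := by
          rw [Finset.sum_const, Finset.card_univ, Fintype.card_fin, nsmul_eq_mul,
            ENNReal.ofReal_mul (p := (M.H : ℝ)) (by positivity), ENNReal.ofReal_natCast]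
  have hZm : Measurable Z := Finset.measurable_sum _ fun h _ => Finset.measurable_sum _
    fun r' hr' => by have := hWm h r' hr'; fun_prop
  have hpos : 0 < M.H * Real.exp (t * e) := by positivity
  refine le_trans (measure_mono (t := {ω | ENNReal.ofReal (M.H * Real.exp (t * e)) ≤ Z ω})
    fun ω hω => ?_) ((meas_ge_le_lintegral_div hZm.aemeasurable (ENNReal.ofReal_pos.2 hpos).ne'
      ENNReal.ofReal_ne_top).trans ((ENNReal.div_le_div_right hZ _).trans ?_))
  · simp only [Set.mem_ofPred_eq, not_forall, not_le] at hω
    obtain ⟨r, hr, hlt⟩ := hω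
    choose c hc hd using fun h : Fin M.H => hcov h (r h) (hr.1 h h.2)
    -- The functions at the different steps are replaced by centres step by step, at a cost of `2ρ`
    -- each: `ρ` in the empirical mean and `ρ` in the expectation.
    have hlow : M.H * e ≤ ∑ h, W h (c h) ω := by
      have h1 : ∀ h : Fin M.H, (1 / (N : ℝ)) * ∑ j, (r h ((run.expert j ω).sa h) -
          M.rTrue h ((run.expert j ω).sa h)) - (∫ τ, r h (τ.sa h) ∂(trajLaw M πE) -
            ∫ τ, M.rTrue h (τ.sa h) ∂(trajLaw M πE)) ≤ W h (c h) ω + 2 * ρ := fun h => by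
        have hir : Integrable (fun τ : Traj S A M.H => r h (τ.sa h)) (trajLaw M πE) :=
          integrable_of_abs_le ((hS.measurable_rew hr h).comp (measurable_sa h))
            fun τ => hS.abs_rew_le hr _ _
        have his : Integrable (fun τ : Traj S A M.H => M.rTrue h (τ.sa h)) (trajLaw M πE) :=
          integrable_of_abs_le ((hS.measurable_rew hS.rTrue h).comp (measurable_sa h))
            fun τ => hS.abs_rew_le hS.rTrue _ _
        have hic : Integrable (fun τ : Traj S A M.H => c h (τ.sa h)) (trajLaw M πE) :=
          integrable_of_abs_le (b := 1) ((hTm h _ (hc h)).1.comp (measurable_sa h)) fun τ =>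
            abs_le.2 ⟨by linarith [((hTm h _ (hc h)).2 (τ.sa h)).1],
              ((hTm h _ (hc h)).2 (τ.sa h)).2⟩
        have hW : W h (c h) ω = (1 / (N : ℝ)) * ∑ j, G h (c h) (run.expert j ω) -
            (∫ τ, c h (τ.sa h) ∂(trajLaw M πE) - ∫ τ, M.rTrue h (τ.sa h) ∂(trajLaw M πE)) := by
          simp only [W, Finset.sum_sub_distrib, Finset.sum_const, Finset.card_univ,
            Fintype.card_fin, nsmul_eq_mul]
          rw [show ∫ τ, G h (c h) τ ∂(trajLaw M πE) = _ from integral_sub hic his]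
          field_simp
        have h3 : ∑ j, (r h ((run.expert j ω).sa h) - M.rTrue h ((run.expert j ω).sa h)) ≤
            ∑ j, (G h (c h) (run.expert j ω) + ρ) := Finset.sum_le_sum fun j _ => by
          have := (abs_le.1 (hd h ((run.expert j ω).sa h))).2
          simp only [G]; linarith
        rw [Finset.sum_add_distrib, Finset.sum_const, Finset.card_univ, Fintype.card_fin,
          nsmul_eq_mul] at h3
        have h4 := mul_le_mul_of_nonneg_left h3 (by positivity : 0 ≤ 1 / (N : ℝ))
        have h5 : (1 / (N : ℝ)) * (N * ρ) = ρ := by field_simp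
        rw [mul_add, h5] at h4
        have h6 : ∫ τ, c h (τ.sa h) ∂(trajLaw M πE) ≤ ∫ τ, (r h (τ.sa h) + ρ) ∂(trajLaw M πE) :=
          integral_mono hic (hir.add (integrable_const _)) fun τ => by
            have := (abs_le.1 (hd h (τ.sa h))).1
            linarith
        rw [integral_add hir (integrable_const _), integral_const, probReal_univ, one_smul] at h6
        rw [hW]
        linarith
      have h2 := Finset.sum_le_sum fun h (_ : h ∈ Finset.univ) => h1 h
      rw [Finset.sum_sub_distrib, Finset.sum_sub_distrib, ← value_eq_sum hS hr,
        ← value_eq_sum hS hS.rTrue, ← Finset.mul_sum, Finset.sum_comm, Finset.sum_add_distrib,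
        Finset.sum_const, Finset.card_univ, Fintype.card_fin, nsmul_eq_mul] at h2
      simp only [Finset.sum_sub_distrib, mul_sub] at h2
      simp only [Run.expertEst, ret, zero_add] at hlt
      linarith
    -- Jensen's inequality over the `H` steps: if the deviations average at least `e`, then so do
    -- their exponentials at the corresponding level.
    have hj : Real.exp (t * e) ≤ ∑ h : Fin M.H, (1 / (M.H : ℝ)) * Real.exp (t * W h (c h) ω) := by
      have := convexOn_exp.map_sum_le (t := (Finset.univ : Finset (Fin M.H)))
        (w := fun _ => 1 / (M.H : ℝ)) (p := fun h => t * W h (c h) ω) (fun _ _ => by positivity)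
        (by simp [hH.ne']) (fun _ _ => Set.mem_univ _)
      simp only [smul_eq_mul] at this
      refine le_trans (Real.exp_le_exp.2 ?_) this
      rw [← Finset.mul_sum, ← Finset.mul_sum, div_mul_eq_mul_div, one_mul, le_div_iff₀ hH]
      have : 0 ≤ t := by positivity
      calc t * e * M.H = t * (M.H * e) := by ring
        _ ≤ _ := by gcongr
    rw [← Finset.mul_sum, div_mul_eq_mul_div, one_mul, le_div_iff₀ hH, mul_comm] at hj
    refine (ENNReal.ofReal_le_ofReal hj).trans ?_
    rw [ENNReal.ofReal_sum_of_nonneg fun h _ => (Real.exp_pos _).le]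
    exact Finset.sum_le_sum fun h _ => Finset.single_le_sum
      (f := fun r' => ENNReal.ofReal (Real.exp (t * W h r' ω))) (fun _ _ => zero_le) (hc h)
  · rw [← ENNReal.ofReal_div_of_pos hpos]
    refine ENNReal.ofReal_le_ofReal (le_of_eq ?_)
    rw [mul_div_mul_left _ _ hH.ne', mul_div_assoc, ← Real.exp_sub]
    congr 2
    rw [ht]
    field_simp
    ring

end Reward

/-! ### The generalized eluder inequality -/

section GEC
variable {S A : Type*} [MeasurableSpace S] [MeasurableSpace A]
  {M : MDP S A} {R Qc : ℕ → Set (S × A → ℝ)} {am : (S × A → ℝ) → S → A}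

theorem bellmanSq_nonneg (M : MDP S A) (r f : ℕ → S × A → ℝ) (τ : Traj S A M.H) :
    0 ≤ bellmanSq M r f τ :=
  Finset.sum_nonneg fun _ _ => sq_nonneg _

theorem Setting.value_nonneg (hS : Setting M R Qc am) {r : ℕ → S × A → ℝ}
    (hr : r ∈ prodClass M.H R) (π : Policy S A) : 0 ≤ value M π r :=
  integral_nonneg fun τ => (hS.ret_mem_Icc hr τ).1

/-- The choice `d = K H` always works, since `√(d H K) = K H` already bounds the left-hand side.
Hence the infimum defining `gec` is over a nonempty set. -/
theorem gecBound_nonempty (hS : Setting M R Qc am) (K : ℕ) {ε : ℝ} (hε : 0 ≤ ε) :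
    {d : ℝ | 0 ≤ d ∧ GECBound M R Qc am K ε d}.Nonempty := by
  refine ⟨K * M.H, by positivity, fun r f hr hf => ?_⟩
  have h1 : ∑ k ∈ Finset.Icc 1 K, (maxA (f k 0) M.s₁ - value M (greedy am (f k)) (r k)) ≤
      ∑ k ∈ Finset.Icc 1 K, (M.H : ℝ) := Finset.sum_le_sum fun k _ => by
    have := (hS.maxA_mem_Icc (hf k) 0 M.s₁).2
    have := hS.value_nonneg (hr k) (greedy am (f k))
    linarith
  rw [Finset.sum_const, Nat.card_Icc, Nat.add_sub_cancel, nsmul_eq_mul] at h1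
  have h2 : √((K : ℝ) * M.H * M.H * K) = K * M.H := by
    rw [show (K : ℝ) * M.H * M.H * K = (K * M.H) ^ 2 by ring]
    exact Real.sqrt_sq (by positivity)
  rw [h2]
  have h3 : 0 ≤ ⨅ m : Set.Ioi (0 : ℝ),
        ((m : ℝ) / 2 * ∑ k ∈ Finset.Icc 1 K, ∑ i ∈ Finset.Ico 1 k,
            ∫ τ, bellmanSq M (r k) (f k) τ ∂(trajLaw M (greedy am (f i)))
          + (K * M.H : ℝ) / (2 * m)) := Real.iInf_nonneg fun m => by
    have hm : (0 : ℝ) < m := m.2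
    have : 0 ≤ ∑ k ∈ Finset.Icc 1 K, ∑ i ∈ Finset.Ico 1 k,
            ∫ τ, bellmanSq M (r k) (f k) τ ∂(trajLaw M (greedy am (f i))) :=
      Finset.sum_nonneg fun _ _ => Finset.sum_nonneg fun _ _ =>
        integral_nonneg fun τ => bellmanSq_nonneg M _ _ τ
    positivity
  have h4 : 0 ≤ ε * M.H * K := by positivity
  linarith

/-- The defining inequality of the generalized eluder coefficient holds at every `d` above it. -/
theorem sum_le_of_gec_le (hS : Setting M R Qc am) {K : ℕ} {ε d : ℝ} (hε : 0 ≤ ε)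
    (hd : gec M R Qc am K ε ≤ d) {r f : ℕ → ℕ → S × A → ℝ}
    (hr : ∀ k ∈ Finset.Icc 1 K, r k ∈ prodClass M.H R)
    (hf : ∀ k ∈ Finset.Icc 1 K, f k ∈ prodClass M.H Qc) {m : ℝ} (hm : 0 < m) :
    ∑ k ∈ Finset.Icc 1 K, (maxA (f k 0) M.s₁ - value M (greedy am (f k)) (r k)) ≤
      m / 2 * ∑ k ∈ Finset.Icc 1 K, ∑ i ∈ Finset.Ico 1 k,
            ∫ τ, bellmanSq M (r k) (f k) τ ∂(trajLaw M (greedy am (f i)))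
          + d / (2 * m) + √(d * M.H * K) + ε * M.H * K := by
  rcases Nat.eq_zero_or_pos K with rfl | hK
  · have hd0 : 0 ≤ d := le_trans (Real.sInf_nonneg fun x hx => hx.1) hd
    simp
    positivity
  classical
  have h1K : 1 ∈ Finset.Icc 1 K := Finset.mem_Icc.2 ⟨le_rfl, hK⟩
  -- `GECBound` asks for class membership at every index, whereas a run provides it only for `1, …,
  -- K`; the other indices repeat the first entry.
  let r' : ℕ → ℕ → S × A → ℝ := fun k => if k ∈ Finset.Icc 1 K then r k else r 1
  let f' : ℕ → ℕ → S × A → ℝ := fun k => if k ∈ Finset.Icc 1 K then f k else f 1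
  have hr' : ∀ k, r' k ∈ prodClass M.H R := fun k => by
    by_cases hk : k ∈ Finset.Icc 1 K
    · simp only [r', if_pos hk]; exact hr k hk
    · simp only [r', if_neg hk]; exact hr 1 h1K
  have hf' : ∀ k, f' k ∈ prodClass M.H Qc := fun k => by
    by_cases hk : k ∈ Finset.Icc 1 K
    · simp only [f', if_pos hk]; exact hf k hk
    · simp only [f', if_neg hk]; exact hf 1 h1K
  have hrk : ∀ k ∈ Finset.Icc 1 K, r' k = r k := fun k hk => if_pos hk
  have hfk : ∀ k ∈ Finset.Icc 1 K, f' k = f k := fun k hk => if_pos hk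
  set X := ∑ k ∈ Finset.Icc 1 K, ∑ i ∈ Finset.Ico 1 k,
    ∫ τ, bellmanSq M (r k) (f k) τ ∂(trajLaw M (greedy am (f i))) with hX
  have hX' : ∑ k ∈ Finset.Icc 1 K, ∑ i ∈ Finset.Ico 1 k,
      ∫ τ, bellmanSq M (r' k) (f' k) τ ∂(trajLaw M (greedy am (f' i))) = X := by
    refine Finset.sum_congr rfl fun k hk => Finset.sum_congr rfl fun i hi => ?_
    have hi' : i ∈ Finset.Icc 1 K := by
      have := Finset.mem_Icc.1 hk
      have := Finset.mem_Ico.1 hi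
      exact Finset.mem_Icc.2 ⟨by omega, by omega⟩
    rw [hrk k hk, hfk k hk, hfk i hi']
  have hX0 : 0 ≤ X := Finset.sum_nonneg fun _ _ => Finset.sum_nonneg fun _ _ =>
    integral_nonneg fun τ => bellmanSq_nonneg M _ _ τ
  -- It is not known beforehand that the infimum is attained. Some admissible `d'` lies below `d +
  -- η`, the right-hand side is monotone in `d`, and `η` then tends to zero.
  have key : ∀ η > 0, ∑ k ∈ Finset.Icc 1 K, (maxA (f k 0) M.s₁ - value M (greedy am (f k)) (r k)) ≤
      m / 2 * X + (d + η) / (2 * m) + √((d + η) * M.H * K) + ε * M.H * K := fun η hη => by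
    obtain ⟨d', ⟨hd0, hb⟩, hlt⟩ := exists_lt_of_csInf_lt (gecBound_nonempty hS K hε)
      (lt_of_le_of_lt hd (lt_add_of_pos_right d hη))
    have hb' := hb r' f' hr' hf'
    rw [hX', Finset.sum_congr rfl fun k hk => by rw [hrk k hk, hfk k hk]] at hb'
    refine hb'.trans ?_
    have h1 : (⨅ m : Set.Ioi (0 : ℝ), ((m : ℝ) / 2 * X + d' / (2 * m))) ≤
        m / 2 * X + d' / (2 * m) := by
      refine ciInf_le (f := fun m : Set.Ioi (0 : ℝ) => ((m : ℝ) / 2 * X + d' / (2 * m)))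
        ⟨0, ?_⟩ ⟨m, hm⟩
      rintro _ ⟨m', rfl⟩
      have : (0 : ℝ) < m' := m'.2
      positivity
    have h2 : d' / (2 * m) ≤ (d + η) / (2 * m) := by gcongr
    have h3 : √(d' * M.H * K) ≤ √((d + η) * M.H * K) := by gcongr
    linarith
  have hcont : Filter.Tendsto (fun η : ℝ => m / 2 * X + (d + η) / (2 * m) +
      √((d + η) * M.H * K) + ε * M.H * K) (nhdsWithin 0 (Set.Ioi 0))
      (nhds (m / 2 * X + (d + 0) / (2 * m) + √((d + 0) * M.H * K) + ε * M.H * K)) := by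
    refine Filter.Tendsto.mono_left (Continuous.tendsto ?_ 0) nhdsWithin_le_nhds
    fun_prop
  rw [add_zero] at hcont
  exact ge_of_tendsto hcont (Filter.eventually_of_mem self_mem_nhdsWithin key)

end GEC

/-! ### Optimism, regret and the deterministic error decomposition -/

section Combination
variable {S A : Type*} [MeasurableSpace S] [MeasurableSpace A]
  {M : MDP S A} {R Qc : ℕ → Set (S × A → ℝ)} {am : (S × A → ℝ) → S → A}
  {πE π₀ : Policy S A} {N K : ℕ} {Ω : Type*} {mΩ : MeasurableSpace Ω} {μ : Measure Ω}

theorem bddBelow_fitError (run : Run M R Qc am πE π₀ N K μ) (ω : Ω) (k : ℕ) (h : Fin M.H)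
    (g' : S × A → ℝ) : BddBelow (Set.range fun g : Qc h => run.fitError ω k h g g') :=
  ⟨0, by rintro _ ⟨g, rfl⟩; exact Finset.sum_nonneg fun _ _ => sq_nonneg _⟩

theorem Run.bellmanEst_nonneg (run : Run M R Qc am πE π₀ N K μ) (ω : Ω) (k : ℕ)
    {Q : ℕ → S × A → ℝ} (hQ : Q ∈ prodClass M.H Qc) : 0 ≤ run.bellmanEst ω k Q :=
  Finset.sum_nonneg fun h _ => sub_nonneg.2
    (ciInf_le (bddBelow_fitError run ω k h (Q (h + 1))) ⟨Q h, hQ.1 h h.2⟩)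

/-- By Bellman completeness the backup of `Q` competes in the inner infimum, so subtracting its loss
subtracts at least the infimum. -/
theorem Run.sum_excess_le_bellmanEst (run : Run M R Qc am πE π₀ N K μ) (hS : Setting M R Qc am)
    (ω : Ω) {k : ℕ} (hk : k ∈ Finset.Icc 1 K) {Q : ℕ → S × A → ℝ} (hQ : Q ∈ prodClass M.H Qc) :
    ∑ h : Fin M.H, ∑ i ∈ Finset.range k, excess M (run.rew k ω) Q h (run.traj i ω) ≤
      run.bellmanEst ω k Q := by
  refine Finset.sum_le_sum fun h _ => ?_
  have := ciInf_le (bddBelow_fitError run ω k h (Q (h + 1)))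
    ⟨bellman M (run.rew k ω) h (Q (h + 1)), hS.compl _ (run.rew_mem k hk ω) Q hQ h h.2⟩
  simp only [excess, Finset.sum_sub_distrib]
  exact sub_le_sub_left this _

/-- On the good event the estimated Bellman error of the optimal Q-function is small. -/
theorem Run.bellmanEst_optQ_le (run : Run M R Qc am πE π₀ N K μ) (hS : Setting M R Qc am)
    (hπ₀ : ∀ h, IsMarkovKernel (π₀ h)) (ω : Ω) {k : ℕ} (hk : k ∈ Finset.Icc 1 K) {B : ℝ}
    (hB : ∀ h : Fin M.H, ∀ r ∈ prodClass M.H R, ∀ f ∈ prodClass M.H Qc,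
        ∑ i ∈ Finset.range k, ∫ τ, bellErr M r f h (τ.sa h) ^ 2 ∂(trajLaw M (run.policy i ω)) ≤
        4 * ∑ i ∈ Finset.range k, excess M r f h (run.traj i ω) + B) :
    run.bellmanEst ω k (optQ M (run.rew k ω)) ≤ M.H * (B / 4) := by
  classical
  have hr := run.rew_mem k hk ω
  set r := run.rew k ω with hrdef
  have hQ := optQ_mem hS hr
  set Q := optQ M r with hQdef
  have key : ∀ h : Fin M.H, run.fitError ω k h (Q h) (Q (h + 1)) -
      ⨅ g : Qc h, run.fitError ω k h g (Q (h + 1)) ≤ B / 4 := fun h => by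
    have : Nonempty (Qc h) := ⟨⟨Q h, hQ.1 h h.2⟩⟩
    rw [sub_le_comm]
    refine le_ciInf fun g => ?_
    -- The competitor `g` replaces `Q^⋆` at the single step `h`. The backup uses only step `h + 1`,
    -- so it is unchanged and equals `Q^⋆` at step `h` by the optimality equation. The excess of the
    -- modified function is thus the loss of `g` minus that of `Q^⋆`, and nonnegativity of squared
    -- Bellman errors bounds it below by `-B / 4`.
    have hf : Function.update Q h g ∈ prodClass M.H Qc := by
      refine ⟨fun j hj => ?_, fun j hj => ?_⟩
      · by_cases hjh : j = h
        · subst hjh; simp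
        · rw [Function.update_of_ne hjh]; exact hQ.1 j hj
      · rw [Function.update_of_ne (by have := h.2; omega)]; exact hQ.2 j hj
    have h1 := hB h r hr _ hf
    have h2 : 0 ≤ ∑ i ∈ Finset.range k, ∫ τ, bellErr M r (Function.update Q h g) h (τ.sa h) ^ 2
        ∂(trajLaw M (run.policy i ω)) :=
      Finset.sum_nonneg fun i _ => integral_nonneg fun τ => sq_nonneg _
    have h3 : ∑ i ∈ Finset.range k, excess M r (Function.update Q h g) h (run.traj i ω) =
        run.fitError ω k h g (Q (h + 1)) - run.fitError ω k h (Q h) (Q (h + 1)) := by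
      simp only [excess, Function.update_self, Finset.sum_sub_distrib,
        Function.update_of_ne (show (h : ℕ) + 1 ≠ h by omega)]
      rw [hQdef, ← optQ_eq_bellman hS hr hπ₀ h.2]
      rfl
    linarith
  refine (Finset.sum_le_sum fun h _ => key h).trans ?_
  simp

/-- The objective is bounded below by `-λ H`, so its infimum is genuine and any member of the class
may serve as comparator. -/
theorem Run.qLoss_sub_le (run : Run M R Qc am πE π₀ N K μ) (hS : Setting M R Qc am) {lam : ℝ}
    (hlam : 0 ≤ lam) (ω : Ω) {k : ℕ} (hk : k ∈ Finset.Icc 1 K) {Q : ℕ → S × A → ℝ}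
    (hQ : Q ∈ prodClass M.H Qc) :
    run.qLoss lam ω k (run.qfun k ω) - run.qLoss lam ω k Q ≤ run.qOptError lam ω := by
  have h1 : (⨅ Q : prodClass M.H Qc, run.qLoss lam ω k Q) ≤ run.qLoss lam ω k Q := by
    refine ciInf_le (f := fun Q : prodClass M.H Qc => run.qLoss lam ω k Q)
      ⟨-(lam * M.H), ?_⟩ ⟨Q, hQ⟩
    rintro _ ⟨Q', rfl⟩
    have := run.bellmanEst_nonneg ω k Q'.2
    have := mul_le_mul_of_nonneg_left (hS.maxA_mem_Icc Q'.2 0 M.s₁).2 hlam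
    simp only [qLoss]
    linarith
  have h2 := le_ciSup (f := fun k : Finset.Icc 1 K =>
    (run.qLoss lam ω k (run.qfun k ω) - ⨅ Q : prodClass M.H Qc, run.qLoss lam ω k Q))
    (Set.finite_range _).bddAbove ⟨k, hk⟩
  unfold qOptError
  simp only at h2
  linarith

theorem Run.qOptError_nonneg (run : Run M R Qc am πE π₀ N K μ) (hS : Setting M R Qc am) {lam : ℝ}
    (hlam : 0 ≤ lam) (ω : Ω) (hK : 1 ≤ K) : 0 ≤ run.qOptError lam ω := by
  have hk : 1 ∈ Finset.Icc 1 K := Finset.mem_Icc.2 ⟨le_rfl, hK⟩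
  have := run.qLoss_sub_le hS hlam ω hk (run.qfun_mem 1 hk ω)
  rwa [sub_self] at this

theorem Run.expertEst_mem_Icc (run : Run M R Qc am πE π₀ N K μ) (hS : Setting M R Qc am) (ω : Ω)
    {r : ℕ → S × A → ℝ} (hr : r ∈ prodClass M.H R) :
    run.expertEst ω r ∈ Set.Icc (0 : ℝ) M.H := by
  unfold expertEst
  refine ⟨mul_nonneg (by positivity) (Finset.sum_nonneg fun j _ => (hS.ret_mem_Icc hr _).1), ?_⟩
  have h1 := Finset.sum_le_sum fun j (_ : j ∈ Finset.univ) => (hS.ret_mem_Icc hr (run.expert j ω)).2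
  rw [Finset.sum_const, Finset.card_univ, Fintype.card_fin, nsmul_eq_mul] at h1
  rcases Nat.eq_zero_or_pos N with rfl | hN
  · simp
  · have hN' : (0 : ℝ) < N := by exact_mod_cast hN
    rw [one_div, inv_mul_le_iff₀ hN']
    exact h1

/-- Bounded losses make the supremum over comparators genuine; it is used with the true reward as
comparator. -/
theorem Run.sum_rewLoss_sub_le (run : Run M R Qc am πE π₀ N K μ) (hS : Setting M R Qc am)
    (ω : Ω) {r : ℕ → S × A → ℝ} (hr : r ∈ prodClass M.H R) :
    (1 / (K : ℝ)) * ∑ k ∈ Finset.Icc 1 K, (run.rewLoss ω k (run.rew k ω) - run.rewLoss ω k r) ≤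
      run.rewardOptError ω := by
  refine mul_le_mul_of_nonneg_left ?_ (by positivity)
  have hb : ∀ k, ∀ r ∈ prodClass M.H R, run.rewLoss ω k r ∈ Set.Icc (-(M.H : ℝ)) M.H :=
    fun k r hr => by
      have h1 := hS.ret_mem_Icc hr (run.traj k ω)
      have h2 := run.expertEst_mem_Icc hS ω hr
      exact ⟨by unfold rewLoss; linarith [h1.1, h2.2], by unfold rewLoss; linarith [h1.2, h2.1]⟩
  refine le_ciSup (f := fun r : prodClass M.H R =>
    ∑ k ∈ Finset.Icc 1 K, (run.rewLoss ω k (run.rew k ω) - run.rewLoss ω k r))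
    ⟨∑ _k ∈ Finset.Icc 1 K, (2 * M.H : ℝ), ?_⟩ ⟨r, hr⟩
  rintro _ ⟨r', rfl⟩
  refine Finset.sum_le_sum fun k hk => ?_
  linarith [(hb k _ (run.rew_mem k hk ω)).2, (hb k _ r'.2).1]

theorem Run.outputValue_eq (run : Run M R Qc am πE π₀ N K μ) (hS : Setting M R Qc am) (ω : Ω) :
    run.outputValue ω =
      (1 / (K : ℝ)) * ∑ k ∈ Finset.Icc 1 K, value M (greedy am (run.qfun k ω)) M.rTrue := by
  unfold outputValue value
  rw [integral_smul_measure, integral_finsetSum_measure]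
  · simp
  · intro k hk
    have := isProbabilityMeasure_trajLaw (M := M) (π := greedy am (run.qfun k ω))
      fun h hh => isMarkovKernel_greedy hS (run.qfun_mem k hk ω) hh
    exact hS.integrable_ret hS.rTrue _

theorem integral_bellmanSq (hS : Setting M R Qc am) {r f : ℕ → S × A → ℝ}
    (hr : r ∈ prodClass M.H R) (hf : f ∈ prodClass M.H Qc) (P : Measure (Traj S A M.H))
    [IsFiniteMeasure P] :
    ∫ τ, bellmanSq M r f τ ∂P = ∑ h : Fin M.H, ∫ τ, bellErr M r f h (τ.sa h) ^ 2 ∂P := by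
  unfold bellmanSq
  rw [integral_finsetSum]
  · rfl
  · exact fun h _ => integrable_of_abs_le (b := (M.H : ℝ) ^ 2)
      (((hS.measurable_bellErr hr hf h.2).comp (measurable_sa h)).pow_const 2)
      fun τ => by
        have := hS.bellErr_sq_le hr hf h.2 (τ.sa h)
        rw [abs_of_nonneg (sq_nonneg _)]
        exact this

/-- The regret of the policies under the learned rewards on the good event. -/
theorem Run.sum_value_sub_le (run : Run M R Qc am πE π₀ N K μ) (hS : Setting M R Qc am)
    (hπE : ∀ h, IsMarkovKernel (πE h)) (hπ₀ : ∀ h, IsMarkovKernel (π₀ h)) {ε d : ℝ} (hε : 0 ≤ ε)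
    (hd : gec M R Qc am K ε ≤ d) {lam : ℝ} (hlam : 0 < lam) (ω : Ω) {B : ℝ}
    (hB : ∀ k ∈ Finset.Icc 1 K, ∀ h : Fin M.H, ∀ r ∈ prodClass M.H R, ∀ f ∈ prodClass M.H Qc,
        ∑ i ∈ Finset.range k, ∫ τ, bellErr M r f h (τ.sa h) ^ 2 ∂(trajLaw M (run.policy i ω)) ≤
        4 * ∑ i ∈ Finset.range k, excess M r f h (run.traj i ω) + B) :
    ∑ k ∈ Finset.Icc 1 K, (value M πE (run.rew k ω) - value M (run.policy k ω) (run.rew k ω)) ≤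
      K * (M.H * B / (2 * lam)) + K * (run.qOptError lam ω / lam) + d * lam + √(d * M.H * K) +
        ε * M.H * K := by
  -- The parameter `1 / (2λ)` turns the factor four in front of the estimated Bellman error of `Q^k`
  -- into `1 / λ`, which is exactly what the optimism step subtracts.
  have hgec := sum_le_of_gec_le hS hε hd (r := fun k => run.rew k ω) (f := fun k => run.qfun k ω)
    (fun k hk => run.rew_mem k hk ω) (fun k hk => run.qfun_mem k hk ω)
    (m := 1 / (2 * lam)) (by positivity)
  have hpol : ∀ k ∈ Finset.Icc 1 K, run.policy k ω = greedy am (run.qfun k ω) := fun k hk => by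
    have := (Finset.mem_Icc.1 hk).1
    rw [policy, if_neg (by omega)]
  -- Optimism: compare `Q^k` with `Q^⋆` of the learned reward in the objective, and divide by `λ`.
  have hopt : ∀ k ∈ Finset.Icc 1 K, value M πE (run.rew k ω) - maxA (run.qfun k ω 0) M.s₁ ≤
      M.H * (B / 4) / lam - run.bellmanEst ω k (run.qfun k ω) / lam + run.qOptError lam ω / lam :=
    fun k hk => by
      have hr := run.rew_mem k hk ω
      have h1 := run.qLoss_sub_le hS hlam.le ω hk (optQ_mem hS hr)
      have h2 := run.bellmanEst_optQ_le hS hπ₀ ω hk (hB k hk)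
      have h3 := value_le_maxA_optQ hS hr hπE
      unfold qLoss at h1
      rw [← sub_div, ← add_div, le_div_iff₀ hlam]
      nlinarith
  have hbell : ∀ k ∈ Finset.Icc 1 K, ∑ i ∈ Finset.Ico 1 k,
      ∫ τ, bellmanSq M (run.rew k ω) (run.qfun k ω) τ ∂(trajLaw M (greedy am (run.qfun i ω))) ≤
      4 * run.bellmanEst ω k (run.qfun k ω) + M.H * B := fun k hk => by
    have hr := run.rew_mem k hk ω
    have hf := run.qfun_mem k hk ω
    have hkK := (Finset.mem_Icc.1 hk).2
    calc ∑ i ∈ Finset.Ico 1 k, ∫ τ, bellmanSq M (run.rew k ω) (run.qfun k ω) τ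
          ∂(trajLaw M (greedy am (run.qfun i ω)))
        = ∑ i ∈ Finset.Ico 1 k, ∫ τ, bellmanSq M (run.rew k ω) (run.qfun k ω) τ
          ∂(trajLaw M (run.policy i ω)) := Finset.sum_congr rfl fun i hi => by
            have := Finset.mem_Ico.1 hi
            rw [hpol i (Finset.mem_Icc.2 ⟨by omega, by omega⟩)]
      -- The eluder sum starts at `i = 1`, while the data also contain `τ^0`; adding its nonnegative
      -- term is harmless.
      _ ≤ ∑ i ∈ Finset.range k, ∫ τ, bellmanSq M (run.rew k ω) (run.qfun k ω) τ
          ∂(trajLaw M (run.policy i ω)) :=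
            Finset.sum_le_sum_of_subset_of_nonneg
              (fun i hi => Finset.mem_range.2 (Finset.mem_Ico.1 hi).2)
              fun i _ _ => integral_nonneg fun τ => bellmanSq_nonneg M _ _ τ
      _ = ∑ i ∈ Finset.range k, ∑ h : Fin M.H,
          ∫ τ, bellErr M (run.rew k ω) (run.qfun k ω) h (τ.sa h) ^ 2
            ∂(trajLaw M (run.policy i ω)) := Finset.sum_congr rfl fun i hi => by
            have := Finset.mem_range.1 hi
            have := run.isProbabilityMeasure_policy hS hπ₀ (show i ≤ K by omega) ω
            exact integral_bellmanSq hS hr hf _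
      _ = ∑ h : Fin M.H, ∑ i ∈ Finset.range k,
          ∫ τ, bellErr M (run.rew k ω) (run.qfun k ω) h (τ.sa h) ^ 2
            ∂(trajLaw M (run.policy i ω)) := Finset.sum_comm
      _ ≤ ∑ h : Fin M.H, (4 * ∑ i ∈ Finset.range k,
          excess M (run.rew k ω) (run.qfun k ω) h (run.traj i ω) + B) :=
            Finset.sum_le_sum fun h _ => hB k hk h _ hr _ hf
      _ ≤ _ := by
            rw [Finset.sum_add_distrib, ← Finset.mul_sum, Finset.sum_const, Finset.card_univ,
              Fintype.card_fin, nsmul_eq_mul]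
            have := run.sum_excess_le_bellmanEst hS ω hk hf
            linarith
  have h1 := Finset.sum_le_sum hopt
  have h2 := Finset.sum_le_sum hbell
  rw [Finset.sum_congr rfl fun k hk => by rw [hpol k hk]]
  simp only [Finset.sum_add_distrib, Finset.sum_sub_distrib, Finset.sum_const, Nat.card_Icc,
    Nat.add_sub_cancel, nsmul_eq_mul, ← Finset.mul_sum, ← Finset.sum_div] at h1 h2 hgec ⊢
  have h3 := mul_le_mul_of_nonneg_left h2 (by positivity : 0 ≤ 1 / (2 * lam) / 2)
  have h4 : d / (2 * (1 / (2 * lam))) = d * lam := by field_simp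
  have h5 : 1 / (2 * lam) / 2 * (4 * ∑ k ∈ Finset.Icc 1 K, run.bellmanEst ω k (run.qfun k ω) +
      K * (M.H * B)) = (∑ k ∈ Finset.Icc 1 K, run.bellmanEst ω k (run.qfun k ω)) / lam +
      K * (M.H * (B / 4) / lam) := by
    field_simp
    ring
  have h6 : K * (M.H * B / (2 * lam)) = 2 * (K * (M.H * (B / 4) / lam)) := by
    field_simp; ring
  rw [h4] at hgec
  rw [h5] at h3
  rw [h6]
  linarith

/-- The error of the output policy on the good events. -/
theorem Run.value_sub_outputValue_le (run : Run M R Qc am πE π₀ N K μ) (hS : Setting M R Qc am)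
    (hπE : ∀ h, IsMarkovKernel (πE h)) (hπ₀ : ∀ h, IsMarkovKernel (π₀ h)) (hK : 1 ≤ K)
    {ε d : ℝ} (hε : 0 ≤ ε)
    (hd : gec M R Qc am K ε ≤ d) {lam : ℝ} (hlam : 0 < lam) (ω : Ω) {B a b : ℝ}
    (hB : ∀ k ∈ Finset.Icc 1 K, ∀ h : Fin M.H, ∀ r ∈ prodClass M.H R, ∀ f ∈ prodClass M.H Qc,
        ∑ i ∈ Finset.range k, ∫ τ, bellErr M r f h (τ.sa h) ^ 2 ∂(trajLaw M (run.policy i ω)) ≤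
        4 * ∑ i ∈ Finset.range k, excess M r f h (run.traj i ω) + B)
    (ha : ∀ r ∈ prodClass M.H R, (run.expertEst ω r - run.expertEst ω M.rTrue) -
        (value M πE r - value M πE M.rTrue) ≤ a)
    (hb : ∑ k ∈ Finset.Icc 1 K,
        ((ret M.rTrue 0 (run.traj k ω) - ret (run.rew k ω) 0 (run.traj k ω))
        - (value M (run.policy k ω) M.rTrue - value M (run.policy k ω) (run.rew k ω))) ≤ K * b) :
    value M πE M.rTrue - run.outputValue ω ≤ a + b + run.rewardOptError ω +
      run.qOptError lam ω / lam + M.H * B / (2 * lam) + d * lam / K + √(d * M.H / K) + ε * M.H := by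
  have hK' : (0 : ℝ) < K := by exact_mod_cast hK
  have h1 := run.sum_value_sub_le hS hπE hπ₀ hε hd hlam ω hB
  have h2 := run.sum_rewLoss_sub_le hS ω hS.rTrue
  -- The uniform estimate over the reward class is needed here, because the learned rewards depend
  -- on the expert data.
  have h3 := Finset.sum_le_sum fun k (hk : k ∈ Finset.Icc 1 K) => ha _ (run.rew_mem k hk ω)
  rw [one_div, inv_mul_le_iff₀ hK'] at h2
  have hpol : ∀ k ∈ Finset.Icc 1 K, run.policy k ω = greedy am (run.qfun k ω) := fun k hk => by
    have := (Finset.mem_Icc.1 hk).1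
    rw [policy, if_neg (by omega)]
  have h4 : K * run.outputValue ω =
      ∑ k ∈ Finset.Icc 1 K, value M (run.policy k ω) M.rTrue := by
    rw [run.outputValue_eq hS, ← mul_assoc, mul_one_div_cancel hK'.ne', one_mul]
    exact Finset.sum_congr rfl fun k hk => by rw [hpol k hk]
  have h5 : √(d * M.H * K) = K * √(d * M.H / K) := by
    rw [show d * M.H * K = K ^ 2 * (d * M.H / K) by field_simp, Real.sqrt_mul (by positivity),
      Real.sqrt_sq hK'.le]
  have h6 : d * lam = K * (d * lam / K) := by field_simp
  unfold rewLoss at h2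
  simp only [Finset.sum_sub_distrib, Finset.sum_const, Nat.card_Icc, Nat.add_sub_cancel,
    nsmul_eq_mul] at h1 h2 h3 hb
  rw [h5] at h1
  refine le_of_mul_le_mul_left ?_ hK'
  rw [mul_sub, h4]
  simp only [mul_add]
  linarith

end Combination

/-! ### Sample sizes and constants -/

section Numerics

theorem log_le_div_of_large {x : ℝ} (hx : 4 * 10 ^ 12 ≤ x) : Real.log x ≤ x / 10 ^ 6 := by
  have hxpos : 0 < x := lt_of_lt_of_le (by norm_num) hx
  have hsq : (2 * 10 ^ 6 : ℝ) ≤ √x := by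
    refine Real.le_sqrt_of_sq_le ?_
    norm_num at hx ⊢
    linarith
  have e1 : Real.log x = 2 * Real.log √x := by
    rw [Real.log_sqrt hxpos.le]; ring
  have e2 := Real.log_le_sub_one_of_pos (Real.sqrt_pos.2 hxpos)
  have e3 : √x * √x = x := Real.mul_self_sqrt hxpos.le
  rw [e1, le_div_iff₀ (by norm_num)]
  nlinarith [Real.sqrt_nonneg x]

/-- Each of `H`, `d` and `1 / ε` enters the left-hand ratio with power at most four, and the
remaining factors `n` and `1 / δ` are at least one. -/
theorem log_ratio_le {H d n δ ε : ℝ} (hH : 1 ≤ H) (hd : 1 ≤ d) (hn : 1 ≤ n)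
    (hε0 : 0 < ε) (hε1 : ε ≤ 1) (hδ0 : 0 < δ) (hδ1 : δ ≤ 1) :
    Real.log (H ^ 4 * d / ε ^ 2) ≤ 4 * Real.log (H * d * n / (δ * ε)) := by
  have hH0 : 0 < H := by linarith
  have hd0 : 0 < d := by linarith
  have hn0 : 0 < n := by linarith
  have : (4 : ℝ) * Real.log (H * d * n / (δ * ε)) = Real.log ((H * d * n / (δ * ε)) ^ 4) := by
    rw [Real.log_pow]; norm_num
  rw [this]
  refine Real.log_le_log (by positivity) ?_
  rw [div_pow, mul_pow, mul_pow, mul_pow]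
  have e1 : d ≤ d ^ 4 := le_self_pow₀ hd (by norm_num)
  have e2 : 1 ≤ n ^ 4 := one_le_pow₀ hn
  have e3 : δ ^ 4 * ε ^ 4 ≤ ε ^ 2 := by
    have e4 : δ ^ 4 ≤ 1 := pow_le_one₀ hδ0.le hδ1
    have e5 : ε ^ 4 ≤ ε ^ 2 := pow_le_pow_of_le_one hε0.le hε1 (by norm_num)
    exact (mul_le_of_le_one_left (by positivity) e4).trans e5
  refine div_le_div₀ (by positivity) ?_ (by positivity) e3
  calc H ^ 4 * d ≤ H ^ 4 * d ^ 4 := by gcongr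
    _ ≤ H ^ 4 * d ^ 4 * n ^ 4 := le_mul_of_one_le_right (by positivity) e2

/-- Removes the self-referential `log K` from the sample-size condition. With `x = K / K0`, `log K =
log x + log K0`; the first term is negligible against the large `x`, and the second is at most `4
L0`, which is itself a small multiple of `x`. -/
theorem log_term_le {H d ε K K0 L L0 : ℝ} (hH : 1 ≤ H) (hd : 0 < d) (hε : 0 < ε)
    (hL0 : 0 ≤ L0) (hK0 : K0 = H ^ 4 * d / ε ^ 2) (hK : 10 ^ 13 * (L0 * K0) ≤ K)
    (hKx : 4 * 10 ^ 12 * K0 ≤ K) (hlogK0 : Real.log K0 ≤ 4 * L0)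
    (hL : L ≤ Real.log K + (3 + H) * L0) : d * H ^ 3 * L / K ≤ 2 * ε ^ 2 / 10 ^ 6 := by
  have hH0 : 0 < H := by linarith
  have hK0pos : 0 < K0 := by rw [hK0]; positivity
  have hKpos : 0 < K := lt_of_lt_of_le (by positivity) hKx
  obtain ⟨x, hx⟩ : ∃ x, x = K / K0 := ⟨_, rfl⟩
  have hxge : 4 * 10 ^ 12 ≤ x := by rw [hx, le_div_iff₀ hK0pos]; exact hKx
  have hxpos : 0 < x := lt_of_lt_of_le (by norm_num) hxge
  have hlogK : Real.log K = Real.log x + Real.log K0 := by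
    rw [hx, Real.log_div hKpos.ne' hK0pos.ne']; ring
  have hL0x : L0 ≤ x / 10 ^ 13 := by
    rw [hx, div_div, le_div_iff₀ (by positivity)]
    linarith
  have hlogx := log_le_div_of_large hxge
  have hfin : L ≤ H * x * (2 / 10 ^ 6) := by
    have e2 : L0 ≤ H * L0 := le_mul_of_one_le_left hL0 hH
    have e3 : H * L0 ≤ H * (x / 10 ^ 13) := mul_le_mul_of_nonneg_left hL0x hH0.le
    have e4 : x ≤ H * x := le_mul_of_one_le_left hxpos.le hH
    linarith
  rw [div_le_iff₀ hKpos]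
  calc d * H ^ 3 * L ≤ d * H ^ 3 * (H * x * (2 / 10 ^ 6)) :=
        mul_le_mul_of_nonneg_left hfin (by positivity)
    _ = 2 * ε ^ 2 / 10 ^ 6 * K := by
        have : H ^ 4 * d * x = ε ^ 2 * K := by rw [hx, hK0]; field_simp
        linear_combination (2 / 10 ^ 6) * this

/-- The assumption `n ≥ 2` bounds the logarithm `L0` below by `log 2`. Absolute constants such as
`log 4` are then absorbed, and `K` is at least a large multiple of `H⁴ d / ε²`. -/
theorem sample_size_bound {H d n δ ε K L : ℝ} (hH : 1 ≤ H) (hd : 1 ≤ d) (hn : 2 ≤ n)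
    (hε0 : 0 < ε) (hε1 : ε ≤ 1) (hδ0 : 0 < δ) (hδ1 : δ ≤ 1)
    (hK : 10 ^ 13 * (H ^ 4 * d * Real.log (H * d * n / (δ * ε)) + H ^ 2 * Real.log (1 / δ)) / ε ^ 2
      ≤ K)
    (hL : L ≤ Real.log 4 + Real.log K + Real.log (H / δ) + H * Real.log n) :
    d * H ^ 3 * L / K ≤ 2 * ε ^ 2 / 10 ^ 6 ∧ 96 * (H ^ 2 * Real.log (4 / δ)) ≤ K * ε ^ 2 ∧
      d * H / K ≤ ε ^ 2 / 10 ^ 6 := by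
  have hH0 : 0 < H := by linarith
  have hd0 : 0 < d := by linarith
  have hn0 : 0 < n := by linarith
  have hδε : δ * ε ≤ 1 := mul_le_one₀ hδ1 hε0.le hε1
  have hδε0 : 0 < δ * ε := by positivity
  obtain ⟨L0, hL0⟩ : ∃ L0, L0 = Real.log (H * d * n / (δ * ε)) := ⟨_, rfl⟩
  rw [← hL0] at hK
  have hHd : 1 ≤ H * d := one_le_mul_of_one_le_of_one_le hH hd
  have hbase : 2 ≤ H * d * n / (δ * ε) := by
    rw [le_div_iff₀ hδε0]
    nlinarith
  have hlog2 : Real.log 2 ≤ L0 := hL0 ▸ Real.log_le_log two_pos hbase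
  have hl2 := Real.log_two_gt_d9
  have hlδ : 0 ≤ Real.log (1 / δ) := Real.log_nonneg (by rw [le_div_iff₀ hδ0]; linarith)
  have hlog4 : Real.log 4 = 2 * Real.log 2 := by
    rw [show (4 : ℝ) = 2 ^ 2 by norm_num, Real.log_pow]; norm_num
  have h1 : Real.log (H / δ) ≤ L0 := by
    rw [hL0]
    refine Real.log_le_log (by positivity) ?_
    rw [div_le_div_iff₀ hδ0 hδε0]
    have : ε ≤ d * n := hε1.trans (by nlinarith)
    nlinarith [mul_le_mul_of_nonneg_left this (by positivity : 0 ≤ H * δ)]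
  have h2 : Real.log n ≤ L0 := by
    rw [hL0]
    refine Real.log_le_log hn0 ?_
    rw [le_div_iff₀ hδε0]
    nlinarith
  obtain ⟨K0, hK0⟩ : ∃ K0, K0 = H ^ 4 * d / ε ^ 2 := ⟨_, rfl⟩
  have hK0pos : 0 < K0 := by rw [hK0]; positivity
  have hKge : 10 ^ 13 * (L0 * K0) ≤ K := by
    refine le_trans ?_ hK
    rw [hK0, ← mul_div_assoc, ← mul_div_assoc]
    gcongr
    nlinarith [mul_nonneg (sq_nonneg H) hlδ]
  have hKx : 4 * 10 ^ 12 * K0 ≤ K := by nlinarith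
  have hKpos : 0 < K := lt_of_lt_of_le (by positivity) hKx
  have hHH : H ^ 2 ≤ H ^ 4 * d := by
    have : H ^ 2 ≤ H ^ 4 := pow_le_pow_right₀ hH (by norm_num)
    nlinarith [pow_pos hH0 4]
  have hKε : 10 ^ 13 * (H ^ 4 * d * L0 + H ^ 2 * Real.log (1 / δ)) ≤ K * ε ^ 2 := by
    rwa [div_le_iff₀ (by positivity)] at hK
  refine ⟨log_term_le hH hd0 hε0 (by linarith) hK0 hKge hKx
    (by rw [hK0, hL0]; exact log_ratio_le hH hd (by linarith) hε0 hε1 hδ0 hδ1) ?_, ?_, ?_⟩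
  · have := mul_le_mul_of_nonneg_left h2 hH0.le
    linarith
  · have e1 : Real.log (4 / δ) = 2 * Real.log 2 + Real.log (1 / δ) := by
      rw [← hlog4, ← Real.log_mul (by norm_num) (by positivity)]
      congr 1; ring
    have e2 : H ^ 2 * Real.log 2 ≤ H ^ 4 * d * L0 := by gcongr
    rw [e1]
    nlinarith [mul_nonneg (sq_nonneg H) hlδ]
  · rw [div_le_iff₀ hKpos]
    have e1 : d * H ≤ H ^ 4 * d := by
      have : H ≤ H ^ 4 := le_self_pow₀ hH (by norm_num)
      nlinarith
    have e2 : H ^ 4 * d * 0.5 ≤ H ^ 4 * d * L0 := by gcongr; linarith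
    nlinarith [mul_nonneg (sq_nonneg H) hlδ]

/-- The chosen `λ` makes `(d λ / K)²` equal to `d H³ L / K + d H³ ρ`, which is of order `ε²`, and
makes the concentration term at most `43` times `d λ / K`. -/
theorem regularized_error_bound {H d ε K L ρ lam : ℝ} (hH : 1 ≤ H) (hd : 1 ≤ d) (hε : 0 < ε)
    (hK : 0 < K) (hL : 0 < L) (hρ : 0 ≤ ρ) (hlam : lam = √((K * H ^ 3 * L + K ^ 2 * H ^ 3 * ρ) / d))
    (h1 : d * H ^ 3 * L / K ≤ 2 * ε ^ 2 / 10 ^ 6) (h2 : d * H ^ 3 * ρ ≤ ε ^ 2 / 10 ^ 6) :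
    0 < lam ∧
      H * (4 * H ^ 2 * L + 86 * H * ρ * K) / (2 * lam) + d * lam / K ≤ ε / 6 := by
  have hH0 : 0 < H := by linarith
  have hd0 : 0 < d := by linarith
  have hpos : 0 < (K * H ^ 3 * L + K ^ 2 * H ^ 3 * ρ) / d := by positivity
  have hl : 0 < lam := by rw [hlam]; exact Real.sqrt_pos.2 hpos
  have hsq : lam ^ 2 = (K * H ^ 3 * L + K ^ 2 * H ^ 3 * ρ) / d := by
    rw [hlam]; exact Real.sq_sqrt hpos.le
  refine ⟨hl, ?_⟩
  have e1 : d * lam / K ≤ ε / 500 := by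
    refine (sq_le_sq₀ (by positivity) (by positivity)).1 ?_
    have : (d * lam / K) ^ 2 = d * H ^ 3 * L / K + d * H ^ 3 * ρ := by
      rw [div_pow, mul_pow, hsq]; field_simp
    rw [this, div_pow]
    nlinarith
  have e2 : H * (4 * H ^ 2 * L + 86 * H * ρ * K) / (2 * lam) ≤ 43 * (d * lam / K) := by
    rw [div_le_iff₀ (by positivity)]
    have e3 : 43 * (d * lam / K) * (2 * lam) = 86 * (H ^ 3 * L + H ^ 3 * ρ * K) := by
      calc 43 * (d * lam / K) * (2 * lam) = 86 * d / K * lam ^ 2 := by ring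
        _ = _ := by rw [hsq]; field_simp
    rw [e3]
    have e4 : H ^ 2 ≤ H ^ 3 := pow_le_pow_right₀ hH (by norm_num)
    have e5 : 0 ≤ H ^ 3 * L := by positivity
    nlinarith [mul_le_mul_of_nonneg_right e4 (by positivity : 0 ≤ ρ * K)]
  linarith

end Numerics

/-! ### Covering numbers of the given classes -/

section Covering

theorem one_le_covNProd {S A : Type*} {ρ : ℝ} (hρ : 0 ≤ ρ) {H : ℕ} {F : ℕ → Set (S × A → ℝ)}
    (hF : ∀ h < H, coveringNumber ρ (F h) ≠ ⊤) (hne : (prodClass H F).Nonempty) :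
    1 ≤ covNProd ρ (prodClass H F) := by
  obtain ⟨⟨T, -, hcov, hcard⟩, -⟩ := exists_cover_prodClass hρ hF
  obtain ⟨f, hf⟩ := hne
  obtain ⟨f', hf', -⟩ := hcov f hf
  rw [← hcard]
  exact Finset.card_pos.2 ⟨f', hf'⟩

variable {S A : Type*} [MeasurableSpace S] [MeasurableSpace A]
  {M : MDP S A} {R Qc : ℕ → Set (S × A → ℝ)} {am : (S × A → ℝ) → S → A} {ρ : ℝ}

theorem Setting.one_le_covN_rew (hS : Setting M R Qc am) {h : ℕ} (hh : h < M.H)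
    (hR : coveringNumber ρ (R h) ≠ ⊤) : 1 ≤ covN ρ (R h) :=
  one_le_covN hR ⟨_, hS.rTrue.1 h hh⟩

theorem Setting.one_le_covN_q (hS : Setting M R Qc am) {h : ℕ} (hh : h < M.H)
    (hQ : coveringNumber ρ (Qc h) ≠ ⊤) : 1 ≤ covN ρ (Qc h) :=
  one_le_covN hQ ⟨_, hS.real _ hS.rTrue h hh⟩

theorem covN_le_maxCovR {h : ℕ} (hh : h < M.H) : covN ρ (R h) ≤ maxCovR M R ρ :=
  Finset.le_sup (f := fun h => covN ρ (R h)) (Finset.mem_range.2 hh)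

theorem covN_mul_le_maxCovQR {h : ℕ} (hh : h < M.H) :
    covN ρ (Qc h) * covN ρ (R h) ≤ maxCovQR M R Qc ρ :=
  Finset.le_sup (f := fun h => covN ρ (Qc h) * covN ρ (R h)) (Finset.mem_range.2 hh)

/-- Turns the logarithm of the product covering numbers in `λ` into `H` times the logarithm of the
stepwise maximum appearing in the condition on `K`. -/
theorem covNProd_mul_le (hρ : 0 ≤ ρ) (hR : ∀ h < M.H, coveringNumber ρ (R h) ≠ ⊤)
    (hQ : ∀ h < M.H, coveringNumber ρ (Qc h) ≠ ⊤) :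
    covNProd ρ (prodClass M.H Qc) * covNProd ρ (prodClass M.H R) ≤ maxCovQR M R Qc ρ ^ M.H := by
  refine (Nat.mul_le_mul (exists_cover_prodClass hρ hQ).2 (exists_cover_prodClass hρ hR).2).trans ?_
  rw [← Finset.prod_mul_distrib]
  refine (Finset.prod_le_prod' fun h hh =>
    covN_mul_le_maxCovQR (M := M) (R := R) (Qc := Qc) (Finset.mem_range.1 hh)).trans_eq ?_
  simp

end Covering

/-! ### Degenerate classes and the expert sample size -/

section Main

theorem abs_ret_sub_le {S A : Type*} {r r' : ℕ → S × A → ℝ} {b : ℝ} {H : ℕ}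
    (h : ∀ j < H, ∀ x, |r j x - r' j x| ≤ b) (τ : Traj S A H) :
    |ret r 0 τ - ret r' 0 τ| ≤ H * b := by
  unfold ret
  rw [← Finset.sum_sub_distrib]
  refine (Finset.abs_sum_le_sum_abs _ _).trans
    ((Finset.sum_le_sum fun (j : Fin H) _ => h (0 + j) (by have := j.2; omega) _).trans ?_)
  simp

variable {S A : Type*} [MeasurableSpace S] [MeasurableSpace A]
  {M : MDP S A} {R Qc : ℕ → Set (S × A → ℝ)} {am : (S × A → ℝ) → S → A}
  {πE π₀ : Policy S A} {N K : ℕ} {Ω : Type*} {mΩ : MeasurableSpace Ω} {μ : Measure Ω} {ρ : ℝ}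

theorem Run.abs_expertEst_sub_le (run : Run M R Qc am πE π₀ N K μ) (ω : Ω) {b : ℝ}
    {r r' : ℕ → S × A → ℝ} (hb : 0 ≤ b) (h : ∀ τ : Traj S A M.H, |ret r 0 τ - ret r' 0 τ| ≤ b) :
    |run.expertEst ω r - run.expertEst ω r'| ≤ b := by
  unfold expertEst
  rw [← mul_sub, ← Finset.sum_sub_distrib, abs_mul, abs_of_nonneg (by positivity), one_div]
  have h1 : |∑ j, (ret r 0 (run.expert j ω) - ret r' 0 (run.expert j ω))| ≤ N * b :=
    (Finset.abs_sum_le_sum_abs _ _).trans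
      ((Finset.sum_le_sum fun j _ => h (run.expert j ω)).trans (by simp))
  rcases Nat.eq_zero_or_pos N with rfl | hN
  · simpa using hb
  · rw [inv_mul_le_iff₀ (by exact_mod_cast hN)]
    exact h1

theorem abs_value_sub_le (hS : Setting M R Qc am) {π : Policy S A}
    (hπ : ∀ h < M.H, IsMarkovKernel (π h)) {r r' : ℕ → S × A → ℝ}
    (hr : r ∈ prodClass M.H R) (hr' : r' ∈ prodClass M.H R) {b : ℝ}
    (h : ∀ τ : Traj S A M.H, |ret r 0 τ - ret r' 0 τ| ≤ b) :
    |value M π r - value M π r'| ≤ b := by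
  have := isProbabilityMeasure_trajLaw hπ
  unfold value
  rw [← integral_sub (hS.integrable_ret hr _) (hS.integrable_ret hr' _)]
  exact abs_integral_le_of_abs_le h

/-- If the classes are covered by single points, the bound holds surely. -/
theorem Run.value_sub_outputValue_le_of_maxCovQR_eq_one (run : Run M R Qc am πE π₀ N K μ)
    (hS : Setting M R Qc am) (hπE : ∀ h, IsMarkovKernel (πE h)) (hK : 1 ≤ K)
    (hR : ∀ h < M.H, coveringNumber ρ (R h) ≠ ⊤) (hQ : ∀ h < M.H, coveringNumber ρ (Qc h) ≠ ⊤)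
    (hρ : 0 ≤ ρ) (h1 : maxCovQR M R Qc ρ = 1) {lam : ℝ} (hlam : 0 ≤ lam) (ω : Ω) :
    value M πE M.rTrue - run.outputValue ω ≤
      8 * M.H * ρ + run.rewardOptError ω + run.qOptError lam ω / lam := by
  have hH : (1 : ℝ) ≤ M.H := by exact_mod_cast hS.one_le
  have hK' : (0 : ℝ) < K := by exact_mod_cast hK
  have hcov : ∀ h < M.H, covN ρ (Qc h) = 1 ∧ covN ρ (R h) = 1 := fun h hh => by
    have e1 := covN_mul_le_maxCovQR (M := M) (R := R) (Qc := Qc) (ρ := ρ) hh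
    rw [h1] at e1
    have e2 := hS.one_le_covN_q hh (hQ h hh)
    have e3 := hS.one_le_covN_rew hh (hR h hh)
    have e4 : covN ρ (Qc h) * covN ρ (R h) = 1 := le_antisymm e1 (Nat.mul_pos e2 e3)
    exact ⟨Nat.eq_one_of_mul_eq_one_right e4, Nat.eq_one_of_mul_eq_one_left e4⟩
  have hopt := optQ_mem hS hS.rTrue
  have hval : ∀ k ∈ Finset.Icc 1 K, value M πE M.rTrue - 4 * M.H * ρ ≤
      value M (greedy am (run.qfun k ω)) M.rTrue := fun k hk => by
    have hf := run.qfun_mem k hk ω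
    -- In a class covered by one ball, `Q^k` is within `2ρ` of its backup under the true reward and
    -- of the optimal Q-function. So its greedy policy loses at most `2Hρ + 2ρ`, whatever the data.
    have e1 := maxA_le_stepValue_add hS hS.rTrue hf (π := greedy am (run.qfun k ω))
      (fun h _ => rfl) (b := 2 * ρ) (fun h hh x => by
        have := (abs_le.1 (abs_sub_le_of_covN_eq_one (hQ h hh) (hcov h hh).1 (hf.1 h hh)
          (hS.compl _ hS.rTrue _ hf h hh) x)).2
        linarith) M.H 0 (by omega) M.s₁
    have e2 := value_le_maxA_optQ hS hS.rTrue hπE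
    have e3 := (abs_le.1 (hS.abs_maxA_sub_le hopt hf (h := 0) (fun x =>
      abs_sub_le_of_covN_eq_one (hQ 0 hS.one_le) (hcov 0 hS.one_le).1 (hopt.1 0 hS.one_le)
        (hf.1 0 hS.one_le) x) M.s₁)).2
    rw [← value_eq_stepValue] at e1
    nlinarith
  have hreg := run.sum_rewLoss_sub_le hS ω hS.rTrue
  -- The optimisation error of the reward may be negative, so it must be bounded below before it can
  -- be added to the right-hand side.
  have hloss : ∀ k ∈ Finset.Icc 1 K, -(4 * M.H * ρ) ≤
      run.rewLoss ω k (run.rew k ω) - run.rewLoss ω k M.rTrue := fun k hk => by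
    have hr := run.rew_mem k hk ω
    have hd := abs_ret_sub_le (r := run.rew k ω) (r' := M.rTrue) (b := 2 * ρ) (H := M.H)
      fun h hh x => abs_sub_le_of_covN_eq_one (hR h hh) (hcov h hh).2 (hr.1 h hh)
        (hS.rTrue.1 h hh) x
    have e1 := (abs_le.1 (hd (run.traj k ω))).1
    have e2 := (abs_le.1 (run.abs_expertEst_sub_le ω (by positivity) hd)).2
    unfold rewLoss
    linarith
  have hreg' := Finset.sum_le_sum hloss
  have hout := Finset.sum_le_sum hval
  rw [Finset.sum_const, Nat.card_Icc, Nat.add_sub_cancel, nsmul_eq_mul] at hreg' hout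
  have e1 : -(4 * M.H * ρ) ≤ run.rewardOptError ω := by
    refine le_trans ?_ hreg
    rw [one_div, le_inv_mul_iff₀ hK']
    exact hreg'
  have e2 : value M πE M.rTrue - 4 * M.H * ρ ≤ run.outputValue ω := by
    rw [run.outputValue_eq hS, one_div, le_inv_mul_iff₀ hK']
    exact hout
  have e3 : 0 ≤ run.qOptError lam ω / lam := div_nonneg (run.qOptError_nonneg hS hlam ω hK) hlam
  linarith

theorem Run.measure_expert_le_delta [IsProbabilityMeasure μ] (run : Run M R Qc am πE π₀ N K μ)
    (hS : Setting M R Qc am) (hπE : ∀ h, IsMarkovKernel (πE h))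
    (hR : ∀ h < M.H, coveringNumber ρ (R h) ≠ ⊤) (hρ : 0 ≤ ρ) {ε δ : ℝ} (hε : 0 < ε)
    (hδ0 : 0 < δ) (hδ1 : δ ≤ 1) (hρε : 48 * M.H * ρ ≤ ε)
    (hN : 384 * ((M.H : ℝ) ^ 2 * Real.log (maxCovR M R ρ / δ)) / ε ^ 2 ≤ N) :
    μ {ω | ¬ ∀ r ∈ prodClass M.H R, (run.expertEst ω r - run.expertEst ω M.rTrue) -
        (value M πE r - value M πE M.rTrue) ≤ ε / 6} ≤ ENNReal.ofReal (δ / 4) := by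
  have hH : (1 : ℝ) ≤ M.H := by exact_mod_cast hS.one_le
  have hH0 : (0 : ℝ) < M.H := by linarith
  have hmax : 1 ≤ maxCovR M R ρ :=
    (hS.one_le_covN_rew hS.one_le (hR 0 hS.one_le)).trans (covN_le_maxCovR hS.one_le)
  -- With a single centre, `log (1 / δ)` need not dominate `log 4`, so no concentration is
  -- available; but then all rewards agree up to `2ρ` and the deviation is at most `4Hρ`.
  rcases hmax.eq_or_lt with h1 | h2
  · refine le_trans (measure_mono_null (fun ω hω => ?_) measure_empty).le zero_le
    refine hω fun r hr => ?_
    have hd := abs_ret_sub_le (r := r) (r' := M.rTrue) (b := 2 * ρ) (H := M.H)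
      fun h hh x => abs_sub_le_of_covN_eq_one (hR h hh) (le_antisymm
        (h1 ▸ covN_le_maxCovR hh) (hS.one_le_covN_rew hh (hR h hh))) (hr.1 h hh)
        (hS.rTrue.1 h hh) x
    have e1 := (abs_le.1 (run.abs_expertEst_sub_le ω (by positivity) hd)).2
    have e2 := (abs_le.1 (abs_value_sub_le hS (fun h _ => hπE h) hr hS.rTrue hd)).1
    linarith
  · have hm2 : (2 : ℝ) ≤ maxCovR M R ρ := by exact_mod_cast h2
    obtain ⟨n, hn⟩ : ∃ n : ℝ, n = maxCovR M R ρ := ⟨_, rfl⟩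
    rw [← hn] at hm2 hN
    have hlog2 := Real.log_two_gt_d9
    have hlogn : Real.log 2 ≤ Real.log (n / δ) := Real.log_le_log two_pos (by
      rw [le_div_iff₀ hδ0]; linarith)
    have hNpos : (0 : ℝ) < N := lt_of_lt_of_le (by
      have : 0 < Real.log (n / δ) := by linarith
      positivity) hN
    -- As `n ≥ 2`, `log (4n / δ) ≤ 3 log (n / δ)`. With `e = ε / (8H)` the exponent is `N ε² / (128
    -- H²)`, whence `384 = 3 · 128`. The deviation is then `ε / 8 + 2Hρ ≤ ε / 6`.
    have hlog : Real.log (4 * n / δ) ≤ N * (ε / (8 * M.H)) ^ 2 / 2 := by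
      have e1 : Real.log (4 * n / δ) = 2 * Real.log 2 + Real.log (n / δ) := by
        rw [mul_div_assoc, Real.log_mul (by norm_num) (by positivity),
          show (4 : ℝ) = 2 ^ 2 by norm_num, Real.log_pow]
        norm_num
      rw [div_le_iff₀ (by positivity)] at hN
      have e2 : N * (ε / (8 * M.H)) ^ 2 / 2 = N * ε ^ 2 / (128 * (M.H : ℝ) ^ 2) := by
        field_simp; norm_num
      rw [e1, e2, le_div_iff₀ (by positivity)]
      nlinarith [mul_le_mul_of_nonneg_left hlogn (sq_nonneg (M.H : ℝ))]
    refine (measure_mono ?_).trans ((run.measure_expert_le hS hπE (by exact_mod_cast hNpos) hR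
        (e := ε / (8 * M.H)) (by positivity)).trans (ENNReal.ofReal_le_ofReal ?_))
    · intro ω hω hall
      refine hω fun r hr => (hall r hr).trans ?_
      have : M.H * (ε / (8 * M.H)) = ε / 8 := by field_simp
      rw [this]
      linarith
    · rw [← hn]
      calc n * Real.exp (-(N * (ε / (8 * M.H)) ^ 2 / 2))
          ≤ n * Real.exp (-Real.log (4 * n / δ)) := by gcongr
        _ = δ / 4 := by
          rw [Real.exp_neg, Real.exp_log (by positivity)]
          field_simp

end Main

end OptAIL

/-! ### The main theorem -/

open OptAIL in
theorem mainTheorem1 :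
    ∃ c₁ > (0 : ℝ), ∃ c₂ > (0 : ℝ), ∃ C > (0 : ℝ),
      ∀ (S A : Type*) [MeasurableSpace S] [MeasurableSpace A] (M : MDP S A), 1 ≤ M.H →
      ∀ (R Qc : ℕ → Set (S × A → ℝ)), IsRewardClass M R → IsQClass M Qc →
      -- realizability of the reward class, realizability and completeness of the Q-class
      M.rTrue ∈ prodClass M.H R → QRealizable M R Qc → BellmanComplete M R Qc →
      ∀ (am : (S × A → ℝ) → S → A), IsArgmaxRule M Qc am →
      ∀ (πE π₀ : Policy S A), (∀ h, IsMarkovKernel (πE h)) → (∀ h, IsMarkovKernel (π₀ h)) →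
      ∀ (ε δ : ℝ), 0 < ε → ε ≤ 1 → 0 < δ → δ ≤ 1 →
      ∀ (N K : ℕ) (d : ℝ), 1 ≤ d → gec M R Qc am K (ε / (6 * M.H)) ≤ d →
      ∀ ρ : ℝ, ρ = c₂ * ε ^ 2 / ((M.H : ℝ) ^ 3 * d + M.H) →
      (∀ h < M.H, coveringNumber ρ (R h) ≠ ⊤ ∧ coveringNumber ρ (Qc h) ≠ ⊤) →
      C * ((M.H : ℝ) ^ 2 * Real.log (maxCovR M R ρ / δ)) / ε ^ 2 ≤ N →
      C * ((M.H : ℝ) ^ 4 * d * Real.log (M.H * d * maxCovQR M R Qc ρ / (δ * ε))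
          + (M.H : ℝ) ^ 2 * Real.log (1 / δ)) / ε ^ 2 ≤ K →
      ∀ lam : ℝ, lam = lambdaQ M R Qc c₁ ρ d δ K →
      ∀ (Ω : Type*) [MeasurableSpace Ω] (μ : Measure Ω) [IsProbabilityMeasure μ]
        (run : Run M R Qc am πE π₀ N K μ),
        -- the failure event has probability at most `δ`
        μ {ω | ¬ (value M πE M.rTrue - run.outputValue ω ≤
            ε + run.rewardOptError ω + run.qOptError lam ω / lam)} ≤ ENNReal.ofReal δ := by
  refine ⟨1, one_pos, 1 / 10 ^ 6, by norm_num, 10 ^ 13, by norm_num, ?_⟩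
  intro S A _ _ M hH1 R Qc hrew hqcl hrT hreal hcompl am ham πE π₀ hπE hπ₀ ε δ hε0 hε1 hδ0 hδ1 N K d
    hd1 hgec ρ hρ hcov hN hK lam hlam Ω _ μ _ run
  have hS : Setting M R Qc am := ⟨hH1, hrew, hqcl, hrT, hreal, hcompl, ham⟩
  have hR : ∀ h < M.H, coveringNumber ρ (R h) ≠ ⊤ := fun h hh => (hcov h hh).1
  have hQ : ∀ h < M.H, coveringNumber ρ (Qc h) ≠ ⊤ := fun h hh => (hcov h hh).2
  have hH : (1 : ℝ) ≤ M.H := by exact_mod_cast hH1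
  have hH0 : (0 : ℝ) < M.H := by linarith
  have hd0 : 0 < d := by linarith
  -- For `δ = 1` the claim is trivial. Otherwise `log (1 / δ) > 0`, which forces `K ≥ 1` even when
  -- the other logarithm vanishes.
  rcases hδ1.eq_or_lt with rfl | hδlt
  · simpa using prob_le_one
  have hρ0 : 0 ≤ ρ := by rw [hρ]; positivity
  have hHρ : M.H * ρ ≤ ε ^ 2 / 10 ^ 6 := by
    rw [hρ, ← mul_div_assoc, div_le_iff₀ (by positivity)]
    nlinarith [mul_nonneg (mul_nonneg (pow_nonneg hH0.le 3) hd0.le) (sq_nonneg ε)]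
  have hdHρ : d * (M.H : ℝ) ^ 3 * ρ ≤ ε ^ 2 / 10 ^ 6 := by
    rw [hρ, ← mul_div_assoc, div_le_iff₀ (by positivity)]
    nlinarith [mul_nonneg hH0.le (sq_nonneg ε)]
  have hε2 : ε ^ 2 ≤ ε := by nlinarith
  have hmax : 1 ≤ maxCovQR M R Qc ρ :=
    (Nat.mul_pos (hS.one_le_covN_q hH1 (hQ 0 hH1)) (hS.one_le_covN_rew hH1 (hR 0 hH1))).trans_le
      (covN_mul_le_maxCovQR hH1)
  have hmax' : (1 : ℝ) ≤ maxCovQR M R Qc ρ := by exact_mod_cast hmax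
  have hlogδ : 0 < Real.log (1 / δ) := Real.log_pos (by rw [lt_div_iff₀ hδ0]; linarith)
  have hK1 : 1 ≤ K := by
    have h1 : 0 ≤ Real.log (M.H * d * maxCovQR M R Qc ρ / (δ * ε)) := by
      refine Real.log_nonneg ?_
      rw [le_div_iff₀ (by positivity), one_mul]
      refine (mul_le_one₀ hδ1 hε0.le hε1).trans ?_
      exact one_le_mul_of_one_le_of_one_le (one_le_mul_of_one_le_of_one_le hH hd1) hmax'
    have h2 : (0 : ℝ) < K := lt_of_lt_of_le (by positivity) hK
    exact_mod_cast h2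
  have hK0 : (0 : ℝ) < K := by exact_mod_cast hK1
  have hK1' : (1 : ℝ) ≤ K := by exact_mod_cast hK1
  rcases hmax.eq_or_lt with h1 | h2
  · refine le_trans (measure_mono_null (fun ω hω => ?_) measure_empty).le zero_le
    have hl : 0 ≤ lam := by rw [hlam, lambdaQ]; positivity
    have := run.value_sub_outputValue_le_of_maxCovQR_eq_one hS hπE hK1 hR hQ hρ0 h1.symm hl ω
    refine hω (this.trans ?_)
    linarith
  · have hm2 : (2 : ℝ) ≤ maxCovQR M R Qc ρ := by exact_mod_cast h2
    have hnQ : (1 : ℝ) ≤ covNProd ρ (prodClass M.H Qc) := by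
      exact_mod_cast one_le_covNProd hρ0 hQ ⟨_, optQ_mem hS hrT⟩
    have hnR : (1 : ℝ) ≤ covNProd ρ (prodClass M.H R) := by
      exact_mod_cast one_le_covNProd hρ0 hR ⟨_, hrT⟩
    have hnn : (covNProd ρ (prodClass M.H Qc) : ℝ) * covNProd ρ (prodClass M.H R) ≤
        (maxCovQR M R Qc ρ : ℝ) ^ M.H := by exact_mod_cast covNProd_mul_le hρ0 hR hQ
    rw [lambdaQ, one_mul] at hlam
    obtain ⟨nQ, hnQdef⟩ : ∃ x : ℝ, x = covNProd ρ (prodClass M.H Qc) := ⟨_, rfl⟩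
    obtain ⟨nR, hnRdef⟩ : ∃ x : ℝ, x = covNProd ρ (prodClass M.H R) := ⟨_, rfl⟩
    rw [← hnQdef, ← hnRdef] at hlam hnn
    rw [← hnQdef] at hnQ
    rw [← hnRdef] at hnR
    obtain ⟨L, hL⟩ : ∃ L, L = Real.log (4 * K * M.H * nQ * nR / δ) := ⟨_, rfl⟩
    rw [← hL] at hlam
    have hnQ0 : 0 < nQ := by linarith
    have hnR0 : 0 < nR := by linarith
    have hLle : L ≤ Real.log 4 + Real.log K + Real.log (M.H / δ) +
        M.H * Real.log (maxCovQR M R Qc ρ) := by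
      rw [hL, show 4 * (K : ℝ) * M.H * nQ * nR / δ = 4 * K * (M.H / δ) * (nQ * nR) by ring,
        Real.log_mul (by positivity) (by positivity), Real.log_mul (by positivity) (by positivity),
        Real.log_mul (by norm_num) hK0.ne', ← Real.log_pow]
      have := Real.log_le_log (by positivity) hnn
      linarith
    have hLpos : 0 < L := by
      rw [hL]
      refine Real.log_pos ?_
      rw [lt_div_iff₀ hδ0, one_mul]
      have e1 : 1 ≤ (K : ℝ) * M.H * nQ * nR :=
        one_le_mul_of_one_le_of_one_le (one_le_mul_of_one_le_of_one_le
          (one_le_mul_of_one_le_of_one_le hK1' hH) hnQ) hnR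
      linarith
    obtain ⟨hb1, hb2, hb3⟩ := sample_size_bound hH hd1 hm2 hε0 hε1 hδ0 hδ1 hK hLle
    obtain ⟨hlam0, hreg⟩ := regularized_error_bound hH hd1 hε0 hK0 hLpos hρ0 hlam hb1 hdHρ
    have hsqrt : √(d * M.H / K) ≤ ε / 6 := by
      refine Real.sqrt_le_iff.2 ⟨by positivity, hb3.trans ?_⟩
      rw [div_pow]
      nlinarith [sq_nonneg ε]
    have hE1 := run.measure_bellman_le hS hπ₀ hρ0 hR hQ L
    -- With this `t`, the two terms of the deviation are `K ε / 8` and at most `K ε / 24`, together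
    -- at most `K ε / 6`.
    have hE2 := run.measure_return_le hS hπ₀ (t := ε / (4 * (M.H : ℝ) ^ 2)) (by positivity)
      (Real.log (4 / δ))
    have hE3 := run.measure_expert_le_delta hS hπE hR hρ0 hε0 hδ0 hδ1 (by linarith)
      (le_trans (by
        have e1 : 0 ≤ Real.log (maxCovR M R ρ / δ) := by
          refine Real.log_nonneg ?_
          have : (1 : ℝ) ≤ maxCovR M R ρ := by
            exact_mod_cast (hS.one_le_covN_rew hH1 (hR 0 hH1)).trans (covN_le_maxCovR hH1)
          rw [le_div_iff₀ hδ0]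
          linarith
        gcongr
        norm_num) hN)
    rw [← hnQdef, ← hnRdef] at hE1
    have hp1 : K * M.H * nQ * nR * Real.exp (-L) = δ / 4 := by
      rw [hL, Real.exp_neg, Real.exp_log (by positivity)]
      field_simp
    have hp2 : Real.exp (-Real.log (4 / δ)) = δ / 4 := by
      rw [Real.exp_neg, Real.exp_log (by positivity), inv_div]
    rw [hp1] at hE1
    rw [hp2] at hE2
    refine (measure_mono ?_).trans ((measure_union_le _ _).trans ((add_le_add
      ((measure_union_le _ _).trans (add_le_add hE1 hE2)) hE3).trans ?_))
    · intro ω hω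
      by_contra hcon
      simp only [Set.mem_union, not_or, Set.mem_ofPred_eq, not_not] at hcon
      obtain ⟨⟨hg1, hg2⟩, hg3⟩ := hcon
      have hb : ε / (4 * (M.H : ℝ) ^ 2) * K * (M.H : ℝ) ^ 2 / 2 +
          Real.log (4 / δ) / (ε / (4 * (M.H : ℝ) ^ 2)) ≤ K * (ε / 6) := by
        have e1 : ε / (4 * (M.H : ℝ) ^ 2) * K * (M.H : ℝ) ^ 2 / 2 = K * ε / 8 := by
          field_simp; norm_num
        have e2 : Real.log (4 / δ) / (ε / (4 * (M.H : ℝ) ^ 2)) ≤ K * ε / 24 := by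
          rw [div_le_iff₀ (by positivity)]
          have : K * ε / 24 * (ε / (4 * (M.H : ℝ) ^ 2)) = K * ε ^ 2 / (96 * (M.H : ℝ) ^ 2) := by
            field_simp; norm_num
          rw [this, le_div_iff₀ (by positivity)]
          linarith
        rw [e1]
        linarith
      have hfin := run.value_sub_outputValue_le hS hπE hπ₀ hK1 (by positivity) hgec hlam0 ω
        (B := 4 * (M.H : ℝ) ^ 2 * L + 86 * M.H * ρ * K) (fun k hk h r hr f hf =>
          (hg1 k hk h r hr f hf).trans (by
            have : (k : ℝ) ≤ K := by exact_mod_cast (Finset.mem_Icc.1 hk).2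
            gcongr)) hg3 (hg2.trans hb)
      have hgecε : ε / (6 * M.H) * M.H = ε / 6 := by field_simp
      rw [hgecε] at hfin
      -- Five contributions of at most `ε / 6` each: expert estimates, returns, regularised Bellman
      -- error, the square root, and the slack of the eluder coefficient.
      exact hω (by linarith)
    · rw [← ENNReal.ofReal_add (by positivity) (by positivity),
        ← ENNReal.ofReal_add (by positivity) (by positivity)]
      exact ENNReal.ofReal_le_ofReal (by linarith)
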